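/- Let $\Omega\subset\mathbb C$ be a bounded domain whose boundary has finitely many connected components, let $\Gamma_0,\dots,\Gamma_n$ be its non-degenerate boundary components (the connected components of $\partial\Omega$ that are not single points), and let $K_k$ be the connected component of $\mathbb C\setminus\Omega$ bounded by $\Gamma_k$; the labelling is such that $K_0$ is unbounded. Put $\omega_j(z):=\omega_\Omega(z,\Gamma_j)$, where $\omega_\Omega(z,\cdot)$ is the harmonic measure of $\Omega$ at $z\in\Omega$, and $$\lambda_{jk}:=\frac1{2\pi}\int_{\partial D_k}\frac{\partial\omega_j}{\partial \mathrm n}\,\mathrm ds,$$ where $D_k$ is any (for $k=0$ unbounded) Jordan domain with $C^1$-smooth boundary $\partial D_k\subset\Omega$ such that $D_k\cap(\mathbb C\setminus\Omega)=K_k$, and $\partial/\partial\mathrm n$ is the derivative along the inner normal of $D_k$. For a finite compactly supported positive Borel measure $\mu$ on $\mathbb C$ let $V_\mu(w):=\int\log\frac1{|w-z|}\,\mathrm d\mu(z)$ and let $|\mu|$ be its total mass. Then for each $j=1,\dots,n$ there exist finite positive Borel measures $\mu_{j0},\dots,\mu_{jn}$ supported on $\Gamma_0,\dots,\Gamma_n$,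 respectively, such that $$\omega_j(z)=V_{\mu_{jj}}(z)-\sum_{0\le k\le n,\ k\ne j}V_{\mu_{jk}}(z)\qquad\text{for all }z\in\Omega,\tag{1}$$ and such that $$\operatorname{supp}\mu_{jk}=\Gamma_k,\qquad |\mu_{jk}|=|\lambda_{jk}|\qquad(k=0,\dots,n),$$ $$\lambda_{jj}>0,\qquad \lambda_{jk}<0\quad(k\in\{0,\dots,n\},\ k\neq j).$$ The measures are unique in the following sense: if finite positive Borel measures $\nu_0,\dots,\nu_n$ supported on $\Gamma_0,\dots,\Gamma_n$, respectively, satisfy (1) in place of $\mu_{j0},\dots,\mu_{jn}$, then $\nu_k=\mu_{jk}$ for all $k\ne 0$, and if moreover $|\nu_0|=|\mu_{j0}|$, then also $\nu_0=\mu_{j0}$. In particular, (1) together with the masses $|\mu_{jk}|=|\lambda_{jk}|$ determines all the measures. -/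

import Mathlib

open MeasureTheory Set Filter Topology

noncomputable section

/-- The set of connected components of a subset `S` of the plane. -/
def componentsOf (S : Set ℂ) : Set (Set ℂ) :=
  {C | ∃ x ∈ S, C = connectedComponentIn S x}

/-- `Ω` is a bounded finitely connected plane domain: a bounded, non-empty, connected open set
whose boundary has only finitely many connected components. Components of the boundary that
consist of a single point are allowed. -/
structure IsBoundedFinitelyConnectedDomain (Ω : Set ℂ) : Prop where
  isOpen : IsOpen Ω
  isConnected : IsConnected Ω
  isBounded : Bornology.IsBounded Ω
  finite_components : (componentsOf (frontier Ω)).Finite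

/-- `Γ 0, …, Γ n` are all the non-degenerate boundary components of `Ω` (the connected components
of `∂Ω` that are not singletons), listed without repetition; `K j` is the connected component of
`ℂ ∖ Ω` that is bounded by `Γ j`; and `Γ 0` is the outer boundary, that is, `K 0` is unbounded. -/
structure IsBoundaryLabelling (Ω : Set ℂ) {n : ℕ} (Γ K : Fin (n + 1) → Set ℂ) : Prop where
  injective : Function.Injective Γ
  range_eq : range Γ = {C | C ∈ componentsOf (frontier Ω) ∧ C.Nontrivial}
  component : ∀ j, K j ∈ componentsOf Ωᶜ
  frontier_eq : ∀ j, frontier (K j) = Γ j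
  outer : ¬ Bornology.IsBounded (K 0)

/-- A real-valued function is subharmonic on the open set `Ω` if it is upper semicontinuous and
satisfies the local submean inequality. (Values `-∞` are not needed in the Perron families below:
replacing `u` by `max u c` for a lower bound `c` of the boundary data does not change the
supremum. Integrability over the circles says that the mean value is not `-∞`.) -/
structure IsSubharmonicOn (u : ℂ → ℝ) (Ω : Set ℂ) : Prop where
  usc : UpperSemicontinuousOn u Ω
  submean : ∀ w ∈ Ω, ∃ ρ > 0, ∀ r ∈ Ioo 0 ρ,
    CircleIntegrable u w r ∧ u w ≤ Real.circleAverage u w r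

/-- The Perron family of the boundary function `φ`: the subharmonic functions `u` on `Ω` with
`limsup_{z → ζ} u z ≤ φ ζ` at every boundary point `ζ`. -/
def perronFamily (Ω : Set ℂ) (φ : ℂ → ℝ) : Set (ℂ → ℝ) :=
  {u | IsSubharmonicOn u Ω ∧
    ∀ ζ ∈ frontier Ω, ∀ c, φ ζ < c → ∀ᶠ z in 𝓝[Ω] ζ, u z < c}

/-- The Perron solution `H_Ω φ` of the Dirichlet problem on `Ω` with bounded boundary data `φ`:
the upper envelope of the Perron family. -/
def perronSolution (Ω : Set ℂ) (φ : ℂ → ℝ) (z : ℂ) : ℝ :=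
  sSup {y | ∃ u ∈ perronFamily Ω φ, y = u z}

/-- The harmonic measure `ω_Ω(z, E)` of a Borel set `E ⊆ ∂Ω` at the point `z ∈ Ω`: the value at
`z` of the Perron solution with boundary data `1` on `E` and `0` on `∂Ω ∖ E`. -/
def harmonicMeasure (Ω : Set ℂ) (z : ℂ) (E : Set ℂ) : ℝ :=
  perronSolution Ω (E.indicator fun _ => 1) z

/-- The logarithmic potential `V_μ(w) = ∫ log (1 / |w - z|) dμ(z)`. -/
def logPotential (μ : Measure ℂ) (w : ℂ) : ℝ :=
  ∫ z, Real.log (1 / ‖w - z‖) ∂μ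

/-- `D` is a (bounded or unbounded) Jordan domain with `C¹`-smooth boundary, and `γ`, restricted
to one period, is a regular `C¹` parametrization of the Jordan curve `∂D` for which `D` lies to
the left, i.e. `i γ'(t)` is an inner normal vector of `D` at `γ t`. -/
structure IsC1JordanDomain (D : Set ℂ) (γ : ℝ → ℂ) : Prop where
  isOpen : IsOpen D
  isConnected : IsConnected D
  contDiff : ContDiff ℝ 1 γ
  periodic : Function.Periodic γ 1
  injOn : InjOn γ (Ico 0 1)
  deriv_ne_zero : ∀ t, deriv γ t ≠ 0
  range_eq : range γ = frontier D
  inner_normal : ∀ t, ∀ᶠ ε : ℝ in 𝓝[>] 0, γ t + ε * (Complex.I * deriv γ t) ∈ D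

/-- `D` is an admissible domain for the period associated with the component `K` of `ℂ ∖ Ω`: a
`C¹` Jordan domain with `∂D ⊆ Ω` and `D ∩ (ℂ ∖ Ω) = K`, its boundary being parametrized by `γ`.
(If `Ω` is bounded, then `D` is unbounded exactly when `K` is.) -/
structure IsPeriodContour (Ω K D : Set ℂ) (γ : ℝ → ℂ) : Prop where
  jordan : IsC1JordanDomain D γ
  frontier_subset : frontier D ⊆ Ω
  inter_compl : D ∩ Ωᶜ = K

/-- The period `(1 / 2π) ∫_{∂D} ∂u/∂n ds`, where `∂/∂n` is the derivative along the inner normal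
`n = i γ' / |γ'|` of `D`, `ds = |γ'| dt`, and `γ` parametrizes `∂D` as in `IsC1JordanDomain`. -/
def period (u : ℂ → ℝ) (γ : ℝ → ℂ) : ℝ :=
  1 / (2 * Real.pi) * ∫ t in (0 : ℝ)..1, fderiv ℝ u (γ t) (Complex.I * deriv γ t)

/-- `μ 0, …, μ n` are finite positive Borel measures, `μ k` is supported on `Γ k`, and
`ω_Ω(z, Γ j) = V_{μ j}(z) - ∑_{k ≠ j} V_{μ k}(z)` for all `z ∈ Ω`. -/
structure IsPotentialRepresentation (Ω : Set ℂ) {n : ℕ} (Γ : Fin (n + 1) → Set ℂ)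
    (j : Fin (n + 1)) (μ : Fin (n + 1) → Measure ℂ) : Prop where
  finite : ∀ k, IsFiniteMeasure (μ k)
  support_subset : ∀ k, (μ k).support ⊆ Γ k
  eq_potential : ∀ z ∈ Ω, harmonicMeasure Ω z (Γ j) =
    logPotential (μ j) z - ∑ k ∈ Finset.univ.erase j, logPotential (μ k) z

end

/-! Existence. Let `U` solve the Dirichlet problem off `⋃ k, K k` with the values 1 on `K j` and 0
on the other `K k`, extended to the plane by these values. Every `K k` is a non-degenerate
continuum, so all its points are regular and `U` is continuous. The remaining points of the
complement of `Ω` are finitely many isolated points; they are removable for bounded functions, so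
the harmonic measure of `Γ j` equals `U` on `Ω`. Since `j ≠ 0`, `U` vanishes near infinity. It is
supermean near `K j`, where it attains its maximum, submean near the other `K k`, and has the mean
value property off the sets `Γ k`. Hence its Riesz charge has one sign on each `Γ k`, and `U` is the
potential of that charge. The charge is obtained from circle means alone. The defect `U w -
circleAverage U w r`, divided by a constant times `r ^ 2`, serves as an approximate negative
Laplacian. Averaging over circles is a symmetric operator, and it turns the logarithmic kernel into
itself minus the bump `logBump r`, so integrating the defect against the kernel reproduces averages
of `U` over small discs. The defect has total integral 0 and bounded mass near each `Γ k`; a weak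
limit along an ultrafilter gives the measures (`exists_potential_representation`).

Supports. If `μ k` did not charge a neighbourhood of a point of `Γ k`, the mean value property of
`U` would hold across that point, where `U` attains its maximum 1 or its minimum 0. The minimum
principle would then make `U` constant on the closure of `Ω`, which meets both `K 0` and `K j`.

Periods. Differentiation under the integral and Fubini express the period of a potential as the
integral of a winding number (`period_eq`). The winding number is constant on each `Γ l`, so the
period around `K k` is the signed mass of `μ k`; for `k = 0` this uses that the signed masses add up
to 0. Winding numbers are found without the Jordan curve theorem: the Cauchy integral is locally
constant off the curve, tends to 0 at infinity, and jumps by `2πi` across the curve.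

Uniqueness. For two representations, moving all terms with a minus sign to the other side gives two
positive measures `A`, `B` on `⋃ k, Γ k` whose potentials agree on `Ω`. The equality passes to `∂Ω`
by averaging along points of `Ω` chosen on small circles
(`truncatedPotential_add_le_of_mem_closure`), and from there to the interior of `K k` by a
domination principle proved with balayage (`truncatedPotential_add_le_of_frontier`); in the
unbounded `K 0` equal masses are needed to control infinity. The potentials then agree on a
neighbourhood of `Γ k`, and a potential determines its measure. -/

/-! ### Maximum principle for functions with the local submean property -/

/-- A function satisfies the local submean inequality at a point. -/
def LocalSubmeanAt (g : ℂ → ℝ) (w : ℂ) : Prop :=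
  ∃ ρ > 0, ∀ r ∈ Ioo (0 : ℝ) ρ, CircleIntegrable g w r ∧ g w ≤ Real.circleAverage g w r

theorem circleMap_re (c : ℂ) (r θ : ℝ) : (circleMap c r θ).re = c.re + r * Real.cos θ := by
  simp [circleMap, Complex.exp_re]

/-- The deficit `M - g` is positive on the arc of angles in `(0, π/2)`, a set of positive measure.
Only strictness to the right of the centre is assumed, to suit a rightmost maximum point. -/
theorem circleAverage_lt_of_le_of_lt_right {g : ℂ → ℝ} {w : ℂ} {r M : ℝ} (hr : 0 < r)
    (hi : CircleIntegrable g w r) (hle : ∀ z, g z ≤ M) (hlt : ∀ z, w.re < z.re → g z < M) :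
    Real.circleAverage g w r < M := by
  have h1 : 0 < ∫ θ in (0 : ℝ)..2 * Real.pi, (M - g (circleMap w r θ)) := by
    rw [intervalIntegral.integral_pos_iff_support_of_nonneg_ae]
    · refine ⟨by positivity, ?_⟩
      have hsub : Ioo (0 : ℝ) (Real.pi / 2) ⊆
          (Function.support fun θ => M - g (circleMap w r θ)) ∩ Ioc 0 (2 * Real.pi) := by
        intro θ hθ
        refine ⟨?_, hθ.1, by linarith [hθ.2, Real.pi_pos]⟩
        have hc : 0 < Real.cos θ :=
          Real.cos_pos_of_mem_Ioo ⟨by linarith [hθ.1, Real.pi_pos], hθ.2⟩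
        have := hlt (circleMap w r θ) (by rw [circleMap_re]; nlinarith)
        exact ne_of_gt (by linarith)
      refine lt_of_lt_of_le ?_ (measure_mono hsub)
      simp [Real.volume_Ioo, Real.pi_pos]
    · exact Eventually.of_forall fun θ => by simpa using hle _
    · exact (intervalIntegrable_const).sub hi
  rw [intervalIntegral.integral_sub intervalIntegrable_const hi] at h1
  simp only [intervalIntegral.integral_const, sub_zero, smul_eq_mul] at h1
  rw [Real.circleAverage_def, smul_eq_mul, inv_mul_lt_iff₀ (by positivity)]
  linarith

/-- A positive maximum would be attained on a compact set. At a point of that set with largest real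
part, `g` is strictly smaller to the right, which contradicts the submean inequality there. No
connectedness is involved. -/
theorem nonpos_of_localSubmean {g : ℂ → ℝ} (hg : UpperSemicontinuous g) {R : ℝ}
    (hR : ∀ z, R ≤ ‖z‖ → g z ≤ 0) (hs : ∀ w, 0 < g w → LocalSubmeanAt g w) (z : ℂ) :
    g z ≤ 0 := by
  by_contra! hz
  have hzR : z ∈ Metric.closedBall (0 : ℂ) R := by
    by_contra h
    simp only [Metric.mem_closedBall, dist_zero_right, not_le] at h
    exact absurd (hR z h.le) (not_le.mpr hz)
  obtain ⟨m, hm, hmax⟩ := (hg.upperSemicontinuousOn (Metric.closedBall (0 : ℂ) R)).exists_isMaxOn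
    ⟨z, hzR⟩ (isCompact_closedBall (0 : ℂ) R)
  have hm0 : 0 < g m := hz.trans_le (hmax hzR)
  have hle : ∀ w, g w ≤ g m := by
    intro w
    by_cases hw : w ∈ Metric.closedBall (0 : ℂ) R
    · exact hmax hw
    · simp only [Metric.mem_closedBall, dist_zero_right, not_le] at hw
      exact (hR w hw.le).trans hm0.le
  have hcl : IsClosed {w | g m ≤ g w} := hg.isClosed_preimage (g m)
  have hsub : {w | g m ≤ g w} ⊆ Metric.closedBall (0 : ℂ) R := by
    intro w hw
    by_contra h
    simp only [Metric.mem_closedBall, dist_zero_right, not_le] at h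
    exact absurd (hR w h.le) (not_le.mpr (hm0.trans_le hw))
  have hcomp : IsCompact {w | g m ≤ g w} :=
    (isCompact_closedBall (0 : ℂ) R).of_isClosed_subset hcl hsub
  obtain ⟨p, hp, hpmax⟩ := hcomp.exists_isMaxOn ⟨m, le_refl (g m)⟩ Complex.continuous_re.continuousOn
  have hpe : g p = g m := le_antisymm (hle p) hp
  obtain ⟨ρ, hρ, h⟩ := hs p (by rw [hpe]; exact hm0)
  obtain ⟨hi, hav⟩ := h (ρ / 2) ⟨by linarith, by linarith⟩
  have := circleAverage_lt_of_le_of_lt_right (M := g m) (half_pos hρ) hi hle (by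
    intro w hw
    by_contra! h'
    exact absurd (hpmax h') (not_le.mpr hw))
  linarith

/-- The maximum principle for upper semicontinuous functions with the local submean property. -/
theorem nonpos_of_localSubmeanOn {W : Set ℂ} (hW : IsOpen W) (hb : Bornology.IsBounded W)
    {g : ℂ → ℝ} (hg : UpperSemicontinuousOn g W) (hs : ∀ w ∈ W, LocalSubmeanAt g w)
    (hbd : ∀ ζ ∈ frontier W, ∀ c > 0, ∀ᶠ z in 𝓝[W] ζ, g z < c) :
    ∀ z ∈ W, g z ≤ 0 := by
  classical
  -- The boundary condition makes the positive part, extended by 0, upper semicontinuous on the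
  -- whole plane, so the global version applies.
  set G : ℂ → ℝ := fun z => if z ∈ W then max (g z) 0 else 0 with hG
  have hGW : ∀ z ∈ W, G z = max (g z) 0 := fun z hz => by simp [hG, hz]
  have hGn : ∀ z ∉ W, G z = 0 := fun z hz => by simp [hG, hz]
  have husc : UpperSemicontinuous G := by
    intro ζ c hc
    by_cases hζ : ζ ∈ W
    · rw [hGW ζ hζ] at hc
      have h1 := hg ζ hζ c (lt_of_le_of_lt (le_max_left _ _) hc)
      rw [hW.nhdsWithin_eq hζ] at h1
      filter_upwards [h1, hW.mem_nhds hζ] with z hz hzW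
      rw [hGW z hzW]
      exact max_lt hz (lt_of_le_of_lt (le_max_right _ _) hc)
    · rw [hGn ζ hζ] at hc
      by_cases hcl : ζ ∈ closure W
      · have h1 := hbd ζ ⟨hcl, by rwa [hW.interior_eq]⟩ c hc
        rw [eventually_nhdsWithin_iff] at h1
        filter_upwards [h1] with z hz
        by_cases hzW : z ∈ W
        · rw [hGW z hzW]; exact max_lt (hz hzW) hc
        · rw [hGn z hzW]; exact hc
      · filter_upwards [isClosed_closure.isOpen_compl.mem_nhds hcl] with z hz
        rw [hGn z (fun h => hz (subset_closure h))]; exact hc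
  obtain ⟨R, hR⟩ := hb.subset_ball 0
  have key := nonpos_of_localSubmean (R := R) husc (fun z hz => by
      rw [hGn z]
      intro h
      have := hR h
      simp only [Metric.mem_ball, dist_zero_right] at this
      linarith) (by
    intro w hw
    have hwW : w ∈ W := by
      by_contra h
      rw [hGn w h] at hw
      exact lt_irrefl _ hw
    obtain ⟨ρ, hρ, h⟩ := hs w hwW
    obtain ⟨δ, hδ, hball⟩ := Metric.isOpen_iff.mp hW w hwW
    refine ⟨min ρ δ, lt_min hρ hδ, fun r hr => ?_⟩
    obtain ⟨hi, hav⟩ := h r ⟨hr.1, hr.2.trans_le (min_le_left _ _)⟩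
    have hmem : ∀ z ∈ Metric.sphere w |r|, z ∈ W := fun z hz => hball (by
      rw [abs_of_pos hr.1] at hz
      rw [Metric.mem_ball, Metric.mem_sphere.mp hz]
      exact hr.2.trans_le (min_le_right _ _))
    have hi' : CircleIntegrable (fun z => max (g z) 0) w r := by
      have : (fun θ => max (g (circleMap w r θ)) 0) =
          fun θ => (1 / 2 : ℝ) * (g (circleMap w r θ) + |g (circleMap w r θ)|) := by
        funext θ
        rcases le_total 0 (g (circleMap w r θ)) with h | h
        · rw [max_eq_left h, abs_of_nonneg h]; ring
        · rw [max_eq_right h, abs_of_nonpos h]; ring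
      unfold CircleIntegrable
      rw [this]
      exact (IntervalIntegrable.add hi hi.abs).const_mul _
    have heq : EqOn (fun z => max (g z) 0) G (Metric.sphere w |r|) := fun z hz =>
      (hGW z (hmem z hz)).symm
    have hiG : CircleIntegrable G w r := by
      refine IntervalIntegrable.congr (fun θ _ => ?_) hi'
      exact heq (circleMap_mem_sphere' w r θ)
    refine ⟨hiG, ?_⟩
    rw [← Real.circleAverage_congr_sphere heq, hGW w hwW]
    refine max_le (hav.trans (Real.circleAverage_mono hi hi' fun z _ => le_max_left _ _)) ?_
    exact Real.circleAverage_nonneg_of_nonneg fun z _ => le_max_right _ _)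
  intro z hz
  have := key z
  rw [hGW z hz] at this
  exact (le_max_left _ _).trans this

/-! ### Functions with the mean value property -/

/-- Continuity and the mean value property for all closed discs contained in `S`. -/
structure MeanValueOn (H : ℂ → ℝ) (S : Set ℂ) : Prop where
  continuousOn : ContinuousOn H S
  circleAverage_eq : ∀ w r, 0 ≤ r → Metric.closedBall w r ⊆ S → Real.circleAverage H w r = H w

theorem MeanValueOn.mono {H : ℂ → ℝ} {S T : Set ℂ} (h : MeanValueOn H S) (hT : T ⊆ S) :
    MeanValueOn H T :=
  ⟨h.continuousOn.mono hT, fun w r hr hw => h.circleAverage_eq w r hr (hw.trans hT)⟩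

theorem sphere_abs_subset {w : ℂ} {r : ℝ} (hr : 0 ≤ r) {S : Set ℂ}
    (h : Metric.closedBall w r ⊆ S) : Metric.sphere w |r| ⊆ S := by
  rw [abs_of_nonneg hr]
  exact Metric.sphere_subset_closedBall.trans h

theorem MeanValueOn.congr {H H' : ℂ → ℝ} {S : Set ℂ} (h : MeanValueOn H S) (he : EqOn H' H S) :
    MeanValueOn H' S :=
  ⟨h.continuousOn.congr he, fun w r hr hw => by
    rw [Real.circleAverage_congr_sphere (he.mono (sphere_abs_subset hr hw)),
      h.circleAverage_eq w r hr hw, he (hw (Metric.mem_closedBall_self hr))]⟩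

theorem ContinuousOn.circleIntegrable_of_closedBall_subset {H : ℂ → ℝ} {S : Set ℂ}
    (h : ContinuousOn H S) {w : ℂ} {r : ℝ} (hr : 0 ≤ r) (hw : Metric.closedBall w r ⊆ S) :
    CircleIntegrable H w r :=
  (h.mono (Metric.sphere_subset_closedBall.trans hw)).circleIntegrable hr

theorem MeanValueOn.circleIntegrable {H : ℂ → ℝ} {S : Set ℂ} (h : MeanValueOn H S) {w : ℂ} {r : ℝ}
    (hr : 0 ≤ r) (hw : Metric.closedBall w r ⊆ S) : CircleIntegrable H w r :=
  h.continuousOn.circleIntegrable_of_closedBall_subset hr hw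

theorem MeanValueOn.add {H H' : ℂ → ℝ} {S : Set ℂ} (h : MeanValueOn H S) (h' : MeanValueOn H' S) :
    MeanValueOn (fun z => H z + H' z) S :=
  ⟨h.continuousOn.add h'.continuousOn, fun w r hr hw => by
    rw [Real.circleAverage_fun_add (h.circleIntegrable hr hw) (h'.circleIntegrable hr hw),
      h.circleAverage_eq w r hr hw, h'.circleAverage_eq w r hr hw]⟩

theorem MeanValueOn.const_mul {H : ℂ → ℝ} {S : Set ℂ} (h : MeanValueOn H S) (a : ℝ) :
    MeanValueOn (fun z => a * H z) S :=
  ⟨continuousOn_const.mul h.continuousOn, fun w r hr hw => by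
    have := Real.circleAverage_fun_smul (a := a) (f := H) (c := w) (R := r)
    simp only [smul_eq_mul] at this
    rw [this, h.circleAverage_eq w r hr hw]⟩

theorem meanValueOn_const (a : ℝ) (S : Set ℂ) : MeanValueOn (fun _ => a) S :=
  ⟨continuousOn_const, fun w r _ _ => Real.circleAverage_const a w r⟩

theorem MeanValueOn.neg {H : ℂ → ℝ} {S : Set ℂ} (h : MeanValueOn H S) :
    MeanValueOn (fun z => -H z) S := by
  simpa using h.const_mul (-1)

theorem MeanValueOn.sub {H H' : ℂ → ℝ} {S : Set ℂ} (h : MeanValueOn H S) (h' : MeanValueOn H' S) :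
    MeanValueOn (fun z => H z - H' z) S := by
  simpa [sub_eq_add_neg] using h.add h'.neg

theorem MeanValueOn.sum {ι : Type*} (s : Finset ι) {H : ι → ℂ → ℝ} {S : Set ℂ}
    (h : ∀ i ∈ s, MeanValueOn (H i) S) : MeanValueOn (fun z => ∑ i ∈ s, H i z) S := by
  classical
  induction s using Finset.induction_on with
  | empty => simpa using meanValueOn_const 0 S
  | insert a s ha ih =>
    simp only [Finset.sum_insert ha]
    exact (h a (Finset.mem_insert_self a s)).add
      (ih fun i hi => h i (Finset.mem_insert_of_mem hi))

theorem MeanValueOn.localSubmeanAt {H : ℂ → ℝ} {S : Set ℂ} (h : MeanValueOn H S) {w : ℂ}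
    (hw : S ∈ 𝓝 w) : LocalSubmeanAt H w := by
  obtain ⟨ρ, hρ, hb⟩ := Metric.mem_nhds_iff.mp hw
  refine ⟨ρ, hρ, fun r hr => ?_⟩
  have hs : Metric.closedBall w r ⊆ S := (Metric.closedBall_subset_ball hr.2).trans hb
  exact ⟨h.circleIntegrable hr.1.le hs, (h.circleAverage_eq w r hr.1.le hs).ge⟩

theorem LocalSubmeanAt.add {f g : ℂ → ℝ} {w : ℂ} (hf : LocalSubmeanAt f w)
    (hg : LocalSubmeanAt g w) : LocalSubmeanAt (fun z => f z + g z) w := by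
  obtain ⟨ρ, hρ, h⟩ := hf
  obtain ⟨σ, hσ, h'⟩ := hg
  refine ⟨min ρ σ, lt_min hρ hσ, fun r hr => ?_⟩
  obtain ⟨h1, h2⟩ := h r ⟨hr.1, hr.2.trans_le (min_le_left _ _)⟩
  obtain ⟨h3, h4⟩ := h' r ⟨hr.1, hr.2.trans_le (min_le_right _ _)⟩
  exact ⟨h1.add h3, by rw [Real.circleAverage_fun_add h1 h3]; exact add_le_add h2 h4⟩

theorem meanValueOn_re_of_differentiable {F : ℂ → ℂ} (hF : Differentiable ℂ F) :
    MeanValueOn (fun z => (F z).re) univ := by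
  refine ⟨(Complex.continuous_re.comp hF.continuous).continuousOn, fun w r _ _ => ?_⟩
  exact InnerProductSpace.HarmonicOnNhd.circleAverage_eq (f := fun z => (F z).re) fun z _ =>
    (hF.analyticAt z).harmonicAt_re

/-- Uniform limits on closed discs preserve the mean value property. -/
theorem meanValueOn_of_forall_approx {H : ℂ → ℝ} {S : Set ℂ}
    (h : ∀ ε > 0, ∃ G, MeanValueOn G S ∧ ∀ z ∈ S, |H z - G z| ≤ ε) : MeanValueOn H S := by
  have hc : ContinuousOn H S := by
    refine Metric.continuousOn_iff.mpr fun b hb ε hε => ?_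
    obtain ⟨G, hG, hd⟩ := h (ε / 3) (by linarith)
    obtain ⟨δ, hδ, h1⟩ := Metric.continuousOn_iff.mp hG.continuousOn b hb (ε / 3) (by linarith)
    refine ⟨δ, hδ, fun a ha hab => ?_⟩
    have h2 := h1 a ha hab
    have h3 := hd a ha
    have h4 := hd b hb
    rw [Real.dist_eq] at *
    rw [abs_lt] at *
    rw [abs_le] at *
    constructor <;> linarith [h2.1, h2.2, h3.1, h3.2, h4.1, h4.2]
  refine ⟨hc, fun w r hr hw => ?_⟩
  refine eq_of_forall_dist_le fun ε hε => ?_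
  obtain ⟨G, hG, hd⟩ := h (ε / 2) (by linarith)
  have hi := hc.circleIntegrable_of_closedBall_subset hr hw
  have h1 : |Real.circleAverage (fun z => H z - G z) w r| ≤ ε / 2 := by
    refine Real.abs_circleAverage_le_circleAverage_abs.trans ?_
    refine Real.circleAverage_mono_on_of_le_circle ?_ ?_
    · exact (IntervalIntegrable.sub hi (hG.circleIntegrable hr hw)).abs
    · intro z hz
      exact hd z (sphere_abs_subset hr hw hz)
  rw [Real.circleAverage_fun_sub hi (hG.circleIntegrable hr hw), hG.circleAverage_eq w r hr hw] at h1
  have h2 := hd w (hw (Metric.mem_closedBall_self hr))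
  rw [Real.dist_eq]
  rw [abs_le] at *
  constructor <;> linarith [h1.1, h1.2, h2.1, h2.2]

/-! ### Poisson integral, comparison on discs and Harnack's inequality -/

/-- Trigonometric polynomials are dense, and on the unit circle a negative power of `z` is the
conjugate of a positive one. -/
theorem exists_entire_approx_on_circle (g : C(UnitAddCircle, ℂ)) {ε : ℝ} (hε : 0 < ε) :
    ∃ F G : ℂ → ℂ, Differentiable ℂ F ∧ Differentiable ℂ G ∧
      ∀ x : UnitAddCircle, ‖g x - (F (AddCircle.toCircle x) +
        (starRingEnd ℂ) (G (AddCircle.toCircle x)))‖ < ε := by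
  have hmem : g ∈ (Submodule.span ℂ (range (fourier (T := 1)))).topologicalClosure := by
    rw [span_fourier_closure_eq_top]; trivial
  obtain ⟨p, hp, hd⟩ := Metric.mem_closure_iff.mp hmem ε hε
  suffices key : ∃ F G : ℂ → ℂ, Differentiable ℂ F ∧ Differentiable ℂ G ∧
      ∀ x : UnitAddCircle, p x = F (AddCircle.toCircle x) +
        (starRingEnd ℂ) (G (AddCircle.toCircle x)) by
    obtain ⟨F, G, hF, hG, h⟩ := key
    refine ⟨F, G, hF, hG, fun x => ?_⟩
    rw [← h x]
    exact (ContinuousMap.norm_coe_le_norm (g - p) x).trans_lt (by rwa [← dist_eq_norm])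
  clear hd
  induction hp using Submodule.span_induction with
  | mem p hp =>
    obtain ⟨n, rfl⟩ := hp
    rcases Int.eq_nat_or_neg n with ⟨m, rfl | rfl⟩
    · refine ⟨fun z => z ^ m, fun _ => 0, by fun_prop, by fun_prop, fun x => ?_⟩
      simp [fourier_apply, AddCircle.toCircle_nsmul]
    · refine ⟨fun _ => 0, fun z => z ^ m, by fun_prop, by fun_prop, fun x => ?_⟩
      simp only [fourier_apply, AddCircle.toCircle_neg, AddCircle.toCircle_nsmul, neg_smul,
        Circle.coe_inv_eq_conj, natCast_zsmul, Circle.coe_pow, map_pow, zero_add]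
  | zero => exact ⟨fun _ => 0, fun _ => 0, by fun_prop, by fun_prop, fun x => by simp⟩
  | add p q _ _ hp hq =>
    obtain ⟨F, G, hF, hG, h⟩ := hp
    obtain ⟨F', G', hF', hG', h'⟩ := hq
    refine ⟨fun z => F z + F' z, fun z => G z + G' z, by fun_prop, by fun_prop, fun x => ?_⟩
    simp only [ContinuousMap.add_apply, h, h', map_add]
    ring
  | smul a p _ hp =>
    obtain ⟨F, G, hF, hG, h⟩ := hp
    refine ⟨fun z => a * F z, fun z => (starRingEnd ℂ) a * G z, by fun_prop, by fun_prop,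
      fun x => ?_⟩
    simp only [ContinuousMap.smul_apply, h, map_mul, Complex.conj_conj, smul_eq_mul]
    ring

/-- `F + conj G` and `F + G` have the same real part, so one entire function is enough for real
data. -/
theorem exists_entire_re_approx_on_sphere {f : ℂ → ℝ} {c : ℂ} {R : ℝ} (hR : 0 < R)
    (hf : ContinuousOn f (Metric.sphere c R)) {ε : ℝ} (hε : 0 < ε) :
    ∃ F : ℂ → ℂ, Differentiable ℂ F ∧ ∀ z ∈ Metric.sphere c R, |f z - (F z).re| ≤ ε := by
  have hcont : Continuous fun x : UnitAddCircle => ((f (c + R * (AddCircle.toCircle x : ℂ)) : ℝ) : ℂ) := by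
    refine Complex.continuous_ofReal.comp (hf.comp_continuous ?_ fun x => ?_)
    · have : Continuous (fun x : UnitAddCircle => (AddCircle.toCircle x : ℂ)) :=
        continuous_subtype_val.comp AddCircle.continuous_toCircle
      fun_prop
    · rw [mem_sphere_iff_norm, add_sub_cancel_left, norm_mul, Circle.norm_coe, mul_one,
        Complex.norm_real, Real.norm_of_nonneg hR.le]
  obtain ⟨F, G, hF, hG, h⟩ := exists_entire_approx_on_circle ⟨_, hcont⟩ hε
  refine ⟨fun z => F ((z - c) / R) + G ((z - c) / R), by fun_prop, fun z hz => ?_⟩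
  have hn : ‖(z - c) / R‖ = 1 := by
    rw [norm_div, ← dist_eq_norm, Metric.mem_sphere.mp hz]
    simp [abs_of_pos hR, hR.ne']
  obtain ⟨x, hx⟩ := (AddCircle.homeomorphCircle (T := 1) one_ne_zero).surjective
    ⟨(z - c) / R, mem_sphere_zero_iff_norm.mpr hn⟩
  have hx' : (AddCircle.toCircle x : ℂ) = (z - c) / R := by
    rw [← AddCircle.homeomorphCircle_apply one_ne_zero, hx]
  have hRc : (R : ℂ) ≠ 0 := by exact_mod_cast hR.ne'
  have hz' : c + R * ((z - c) / R) = z := by field_simp; ring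
  have h1 := h x
  simp only [ContinuousMap.coe_mk, hx', hz'] at h1
  have h2 := (Complex.abs_re_le_norm _).trans h1.le
  simpa using h2

theorem poissonKernel_bounds {c w z : ℂ} {R : ℝ} (hz : z ∈ Metric.sphere c R)
    (hw : w ∈ Metric.ball c R) :
    (R - ‖w - c‖) / (R + ‖w - c‖) ≤ poissonKernel c w z ∧
      poissonKernel c w z ≤ (R + ‖w - c‖) / (R - ‖w - c‖) := by
  rw [poissonKernel_eq_re_herglotzRieszKernel]
  exact ⟨le_re_herglotzRieszKernel hz hw, re_herglotzRieszKernel_le hz hw⟩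

theorem poissonKernel_nonneg {c w z : ℂ} {R : ℝ} (hz : z ∈ Metric.sphere c R)
    (hw : w ∈ Metric.ball c R) : 0 ≤ poissonKernel c w z := by
  refine le_trans ?_ (poissonKernel_bounds hz hw).1
  have h : ‖w - c‖ < R := by rwa [← dist_eq_norm]
  have := norm_nonneg (w - c)
  apply div_nonneg <;> linarith

theorem continuousOn_poissonKernel_sphere {c w : ℂ} {R : ℝ} (hw : w ∈ Metric.ball c R) :
    ContinuousOn (poissonKernel c w) (Metric.sphere c R) := by
  have hR : 0 < R := Metric.pos_of_mem_ball hw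
  rw [poissonKernel_eq_re_herglotzRieszKernel]
  have := continuousOn_herglotzRieszKernel_sphere hw
  rw [abs_of_pos hR] at this
  exact Complex.continuous_re.comp_continuousOn this

theorem circleAverage_poissonKernel_mul_re {F : ℂ → ℂ} (hF : Differentiable ℂ F) {c w : ℂ} {R : ℝ}
    (hw : w ∈ Metric.ball c R) :
    Real.circleAverage (fun z => poissonKernel c w z * (F z).re) c R = (F w).re :=
  InnerProductSpace.HarmonicOnNhd.circleAverage_poissonKernel_smul (f := fun z => (F z).re)
    (fun z _ => (hF.analyticAt z).harmonicAt_re) hw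

theorem circleIntegrable_poissonKernel_mul {c w : ℂ} {R : ℝ} (hw : w ∈ Metric.ball c R) {f : ℂ → ℝ}
    (hf : ContinuousOn f (Metric.sphere c R)) :
    CircleIntegrable (fun z => poissonKernel c w z * f z) c R :=
  ((continuousOn_poissonKernel_sphere hw).mul hf).circleIntegrable (Metric.pos_of_mem_ball hw).le

theorem circleAverage_poissonKernel_mul_const {c w : ℂ} {R : ℝ} (hw : w ∈ Metric.ball c R) (a : ℝ) :
    Real.circleAverage (fun z => poissonKernel c w z * a) c R = a := by
  simpa using circleAverage_poissonKernel_mul_re (F := fun _ => (a : ℂ)) (by fun_prop) hw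

theorem circleAverage_poissonKernel_mul_mono {c w : ℂ} {R : ℝ} (hw : w ∈ Metric.ball c R)
    {f g : ℂ → ℝ} (hf : ContinuousOn f (Metric.sphere c R))
    (hg : ContinuousOn g (Metric.sphere c R)) (h : ∀ z ∈ Metric.sphere c R, f z ≤ g z) :
    Real.circleAverage (fun z => poissonKernel c w z * f z) c R ≤
      Real.circleAverage (fun z => poissonKernel c w z * g z) c R := by
  refine Real.circleAverage_mono (circleIntegrable_poissonKernel_mul hw hf)
    (circleIntegrable_poissonKernel_mul hw hg) fun z hz => ?_
  rw [abs_of_pos (Metric.pos_of_mem_ball hw)] at hz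
  exact mul_le_mul_of_nonneg_left (h z hz) (poissonKernel_nonneg hz hw)

/-- Solution of the Dirichlet problem on a disc by the Poisson integral. -/
theorem exists_dirichlet_disc {f : ℂ → ℝ} {c : ℂ} {R : ℝ} (hR : 0 < R)
    (hf : ContinuousOn f (Metric.sphere c R)) :
    ∃ H : ℂ → ℝ, MeanValueOn H (Metric.closedBall c R) ∧ EqOn H f (Metric.sphere c R) ∧
      ∀ w ∈ Metric.ball c R,
        H w = Real.circleAverage (fun z => poissonKernel c w z * f z) c R := by
  classical
  set H : ℂ → ℝ := fun w => if w ∈ Metric.ball c R then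
    Real.circleAverage (fun z => poissonKernel c w z * f z) c R else f w with hH
  have hin : ∀ w ∈ Metric.ball c R,
      H w = Real.circleAverage (fun z => poissonKernel c w z * f z) c R := fun w hw => by
    simp only [hH, if_pos hw]
  have hout : EqOn H f (Metric.sphere c R) := fun w hw => by
    have : w ∉ Metric.ball c R := by
      rw [Metric.mem_ball, Metric.mem_sphere.mp hw]; exact lt_irrefl R
    simp only [hH, if_neg this]
  refine ⟨H, meanValueOn_of_forall_approx fun ε hε => ?_, hout, hin⟩
  -- An approximation within `ε` on the circle stays within `ε` in the disc, because the Poisson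
  -- kernel is nonnegative with average 1. So the extension is a uniform limit of harmonic functions
  -- on the closed disc, and continuity up to the circle comes for free.
  obtain ⟨F, hF, hd⟩ := exists_entire_re_approx_on_sphere hR hf hε
  refine ⟨fun z => (F z).re, (meanValueOn_re_of_differentiable hF).mono (subset_univ _), ?_⟩
  intro z hz
  rcases (Metric.mem_closedBall.mp hz).lt_or_eq with h | h
  · have hz' : z ∈ Metric.ball c R := h
    have hFc : ContinuousOn (fun z => (F z).re) (Metric.sphere c R) :=
      (Complex.continuous_re.comp hF.continuous).continuousOn
    have e1 : H z - (F z).re =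
        Real.circleAverage (fun ζ => poissonKernel c z ζ * (f ζ - (F ζ).re)) c R := by
      rw [hin z hz', ← circleAverage_poissonKernel_mul_re hF hz', ← Real.circleAverage_fun_sub
        (circleIntegrable_poissonKernel_mul hz' hf) (circleIntegrable_poissonKernel_mul hz' hFc)]
      simp only [mul_sub]
    rw [e1, abs_le]
    constructor
    · rw [← circleAverage_poissonKernel_mul_const hz' (-ε)]
      exact circleAverage_poissonKernel_mul_mono hz' continuousOn_const (hf.sub hFc)
        fun ζ hζ => (abs_le.mp (hd ζ hζ)).1
    · rw [← circleAverage_poissonKernel_mul_const hz' ε]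
      exact circleAverage_poissonKernel_mul_mono hz' (hf.sub hFc) continuousOn_const
        fun ζ hζ => (abs_le.mp (hd ζ hζ)).2
  · rw [hout h]
    exact hd z h

/-- A continuous function with the local submean property in an open disc lies below every
function with the mean value property that dominates it on the circle. -/
theorem le_of_localSubmean_of_le_sphere {v H : ℂ → ℝ} {c : ℂ} {R : ℝ}
    (hv : ContinuousOn v (Metric.closedBall c R))
    (hs : ∀ w ∈ Metric.ball c R, LocalSubmeanAt v w)
    (hH : MeanValueOn H (Metric.closedBall c R)) (hle : ∀ z ∈ Metric.sphere c R, v z ≤ H z) :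
    ∀ z ∈ Metric.closedBall c R, v z ≤ H z := by
  have hd : ContinuousOn (fun z => v z + -H z) (Metric.closedBall c R) := hv.add hH.neg.continuousOn
  have key := nonpos_of_localSubmeanOn (W := Metric.ball c R) Metric.isOpen_ball
    Metric.isBounded_ball (g := fun z => v z + -H z)
    (hd.mono Metric.ball_subset_closedBall).upperSemicontinuousOn
    (fun w hw => (hs w hw).add (hH.neg.localSubmeanAt
      (mem_of_superset (Metric.isOpen_ball.mem_nhds hw) Metric.ball_subset_closedBall)))
    (fun ζ hζ a ha => by
      have hζ' := Metric.frontier_ball_subset_sphere hζ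
      have h1 : v ζ + -H ζ < a := by linarith [hle ζ hζ']
      have h2 := (hd ζ (Metric.sphere_subset_closedBall hζ')).mono Metric.ball_subset_closedBall
      exact h2.eventually_lt_const h1)
  intro z hz
  rcases (Metric.mem_closedBall.mp hz).lt_or_eq with h | h
  · linarith [key z h]
  · exact hle z h

/-- Uniqueness in the Dirichlet problem: comparison with the Poisson extension of the circle values,
in both directions. -/
theorem MeanValueOn.eq_poisson {H : ℂ → ℝ} {c w : ℂ} {R : ℝ}
    (hH : MeanValueOn H (Metric.closedBall c R)) (hw : w ∈ Metric.ball c R) :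
    H w = Real.circleAverage (fun z => poissonKernel c w z * H z) c R := by
  have hR := Metric.pos_of_mem_ball hw
  obtain ⟨G, hG, hGs, hGp⟩ := exists_dirichlet_disc hR
    (hH.continuousOn.mono Metric.sphere_subset_closedBall)
  rw [← hGp w hw]
  have hn : ∀ {F : ℂ → ℝ}, MeanValueOn F (Metric.closedBall c R) →
      ∀ z ∈ Metric.ball c R, LocalSubmeanAt F z := fun hF z hz => hF.localSubmeanAt
    (mem_of_superset (Metric.isOpen_ball.mem_nhds hz) Metric.ball_subset_closedBall)
  refine le_antisymm ?_ ?_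
  · exact le_of_localSubmean_of_le_sphere hH.continuousOn (hn hH) hG (fun z hz => (hGs hz).ge)
      w (Metric.ball_subset_closedBall hw)
  · exact le_of_localSubmean_of_le_sphere hG.continuousOn (hn hG) hH (fun z hz => (hGs hz).le)
      w (Metric.ball_subset_closedBall hw)

/-- The local submean property implies the submean property on all closed discs. -/
theorem le_circleAverage_of_localSubmean {v : ℂ → ℝ} {c : ℂ} {R : ℝ} (hR : 0 ≤ R)
    (hv : ContinuousOn v (Metric.closedBall c R))
    (hs : ∀ w ∈ Metric.ball c R, LocalSubmeanAt v w) : v c ≤ Real.circleAverage v c R := by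
  rcases hR.eq_or_lt with rfl | hR
  · simp
  obtain ⟨G, hG, hGs, -⟩ := exists_dirichlet_disc hR (hv.mono Metric.sphere_subset_closedBall)
  have h := le_of_localSubmean_of_le_sphere hv hs hG (fun z hz => (hGs hz).ge) c
    (Metric.mem_closedBall_self hR.le)
  rw [← hG.circleAverage_eq c R hR.le subset_rfl] at h
  rwa [Real.circleAverage_congr_sphere (f₂ := v) (by rwa [abs_of_pos hR])] at h

/-- **Harnack's inequality** for nonnegative functions with the mean value property. -/
theorem MeanValueOn.harnack {H : ℂ → ℝ} {c w : ℂ} {R : ℝ}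
    (hH : MeanValueOn H (Metric.closedBall c R)) (h0 : ∀ z ∈ Metric.sphere c R, 0 ≤ H z)
    (hw : w ∈ Metric.ball c R) :
    (R - ‖w - c‖) / (R + ‖w - c‖) * H c ≤ H w ∧
      H w ≤ (R + ‖w - c‖) / (R - ‖w - c‖) * H c := by
  have hR := Metric.pos_of_mem_ball hw
  have hc := hH.continuousOn.mono Metric.sphere_subset_closedBall
  have e : ∀ a : ℝ, a * H c = Real.circleAverage (fun z => a * H z) c R := fun a =>
    ((hH.const_mul a).circleAverage_eq c R hR.le subset_rfl).symm
  have hi : ∀ a : ℝ, CircleIntegrable (fun z => a * H z) c R := fun a =>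
    (hH.const_mul a).circleIntegrable hR.le subset_rfl
  rw [hH.eq_poisson hw, e, e]
  constructor
  · refine Real.circleAverage_mono (hi _) (circleIntegrable_poissonKernel_mul hw hc) fun z hz => ?_
    rw [abs_of_pos hR] at hz
    exact mul_le_mul_of_nonneg_right (poissonKernel_bounds hz hw).1 (h0 z hz)
  · refine Real.circleAverage_mono (circleIntegrable_poissonKernel_mul hw hc) (hi _) fun z hz => ?_
    rw [abs_of_pos hR] at hz
    exact mul_le_mul_of_nonneg_right (poissonKernel_bounds hz hw).2 (h0 z hz)

/-! ### The logarithmic kernel and potentials off the support -/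

/-- The form with `max` covers centres near to and far from `a` at once: the average is continuous
in `c`, and it differs from `log ‖c - a‖` only for `‖c - a‖ < r`. -/
theorem circleAverage_log_norm_sub (a c : ℂ) {r : ℝ} (hr : 0 < r) :
    Real.circleAverage (fun z => Real.log ‖z - a‖) c r = Real.log (max r ‖c - a‖) := by
  rw [circleAverage_log_norm_sub_const_eq_log_radius_add_posLog hr.ne']
  rcases le_total ‖c - a‖ r with h | h
  · rw [max_eq_left h, add_eq_left, Real.posLog_eq_zero_iff, abs_of_nonneg (by positivity)]
    exact inv_mul_le_one_of_le₀ h hr.le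
  · have hpos : 0 < ‖c - a‖ := hr.trans_le h
    rw [max_eq_right h, Real.posLog_eq_log, Real.log_mul (by positivity) (by positivity),
      Real.log_inv]
    · ring
    · rw [abs_of_nonneg (by positivity), ← div_eq_inv_mul]
      exact (one_le_div hr).mpr h

theorem meanValueOn_log_norm_sub (a : ℂ) :
    MeanValueOn (fun z => Real.log ‖z - a‖) ({a}ᶜ : Set ℂ) := by
  refine ⟨?_, fun w r hr hw => ?_⟩
  · refine ContinuousOn.log (by fun_prop) fun z hz => ?_
    rw [norm_ne_zero_iff, sub_ne_zero]
    exact hz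
  · rcases hr.eq_or_lt with rfl | hr
    · simp
    rw [circleAverage_log_norm_sub a w hr, max_eq_right]
    by_contra! h
    exact hw (Metric.mem_closedBall.mpr (by rw [dist_comm, dist_eq_norm]; exact h.le)) rfl

theorem abs_log_le_of_mem_Icc {t δ M : ℝ} (hδ : 0 < δ) (h1 : δ ≤ t) (h2 : t ≤ M) :
    |Real.log t| ≤ |Real.log δ| + |Real.log M| := by
  have a := Real.log_le_log hδ h1
  have b := Real.log_le_log (hδ.trans_le h1) h2
  rw [abs_le]
  constructor
  · linarith [neg_abs_le (Real.log δ), abs_nonneg (Real.log M)]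
  · linarith [le_abs_self (Real.log M), abs_nonneg (Real.log δ)]

theorem logPotential_eq_neg (μ : Measure ℂ) (w : ℂ) :
    logPotential μ w = -∫ z, Real.log ‖w - z‖ ∂μ := by
  unfold logPotential
  rw [← integral_neg]
  simp

/-- The kernel is bounded uniformly on a neighbourhood of each compact set disjoint from `T`. -/
theorem exists_abs_log_norm_sub_le {S T : Set ℂ} (hS : IsCompact S) (hT : IsCompact T)
    (hd : Disjoint S T) :
    ∃ C δ : ℝ, 0 < δ ∧ ∀ w ∈ S, ∀ z ∈ T, ∀ w', ‖w' - w‖ ≤ δ →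
      |Real.log ‖w' - z‖| ≤ C ∧ δ ≤ ‖w' - z‖ := by
  obtain ⟨δ, hδ, hsep⟩ := hd.exists_thickenings hS hT.isClosed
  obtain ⟨A, hA⟩ := hS.isBounded.exists_norm_le
  obtain ⟨B, hB⟩ := hT.isBounded.exists_norm_le
  refine ⟨|Real.log (δ / 2)| + |Real.log (A + δ / 2 + B)|, δ / 2, half_pos hδ,
    fun w hw z hz w' hw' => ?_⟩
  have h1 : δ / 2 ≤ ‖w' - z‖ := by
    by_contra! h
    have h2 : w' ∈ Metric.thickening δ S :=
      Metric.mem_thickening_iff.mpr ⟨w, hw, by rw [dist_eq_norm]; linarith⟩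
    have h3 : w' ∈ Metric.thickening δ T :=
      Metric.mem_thickening_iff.mpr ⟨z, hz, by rw [dist_eq_norm]; linarith⟩
    exact disjoint_left.mp hsep h2 h3
  refine ⟨abs_log_le_of_mem_Icc (half_pos hδ) h1 ?_, h1⟩
  have e : w' - z = (w' - w) + w - z := by ring
  calc ‖w' - z‖ ≤ ‖(w' - w) + w‖ + ‖z‖ := by rw [e]; exact norm_sub_le _ _
    _ ≤ ‖w' - w‖ + ‖w‖ + ‖z‖ := by gcongr; exact norm_add_le _ _
    _ ≤ A + δ / 2 + B := by linarith [hA w hw, hB z hz]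

theorem measurable_log_norm_sub : Measurable fun p : ℂ × ℂ => Real.log ‖p.1 - p.2‖ := by
  fun_prop

theorem integrable_log_norm_sub {μ : Measure ℂ} [IsFiniteMeasure μ] {T : Set ℂ} (hT : IsCompact T)
    (hμ : μ Tᶜ = 0) {w : ℂ} (hw : w ∉ T) : Integrable (fun z => Real.log ‖w - z‖) μ := by
  obtain ⟨C, δ, hδ, h⟩ := exists_abs_log_norm_sub_le (isCompact_singleton (x := w)) hT
    (disjoint_singleton_left.mpr hw)
  refine Integrable.of_bound (Measurable.aestronglyMeasurable (by fun_prop)) C ?_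
  filter_upwards [compl_mem_ae_iff.mpr hμ] with z hz
  rw [compl_compl] at hz
  exact (h w rfl z hz w (by simp [hδ.le])).1

/-- The kernel is bounded uniformly for `w` in a closed disc off `T` and `z` in `T`, so Fubini
carries its mean value property through the integral. -/
theorem meanValueOn_logPotential {μ : Measure ℂ} [IsFiniteMeasure μ] {T : Set ℂ}
    (hT : IsCompact T) (hμ : μ Tᶜ = 0) : MeanValueOn (logPotential μ) Tᶜ := by
  have hae : ∀ᵐ z ∂μ, z ∈ T := by
    filter_upwards [compl_mem_ae_iff.mpr hμ] with z hz
    rwa [compl_compl] at hz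
  have hfun : logPotential μ = fun w => -∫ z, Real.log ‖w - z‖ ∂μ :=
    funext (logPotential_eq_neg μ)
  rw [hfun]
  refine MeanValueOn.neg ⟨fun w hw => ?_, fun w r hr hw => ?_⟩
  · obtain ⟨C, δ, hδ, h⟩ := exists_abs_log_norm_sub_le (isCompact_singleton (x := w)) hT
      (disjoint_singleton_left.mpr hw)
    refine ContinuousAt.continuousWithinAt (continuousAt_of_dominated (bound := fun _ => C)
      (Eventually.of_forall fun x => Measurable.aestronglyMeasurable (by fun_prop)) ?_
      (integrable_const C) ?_)
    · filter_upwards [Metric.ball_mem_nhds w hδ] with x hx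
      filter_upwards [hae] with z hz
      exact (h w rfl z hz x (by rw [← dist_eq_norm]; exact hx.le)).1
    · filter_upwards [hae] with z hz
      refine ContinuousAt.log (by fun_prop) (norm_ne_zero_iff.mpr (sub_ne_zero.mpr ?_))
      rintro rfl
      exact hw hz
  · obtain ⟨C, δ, hδ, h⟩ := exists_abs_log_norm_sub_le (isCompact_closedBall w r) hT
      (disjoint_left.mpr fun z hz => hw hz)
    have hint : Integrable (Function.uncurry fun (θ : ℝ) (z : ℂ) => Real.log ‖circleMap w r θ - z‖)
        ((volume.restrict (Ioc 0 (2 * Real.pi))).prod μ) := by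
      refine Integrable.of_bound (Measurable.aestronglyMeasurable ?_) C ?_
      · exact measurable_log_norm_sub.comp
          (((continuous_circleMap w r).measurable.comp measurable_fst).prodMk measurable_snd)
      · filter_upwards [Measure.quasiMeasurePreserving_snd.ae hae] with p hp
        exact (h _ (circleMap_mem_closedBall w hr p.1) _ hp _ (by simp [hδ.le])).1
    rw [Real.circleAverage_def, intervalIntegral.integral_of_le (by positivity),
      integral_integral_swap hint, smul_eq_mul, ← integral_const_mul]
    refine integral_congr_ae ?_
    filter_upwards [hae] with z hz
    have := (meanValueOn_log_norm_sub z).circleAverage_eq w r hr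
      (fun x hx hxz => hw hx (by rw [mem_singleton_iff.mp hxz]; exact hz))
    rw [Real.circleAverage_def, intervalIntegral.integral_of_le (by positivity), smul_eq_mul] at this
    exact this

/-! ### Barriers at the points of a continuum -/

/-- Measurable choice of a point of a closed set on each circle of a family of concentric
circles. -/
theorem exists_measurable_selection_spheres {T : Set ℂ} (hT : IsClosed T) {z₀ : ℂ} {a b : ℝ}
    (ha : 0 ≤ a) (h : ∀ s ∈ Icc a b, ∃ z ∈ T, ‖z - z₀‖ = s) :
    ∃ k : ℝ → ℂ, Measurable k ∧ ∀ s ∈ Icc a b, k s ∈ T ∧ ‖k s - z₀‖ = s := by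
  classical
  set Θ : ℝ → Set ℝ := fun s => {t | t ∈ Icc 0 (2 * Real.pi) ∧ circleMap z₀ s t ∈ T} with hΘ
  have hcm : Continuous fun p : ℝ × ℝ => circleMap z₀ p.1 p.2 := by
    unfold circleMap; fun_prop
  have hΘc : ∀ s, IsCompact (Θ s) := fun s =>
    isCompact_Icc.inter_right (hT.preimage (continuous_circleMap z₀ s))
  have hΘn : ∀ s ∈ Icc a b, (Θ s).Nonempty := by
    intro s hs
    obtain ⟨z, hz, hzs⟩ := h s hs
    have hs0 : 0 ≤ s := ha.trans hs.1
    have : z ∈ circleMap z₀ s '' Ioc 0 (2 * Real.pi) := by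
      rw [image_circleMap_Ioc, mem_sphere_iff_norm, abs_of_nonneg hs0, hzs]
    obtain ⟨t, ht, rfl⟩ := this
    exact ⟨t, ⟨ht.1.le, ht.2⟩, hz⟩
  set θ : ℝ → ℝ := fun s => if s ∈ Icc a b then sInf (Θ s) else 0 with hθ
  have hθmem : ∀ s ∈ Icc a b, θ s ∈ Θ s := fun s hs => by
    simp only [hθ, if_pos hs]
    exact (hΘc s).sInf_mem (hΘn s hs)
  have hmeas : Measurable θ := by
    refine measurable_of_Iic fun c => ?_
    set B : Set (ℝ × ℝ) := {p | p ∈ Icc a b ×ˢ Icc 0 (min c (2 * Real.pi)) ∧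
      circleMap z₀ p.1 p.2 ∈ T} with hB
    have hBc : IsCompact B := (isCompact_Icc.prod isCompact_Icc).inter_right (hT.preimage hcm)
    -- Taking the smallest admissible angle makes each sublevel set over `[a, b]` the projection of
    -- a compact set. The default value 0 outside `[a, b]` accounts for the second part of the
    -- union.
    have hset : θ ⁻¹' Iic c = (Prod.fst '' B) ∪ ((Icc a b)ᶜ ∩ {_s | 0 ≤ c}) := by
      ext s
      by_cases hs : s ∈ Icc a b
      · have h1 : θ s = sInf (Θ s) := by simp only [hθ, if_pos hs]
        have h2 := hθmem s hs
        simp only [mem_preimage, mem_Iic, mem_union, mem_inter_iff, mem_compl_iff, hs, not_true,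
          false_and, or_false]
        constructor
        · intro hc
          exact ⟨(s, θ s), ⟨⟨hs, h2.1.1, le_min hc h2.1.2⟩, h2.2⟩, rfl⟩
        · rintro ⟨⟨s', t⟩, ⟨⟨-, ht⟩, htT⟩, rfl⟩
          rw [h1]
          refine (csInf_le (hΘc s').bddBelow ⟨⟨ht.1, ht.2.trans (min_le_right _ _)⟩, htT⟩).trans ?_
          exact ht.2.trans (min_le_left _ _)
      · have h1 : θ s = 0 := by simp only [hθ, if_neg hs]
        simp only [mem_preimage, mem_Iic, h1, mem_union, mem_inter_iff, mem_compl_iff, hs,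
          not_false_eq_true, true_and]
        constructor
        · exact Or.inr
        · rintro (⟨p, hp, rfl⟩ | h)
          · exact absurd hp.1.1 hs
          · exact h
    rw [hset]
    exact (hBc.image continuous_fst).isClosed.measurableSet.union
      (measurableSet_Icc.compl.inter (MeasurableSet.const _))
  refine ⟨fun s => circleMap z₀ s (θ s), hcm.measurable.comp (measurable_id.prodMk hmeas),
    fun s hs => ⟨(hθmem s hs).2, ?_⟩⟩
  rw [circleMap_sub_center, norm_circleMap_zero, abs_of_nonneg (ha.trans hs.1)]

/-- The extremal case is `q = -p`. For opposite signs this is midpoint convexity of `x log x`, with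
`log` even; for equal signs monotonicity of `log` is enough. It says that a uniform mass on a
segment has its largest logarithmic potential, along the line, at the midpoint. -/
theorem mul_log_half_le_mul_log_sub {p q : ℝ} (h : q < p) :
    (p - q) * Real.log ((p - q) / 2) ≤ p * Real.log p - q * Real.log q := by
  have key : ∀ x y : ℝ, 0 ≤ x → x < y →
      (y - x) * Real.log ((y - x) / 2) ≤ y * Real.log y - x * Real.log x := by
    intro x y hx hxy
    have h1 : Real.log ((y - x) / 2) ≤ Real.log y := Real.log_le_log (by linarith) (by linarith)
    rcases hx.eq_or_lt with rfl | hx0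
    · simp only [sub_zero, zero_mul] at *
      exact mul_le_mul_of_nonneg_left h1 hxy.le
    · have h2 : Real.log x ≤ Real.log y := Real.log_le_log hx0 hxy.le
      nlinarith
  rcases le_or_gt 0 q with hq | hq
  · exact key q p hq h
  rcases le_or_gt p 0 with hp | hp
  · have := key (-p) (-q) (by linarith) (by linarith)
    rw [Real.log_neg_eq_log, Real.log_neg_eq_log, show -q - -p = p - q by ring] at this
    linarith
  · have hc := Real.convexOn_mul_log.2 (mem_Ici.mpr hp.le) (mem_Ici.mpr (neg_pos.mpr hq).le)
      (by norm_num : (0 : ℝ) ≤ 1 / 2) (by norm_num : (0 : ℝ) ≤ 1 / 2) (by norm_num)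
    simp only [smul_eq_mul, Real.log_neg_eq_log] at hc
    rw [show 1 / 2 * p + 1 / 2 * -q = (p - q) / 2 by ring] at hc
    linarith

theorem intervalIntegrable_log_sub (t a b : ℝ) :
    IntervalIntegrable (fun s => Real.log (t - s)) volume a b := by
  have := (intervalIntegral.intervalIntegrable_log' (a := t - a) (b := t - b)).comp_sub_left t
  simpa using this

theorem neg_integral_log_sub_le (t : ℝ) {a b : ℝ} (h : a < b) :
    -∫ s in a..b, Real.log (t - s) ≤ (b - a) * (Real.log (2 / (b - a)) + 1) := by
  rw [intervalIntegral.integral_comp_sub_left (fun x => Real.log x) t, integral_log]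
  have := mul_log_half_le_mul_log_sub (p := t - a) (q := t - b) (by linarith)
  rw [show t - a - (t - b) = b - a by ring] at this
  have e : Real.log (2 / (b - a)) = -Real.log ((b - a) / 2) := by
    rw [← Real.log_inv, inv_div]
  rw [e]
  linarith

/-- The barrier at a point `ζ` of a closed set that meets all small circles around `ζ`. -/
theorem exists_barrier {P : Set ℂ} (hP : IsClosed P) {ζ : ℂ} {R : ℝ} (hR : 0 < R)
    (h : ∀ s ∈ Icc 0 R, ∃ z ∈ P, ‖z - ζ‖ = s) {ε : ℝ} (hε : 0 < ε) :
    ∃ δ > 0, ∃ f : ℂ → ℝ, MeanValueOn f Pᶜ ∧ (∀ z ∉ P, f z ≤ 1) ∧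
      (∀ z ∉ P, R ≤ ‖z - ζ‖ → f z ≤ 0) ∧ ∀ z ∉ P, ‖z - ζ‖ < δ → 1 - ε ≤ f z := by
  have hl2 : 0 < Real.log 2 := Real.log_pos one_lt_two
  -- With `V` the potential of `τ` below, the barrier is `(V / r + log (exp l * r)) / N`. The bound
  -- `V / r ≤ log (2 / r) + 1` gives a numerator of at most `N`. At distance at least `R = r + exp l
  -- * r` from `ζ` it is at most 0. Within `r` of `ζ` it is at least `l - log 2 = N - ε * l`, and `l
  -- ≤ N` makes the relative loss at most `ε`.
  set l : ℝ := (1 + 2 * Real.log 2) / ε with hl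
  have hl0 : 0 < l := by positivity
  set M : ℝ := 1 + Real.exp l with hM
  have hM1 : 1 < M := by linarith [Real.exp_pos l]
  set r : ℝ := R / M with hr
  have hr0 : 0 < r := by positivity
  have hrR : r ≤ R := div_le_self hR.le hM1.le
  set N : ℝ := l + 1 + Real.log 2 with hN
  have hN0 : 0 < N := by positivity
  obtain ⟨k, hk, hkT⟩ := exists_measurable_selection_spheres hP le_rfl
    (fun s hs => h s ⟨hs.1, hs.2.trans hrR⟩ : ∀ s ∈ Icc 0 r, _)
  -- One point of `P` on each circle of radius `s ≤ r`, weighted by `ds`. Since `‖z - k s‖ ≥ |‖z -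
  -- ζ‖ - s|`, the potential is dominated by that of a segment and stays bounded above.
  set τ : Measure ℂ := (volume.restrict (Ioc 0 r)).map k with hτ
  have hT : IsCompact (P ∩ Metric.closedBall ζ r) := (isCompact_closedBall ζ r).inter_left hP
  have hτT : τ (P ∩ Metric.closedBall ζ r)ᶜ = 0 := by
    rw [hτ, Measure.map_apply hk hT.measurableSet.compl,
      Measure.restrict_apply (hk hT.measurableSet.compl)]
    convert measure_empty (μ := (volume : Measure ℝ))
    ext s
    simp only [mem_inter_iff, mem_preimage, mem_compl_iff, mem_Ioc, mem_empty_iff_false, iff_false,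
      not_and]
    intro h1 h2 h3
    obtain ⟨h4, h5⟩ := hkT s ⟨h2.le, h3⟩
    exact h1 h4 (by rw [mem_closedBall_iff_norm, h5]; exact h3)
  have hmv := (meanValueOn_logPotential hT hτT).mono
    (compl_subset_compl.mpr (inter_subset_left (s := P) (t := Metric.closedBall ζ r)))
  have hV : ∀ z, logPotential τ z = -∫ s in (0 : ℝ)..r, Real.log ‖z - k s‖ := by
    intro z
    rw [logPotential_eq_neg, hτ, integral_map hk.aemeasurable
      (Measurable.aestronglyMeasurable (by fun_prop)), intervalIntegral.integral_of_le hr0.le]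
  have hint : ∀ z ∉ P, IntervalIntegrable (fun s => Real.log ‖z - k s‖) volume 0 r := by
    intro z hz
    rw [intervalIntegrable_iff_integrableOn_Ioc_of_le hr0.le]
    exact (integrable_map_measure (Measurable.aestronglyMeasurable (by fun_prop))
      hk.aemeasurable).mp (integrable_log_norm_sub hT hτT fun hz' => hz hz'.1)
  have hzk : ∀ z ∉ P, ∀ s ∈ Icc 0 r, 0 < ‖z - k s‖ := by
    intro z hz s hs
    rw [norm_pos_iff, sub_ne_zero]
    rintro rfl
    exact hz (hkT s hs).1
  have hkz : ∀ z, ∀ s ∈ Icc 0 r, ‖z - ζ‖ - s ≤ ‖z - k s‖ ∧ s - ‖z - ζ‖ ≤ ‖z - k s‖ ∧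
      ‖z - k s‖ ≤ ‖z - ζ‖ + s := by
    intro z s hs
    have h1 := (hkT s hs).2
    have h2 : ‖z - ζ‖ ≤ ‖z - k s‖ + ‖k s - ζ‖ := by simpa using norm_add_le (z - k s) (k s - ζ)
    have h3 : ‖k s - ζ‖ ≤ ‖z - k s‖ + ‖z - ζ‖ := by
      rw [norm_sub_rev z (k s)]; simpa using norm_add_le (k s - z) (z - ζ)
    have h4 : ‖z - k s‖ ≤ ‖z - ζ‖ + ‖k s - ζ‖ := by
      rw [norm_sub_rev (k s) ζ]; simpa using norm_add_le (z - ζ) (ζ - k s)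
    rw [h1] at *
    exact ⟨by linarith, by linarith, h4⟩
  refine ⟨r, hr0, fun z => N⁻¹ * (r⁻¹ * logPotential τ z + Real.log (Real.exp l * r)),
    ((hmv.const_mul _).add (meanValueOn_const _ _)).const_mul _, ?_, ?_, ?_⟩
  · intro z hz
    have h1 : logPotential τ z ≤ r * (Real.log (2 / r) + 1) := by
      have := neg_integral_log_sub_le ‖z - ζ‖ hr0
      rw [sub_zero] at this
      refine le_trans ?_ this
      rw [hV, neg_le_neg_iff]
      refine intervalIntegral.integral_mono_ae_restrict hr0.le (intervalIntegrable_log_sub _ _ _)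
        (hint z hz) ?_
      filter_upwards [ae_restrict_mem measurableSet_Icc,
        ae_restrict_of_ae (compl_mem_ae_iff.mpr (measure_singleton ‖z - ζ‖))] with s hs hne
      obtain ⟨h2, h3, -⟩ := hkz z s hs
      rw [← Real.log_abs]
      exact Real.log_le_log (abs_pos.mpr (sub_ne_zero.mpr (Ne.symm hne)))
        (abs_le.mpr ⟨by linarith, h2⟩)
    rw [inv_mul_le_iff₀ hN0, mul_one]
    have h2 : r⁻¹ * logPotential τ z ≤ Real.log (2 / r) + 1 := by
      rwa [inv_mul_le_iff₀ hr0]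
    rw [Real.log_div two_ne_zero hr0.ne'] at h2
    rw [Real.log_mul (Real.exp_pos l).ne' hr0.ne', Real.log_exp]
    linarith
  · intro z hz hzR
    have h1 : logPotential τ z ≤ -(r * Real.log (Real.exp l * r)) := by
      rw [hV, neg_le_neg_iff]
      have := intervalIntegral.integral_mono_on_of_le_Ioo hr0.le
        (intervalIntegrable_const (c := Real.log (Real.exp l * r))) (hint z hz) fun s hs => by
          refine Real.log_le_log (by positivity) ?_
          have := (hkz z s (Ioo_subset_Icc_self hs)).1
          have e : R = r + Real.exp l * r := by
            rw [hr]; field_simp; rw [hM]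
          linarith [hs.2]
      simpa using this
    have h2 : r⁻¹ * logPotential τ z ≤ -Real.log (Real.exp l * r) := by
      rw [inv_mul_le_iff₀ hr0]; linarith
    exact mul_nonpos_of_nonneg_of_nonpos (by positivity) (by linarith)
  · intro z hz hzr
    have h1 : -(r * Real.log (2 * r)) ≤ logPotential τ z := by
      rw [hV, neg_le_neg_iff]
      have := intervalIntegral.integral_mono_on_of_le_Ioo hr0.le (hint z hz)
        (intervalIntegrable_const (c := Real.log (2 * r))) fun s hs => by
          refine Real.log_le_log (hzk z hz s (Ioo_subset_Icc_self hs)) ?_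
          linarith [(hkz z s (Ioo_subset_Icc_self hs)).2.2, hs.2]
      simpa using this
    have h2 : -Real.log (2 * r) ≤ r⁻¹ * logPotential τ z := by
      rw [← div_eq_inv_mul, le_div_iff₀ hr0]; linarith
    change 1 - ε ≤ N⁻¹ * (r⁻¹ * logPotential τ z + Real.log (Real.exp l * r))
    rw [← div_eq_inv_mul, le_div_iff₀ hN0, Real.log_mul (Real.exp_pos l).ne' hr0.ne', Real.log_exp]
    rw [Real.log_mul two_ne_zero hr0.ne'] at h2
    have h3 : ε * l = 1 + 2 * Real.log 2 := by rw [hl]; field_simp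
    have h4 : ε * N = ε * l + ε * (1 + Real.log 2) := by rw [hN]; ring
    have h5 : 0 < ε * (1 + Real.log 2) := by positivity
    have h6 : (1 - ε) * N = N - ε * N := by ring
    rw [h6, h4, h3]
    linarith

/-! ### Perron's method for boundary values 1 and 0 -/

theorem LocalSubmeanAt.max {f g : ℂ → ℝ} {w : ℂ} (hf : LocalSubmeanAt f w)
    (hg : LocalSubmeanAt g w) : LocalSubmeanAt (fun z => max (f z) (g z)) w := by
  obtain ⟨ρ, hρ, h⟩ := hf
  obtain ⟨σ, hσ, h'⟩ := hg
  refine ⟨min ρ σ, lt_min hρ hσ, fun r hr => ?_⟩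
  obtain ⟨h1, h2⟩ := h r ⟨hr.1, hr.2.trans_le (min_le_left _ _)⟩
  obtain ⟨h3, h4⟩ := h' r ⟨hr.1, hr.2.trans_le (min_le_right _ _)⟩
  have hi : CircleIntegrable (fun z => Max.max (f z) (g z)) w r := by
    have e : (fun θ => Max.max (f (circleMap w r θ)) (g (circleMap w r θ))) =
        fun θ => (1 / 2 : ℝ) * (f (circleMap w r θ) + g (circleMap w r θ) +
          |f (circleMap w r θ) - g (circleMap w r θ)|) := by
      funext θ
      rcases le_total (f (circleMap w r θ)) (g (circleMap w r θ)) with h | h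
      · rw [max_eq_right h, abs_of_nonpos (sub_nonpos.mpr h)]; ring
      · rw [max_eq_left h, abs_of_nonneg (sub_nonneg.mpr h)]; ring
    unfold CircleIntegrable
    rw [e]
    exact (IntervalIntegrable.add (IntervalIntegrable.add h1 h3)
      (IntervalIntegrable.sub h1 h3).abs).const_mul _
  exact ⟨hi, max_le (h2.trans (Real.circleAverage_mono h1 hi fun z _ => le_max_left _ _))
    (h4.trans (Real.circleAverage_mono h3 hi fun z _ => le_max_right _ _))⟩

/-- Continuous subharmonic competitors for boundary values `1` on `P` and `0` on `Q`. -/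
structure IsDirichletSub (P Q : Set ℂ) (v : ℂ → ℝ) : Prop where
  continuousOn : ContinuousOn v Pᶜ
  nonneg : ∀ z, 0 ≤ v z
  le_one : ∀ z, v z ≤ 1
  eq_zero : ∀ z ∈ Q, v z = 0
  submean : ∀ w ∈ (P ∪ Q)ᶜ, LocalSubmeanAt v w

theorem isDirichletSub_zero (P Q : Set ℂ) : IsDirichletSub P Q fun _ => 0 :=
  ⟨continuousOn_const, fun _ => le_rfl, fun _ => zero_le_one, fun _ _ => rfl,
    fun _ _ => (meanValueOn_const 0 univ).localSubmeanAt univ_mem⟩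

theorem IsDirichletSub.max {P Q : Set ℂ} {v w : ℂ → ℝ} (hv : IsDirichletSub P Q v)
    (hw : IsDirichletSub P Q w) : IsDirichletSub P Q fun z => max (v z) (w z) :=
  ⟨hv.continuousOn.sup hw.continuousOn, fun z => (hv.nonneg z).trans (le_max_left _ _),
    fun z => max_le (hv.le_one z) (hw.le_one z),
    fun z hz => by rw [hv.eq_zero z hz, hw.eq_zero z hz, max_self],
    fun z hz => (hv.submean z hz).max (hw.submean z hz)⟩

/-- Poisson modification: in the disc `v` is replaced by the harmonic function with the same values
on the circle. The new function dominates `v`; off the open disc its values are unchanged, so the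
submean inequalities there survive. -/
theorem IsDirichletSub.exists_lift {P Q : Set ℂ} (hP : IsClosed P) (hQ : IsClosed Q) {v : ℂ → ℝ}
    (hv : IsDirichletSub P Q v) {c : ℂ} {R : ℝ} (hR : 0 < R)
    (hc : Metric.closedBall c R ⊆ (P ∪ Q)ᶜ) :
    ∃ v', IsDirichletSub P Q v' ∧ (∀ z, v z ≤ v' z) ∧ MeanValueOn v' (Metric.closedBall c R) ∧
      EqOn v' v (Metric.sphere c R) := by
  classical
  have hcP : Metric.closedBall c R ⊆ Pᶜ := hc.trans (compl_subset_compl.mpr subset_union_left)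
  have hvc : ContinuousOn v (Metric.closedBall c R) := hv.continuousOn.mono hcP
  obtain ⟨H, hH, hHs, -⟩ := exists_dirichlet_disc hR (hvc.mono Metric.sphere_subset_closedBall)
  have hHsub : ∀ z ∈ Metric.ball c R, LocalSubmeanAt H z := fun z hz => hH.localSubmeanAt
    (mem_of_superset (Metric.isOpen_ball.mem_nhds hz) Metric.ball_subset_closedBall)
  have hvH : ∀ z ∈ Metric.closedBall c R, v z ≤ H z := le_of_localSubmean_of_le_sphere hvc
    (fun w hw => hv.submean w (hc (Metric.ball_subset_closedBall hw))) hH fun z hz => (hHs hz).ge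
  have hH1 : ∀ z ∈ Metric.closedBall c R, H z ≤ 1 := le_of_localSubmean_of_le_sphere
    hH.continuousOn hHsub (meanValueOn_const 1 _) fun z hz => by rw [hHs hz]; exact hv.le_one z
  set v' : ℂ → ℝ := (Metric.ball c R).piecewise H v with hv'
  have hin : EqOn v' H (Metric.closedBall c R) := by
    intro z hz
    by_cases hzb : z ∈ Metric.ball c R
    · exact piecewise_eq_of_mem _ _ _ hzb
    · have hzs : z ∈ Metric.sphere c R :=
        le_antisymm hz (not_lt.mp hzb)
      rw [hv', piecewise_eq_of_notMem _ _ _ hzb, hHs hzs]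
  have hout : ∀ z ∉ Metric.ball c R, v' z = v z := fun z hz => piecewise_eq_of_notMem _ _ _ hz
  have hle : ∀ z, v z ≤ v' z := by
    intro z
    by_cases hzb : z ∈ Metric.ball c R
    · rw [hin (Metric.ball_subset_closedBall hzb)]
      exact hvH z (Metric.ball_subset_closedBall hzb)
    · exact (hout z hzb).ge
  have hmv : MeanValueOn v' (Metric.closedBall c R) := hH.congr hin
  have hcont : ContinuousOn v' Pᶜ := by
    refine ContinuousOn.piecewise (fun a ha => hHs (Metric.frontier_ball_subset_sphere ha.2)) ?_ ?_
    · exact hH.continuousOn.mono (inter_subset_right.trans Metric.closure_ball_subset_closedBall)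
    · exact hv.continuousOn.mono inter_subset_left
  have hO : IsOpen (P ∪ Q)ᶜ := (hP.union hQ).isOpen_compl
  refine ⟨v', ⟨hcont, fun z => (hv.nonneg z).trans (hle z), fun z => ?_, fun z hz => ?_,
    fun w hw => ?_⟩, hle, hmv, fun z hz => by rw [hin (Metric.sphere_subset_closedBall hz), hHs hz]⟩
  · by_cases hzb : z ∈ Metric.ball c R
    · rw [hin (Metric.ball_subset_closedBall hzb)]
      exact hH1 z (Metric.ball_subset_closedBall hzb)
    · rw [hout z hzb]; exact hv.le_one z
  · rw [hout z fun hzb => hc (Metric.ball_subset_closedBall hzb) (Or.inr hz)]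
    exact hv.eq_zero z hz
  · by_cases hwb : w ∈ Metric.ball c R
    · exact hmv.localSubmeanAt
        (mem_of_superset (Metric.isOpen_ball.mem_nhds hwb) Metric.ball_subset_closedBall)
    · obtain ⟨ρ, hρ, h⟩ := hv.submean w hw
      obtain ⟨σ, hσ, hσb⟩ := Metric.isOpen_iff.mp hO w hw
      refine ⟨min ρ σ, lt_min hρ hσ, fun r hr => ?_⟩
      obtain ⟨h1, h2⟩ := h r ⟨hr.1, hr.2.trans_le (min_le_left _ _)⟩
      have hi : CircleIntegrable v' w r := hcont.circleIntegrable_of_closedBall_subset hr.1.le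
        ((Metric.closedBall_subset_ball (hr.2.trans_le (min_le_right _ _))).trans
          (hσb.trans (compl_subset_compl.mpr subset_union_left)))
      refine ⟨hi, ?_⟩
      rw [hout w hwb]
      exact h2.trans (Real.circleAverage_mono h1 hi fun z _ => hle z)

/-- Upper envelope of the competitors. -/
noncomputable def dirichletEnvelope (P Q : Set ℂ) (z : ℂ) : ℝ :=
  sSup {y | ∃ v, IsDirichletSub P Q v ∧ y = v z}

theorem IsDirichletSub.le_envelope {P Q : Set ℂ} {v : ℂ → ℝ} (hv : IsDirichletSub P Q v) (z : ℂ) :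
    v z ≤ dirichletEnvelope P Q z := by
  refine le_csSup ⟨1, ?_⟩ ⟨v, hv, rfl⟩
  rintro y ⟨v, hv, rfl⟩
  exact hv.le_one z

theorem dirichletEnvelope_le {P Q : Set ℂ} {z : ℂ} {a : ℝ}
    (h : ∀ v, IsDirichletSub P Q v → v z ≤ a) : dirichletEnvelope P Q z ≤ a := by
  refine csSup_le ⟨0, _, isDirichletSub_zero P Q, rfl⟩ ?_
  rintro y ⟨v, hv, rfl⟩
  exact h v hv

theorem exists_lt_of_lt_dirichletEnvelope {P Q : Set ℂ} {z : ℂ} {a : ℝ}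
    (h : a < dirichletEnvelope P Q z) : ∃ v, IsDirichletSub P Q v ∧ a < v z := by
  by_contra! hcon
  exact absurd (dirichletEnvelope_le hcon) (not_le.mpr h)

/-- Harnack's inequality for the lifted competitors passes to the supremum, and its two constants
tend to 1 at the centre of the disc. -/
theorem continuousOn_dirichletEnvelope {P Q : Set ℂ} (hP : IsClosed P) (hQ : IsClosed Q) :
    ContinuousOn (dirichletEnvelope P Q) (P ∪ Q)ᶜ := by
  intro c hc
  refine ContinuousAt.continuousWithinAt ?_
  have hO : IsOpen (P ∪ Q)ᶜ := (hP.union hQ).isOpen_compl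
  obtain ⟨R, hR, hb⟩ := Metric.nhds_basis_closedBall.mem_iff.mp (hO.mem_nhds hc)
  have h1 : ∀ w ∈ Metric.ball c R, dirichletEnvelope P Q w ≤
      (R + ‖w - c‖) / (R - ‖w - c‖) * dirichletEnvelope P Q c := by
    intro w hw
    have hwR : ‖w - c‖ < R := by rwa [← dist_eq_norm]
    refine dirichletEnvelope_le fun v hv => ?_
    obtain ⟨v', hv', hle, hmv, -⟩ := hv.exists_lift hP hQ hR hb
    refine (hle w).trans ((hmv.harnack (fun z _ => hv'.nonneg z) hw).2.trans ?_)
    refine mul_le_mul_of_nonneg_left (hv'.le_envelope c) (div_nonneg ?_ (by linarith))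
    linarith [norm_nonneg (w - c)]
  have h2 : ∀ w ∈ Metric.ball c R,
      (R - ‖w - c‖) / (R + ‖w - c‖) * dirichletEnvelope P Q c ≤ dirichletEnvelope P Q w := by
    intro w hw
    have hwR : ‖w - c‖ < R := by rwa [← dist_eq_norm]
    have hq : 0 < (R - ‖w - c‖) / (R + ‖w - c‖) :=
      div_pos (by linarith) (by linarith [norm_nonneg (w - c)])
    rw [← le_div_iff₀' hq]
    refine dirichletEnvelope_le fun v hv => ?_
    obtain ⟨v', hv', hle, hmv, -⟩ := hv.exists_lift hP hQ hR hb
    rw [le_div_iff₀' hq]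
    refine (mul_le_mul_of_nonneg_left (hle c) hq.le).trans
      ((hmv.harnack (fun z _ => hv'.nonneg z) hw).1.trans (hv'.le_envelope w))
  have t1 : Tendsto (fun w => (R + ‖w - c‖) / (R - ‖w - c‖) * dirichletEnvelope P Q c) (𝓝 c)
      (𝓝 (dirichletEnvelope P Q c)) := by
    have h : ContinuousAt
        (fun w => (R + ‖w - c‖) / (R - ‖w - c‖) * dirichletEnvelope P Q c) c :=
      (ContinuousAt.div (by fun_prop) (by fun_prop) (by simpa using hR.ne')).mul continuousAt_const
    simpa [ContinuousAt, hR.ne'] using h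
  have t2 : Tendsto (fun w => (R - ‖w - c‖) / (R + ‖w - c‖) * dirichletEnvelope P Q c) (𝓝 c)
      (𝓝 (dirichletEnvelope P Q c)) := by
    have h : ContinuousAt
        (fun w => (R - ‖w - c‖) / (R + ‖w - c‖) * dirichletEnvelope P Q c) c :=
      (ContinuousAt.div (by fun_prop) (by fun_prop) (by simpa using hR.ne')).mul continuousAt_const
    simpa [ContinuousAt, hR.ne'] using h
  refine tendsto_of_tendsto_of_tendsto_of_le_of_le' t2 t1 ?_ ?_
  · filter_upwards [Metric.ball_mem_nhds c hR] with w hw using h2 w hw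
  · filter_upwards [Metric.ball_mem_nhds c hR] with w hw using h1 w hw

/-- On a compact set the envelope is approximated uniformly from below by a single competitor. -/
theorem exists_isDirichletSub_near {P Q : Set ℂ} (hP : IsClosed P) (hQ : IsClosed Q) {S : Set ℂ}
    (hS : IsCompact S) (hSO : S ⊆ (P ∪ Q)ᶜ) {ε : ℝ} (hε : 0 < ε) :
    ∃ v, IsDirichletSub P Q v ∧ ∀ z ∈ S, dirichletEnvelope P Q z - ε ≤ v z := by
  have hO : IsOpen (P ∪ Q)ᶜ := (hP.union hQ).isOpen_compl
  refine hS.induction_on (p := fun S => ∃ v, IsDirichletSub P Q v ∧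
    ∀ z ∈ S, dirichletEnvelope P Q z - ε ≤ v z) ⟨_, isDirichletSub_zero P Q, by simp⟩ ?_ ?_ ?_
  · rintro s t hst ⟨v, hv, h⟩
    exact ⟨v, hv, fun z hz => h z (hst hz)⟩
  · rintro s t ⟨v, hv, h⟩ ⟨w, hw, h'⟩
    refine ⟨_, hv.max hw, ?_⟩
    rintro z (hz | hz)
    · exact (h z hz).trans (le_max_left _ _)
    · exact (h' z hz).trans (le_max_right _ _)
  · intro x hx
    obtain ⟨v, hv, hlt⟩ := exists_lt_of_lt_dirichletEnvelope
      (show dirichletEnvelope P Q x - ε < dirichletEnvelope P Q x by linarith)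
    have hcx : ContinuousAt (fun z => dirichletEnvelope P Q z - ε) x :=
      ((continuousOn_dirichletEnvelope hP hQ).continuousAt (hO.mem_nhds (hSO hx))).sub
        continuousAt_const
    have hvx : ContinuousAt v x := hv.continuousOn.continuousAt
      (hP.isOpen_compl.mem_nhds fun h => hSO hx (Or.inl h))
    refine ⟨{z | dirichletEnvelope P Q z - ε < v z}, mem_nhdsWithin_of_mem_nhds ?_,
      v, hv, fun z hz => le_of_lt hz⟩
    exact hcx.eventually_lt hvx hlt

/-- On the circle a single competitor is within `ε` of the envelope, by compactness and stability
under `max`. Its Poisson modification has the mean value property, and letting `ε` tend to 0 gives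
the harder inequality. -/
theorem meanValueOn_dirichletEnvelope {P Q : Set ℂ} (hP : IsClosed P) (hQ : IsClosed Q) :
    MeanValueOn (dirichletEnvelope P Q) (P ∪ Q)ᶜ := by
  have hcont := continuousOn_dirichletEnvelope hP hQ
  refine ⟨hcont, fun w r hr hw => ?_⟩
  rcases hr.eq_or_lt with rfl | hr
  · simp
  have hi := hcont.circleIntegrable_of_closedBall_subset hr.le hw
  refine le_antisymm ?_ ?_
  · refine le_of_forall_pos_le_add fun ε hε => ?_
    obtain ⟨v, hv, h⟩ := exists_isDirichletSub_near hP hQ (isCompact_sphere w r)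
      (Metric.sphere_subset_closedBall.trans hw) hε
    obtain ⟨v', hv', hle, hmv, -⟩ := hv.exists_lift hP hQ hr hw
    have h1 : Real.circleAverage (dirichletEnvelope P Q) w r ≤
        Real.circleAverage (fun z => v' z + ε) w r := by
      refine Real.circleAverage_mono hi
        ((hmv.add (meanValueOn_const ε _)).circleIntegrable hr.le subset_rfl) fun z hz => ?_
      rw [abs_of_pos hr] at hz
      linarith [h z hz, hle z]
    rw [(hmv.add (meanValueOn_const ε _)).circleAverage_eq w r hr.le subset_rfl] at h1
    linarith [hv'.le_envelope w]
  · refine dirichletEnvelope_le fun v hv => ?_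
    obtain ⟨v', hv', hle, hmv, -⟩ := hv.exists_lift hP hQ hr hw
    refine (hle w).trans ?_
    rw [← hmv.circleAverage_eq w r hr.le subset_rfl]
    exact Real.circleAverage_mono (hmv.circleIntegrable hr.le subset_rfl) hi
      fun z _ => hv'.le_envelope z

/-- `P` meets all sufficiently small circles around `ζ`. -/
def MeetsSmallCircles (P : Set ℂ) (ζ : ℂ) : Prop :=
  ∃ R > 0, ∀ s ∈ Icc (0 : ℝ) R, ∃ z ∈ P, ‖z - ζ‖ = s

theorem MeetsSmallCircles.exists_pos_lt {P : Set ℂ} {ζ : ℂ} (h : MeetsSmallCircles P ζ) {Q : Set ℂ}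
    (hQ : IsClosed Q) (hζ : ζ ∉ Q) :
    ∃ R > 0, (∀ s ∈ Icc (0 : ℝ) R, ∃ z ∈ P, ‖z - ζ‖ = s) ∧ Metric.closedBall ζ R ⊆ Qᶜ := by
  obtain ⟨R, hR, h⟩ := h
  obtain ⟨R', hR', hb⟩ := Metric.nhds_basis_closedBall.mem_iff.mp (hQ.isOpen_compl.mem_nhds hζ)
  exact ⟨min R R', lt_min hR hR', fun s hs => h s ⟨hs.1, hs.2.trans (min_le_left _ _)⟩,
    (Metric.closedBall_subset_closedBall (min_le_right _ _)).trans hb⟩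

/-- The positive part of the barrier at `ζ` is itself a competitor: it vanishes on `Q`, which stays
at distance more than `R` from `ζ`. Its value on `P` is immaterial, as competitors are continuous
only off `P`. -/
theorem dirichletEnvelope_near_one {P Q : Set ℂ} (hP : IsClosed P) (hQ : IsClosed Q)
    (hd : Disjoint P Q) {ζ : ℂ} (hζ : ζ ∈ P) (hr : MeetsSmallCircles P ζ) {ε : ℝ} (hε : 0 < ε) :
    ∃ δ > 0, ∀ z ∉ P, ‖z - ζ‖ < δ → 1 - ε ≤ dirichletEnvelope P Q z := by
  classical
  obtain ⟨R, hR, hs, hb⟩ := hr.exists_pos_lt hQ (disjoint_left.mp hd hζ)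
  obtain ⟨δ, hδ, f, hf, h1, h2, h3⟩ := exists_barrier hP hR hs hε
  set v : ℂ → ℝ := fun z => if z ∈ P then 0 else max (f z) 0 with hv
  have hvP : EqOn v (fun z => max (f z) 0) Pᶜ := fun z hz => if_neg hz
  have hvf : IsDirichletSub P Q v := by
    refine ⟨(hf.continuousOn.sup continuousOn_const).congr hvP, fun z => ?_, fun z => ?_,
      fun z hz => ?_, fun w hw => ?_⟩
    · by_cases hz : z ∈ P
      · simp [hv, hz]
      · rw [hvP hz]; exact le_max_right _ _
    · by_cases hz : z ∈ P
      · simp [hv, hz]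
      · rw [hvP hz]; exact max_le (h1 z hz) zero_le_one
    · have hzP : z ∉ P := disjoint_right.mp hd hz
      rw [hvP hzP]
      refine max_eq_right (h2 z hzP ?_)
      by_contra! h
      exact hb (by rw [mem_closedBall_iff_norm]; exact h.le) hz
    · have hwP : w ∈ Pᶜ := fun h => hw (Or.inl h)
      obtain ⟨ρ, hρ, h⟩ := (hf.localSubmeanAt (hP.isOpen_compl.mem_nhds hwP)).max
        ((meanValueOn_const 0 univ).localSubmeanAt univ_mem)
      obtain ⟨σ, hσ, hσb⟩ := Metric.isOpen_iff.mp hP.isOpen_compl w hwP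
      refine ⟨min ρ σ, lt_min hρ hσ, fun r hr => ?_⟩
      obtain ⟨h4, h5⟩ := h r ⟨hr.1, hr.2.trans_le (min_le_left _ _)⟩
      have hsub : Metric.sphere w |r| ⊆ Pᶜ := sphere_abs_subset hr.1.le
        ((Metric.closedBall_subset_ball (hr.2.trans_le (min_le_right _ _))).trans hσb)
      refine ⟨IntervalIntegrable.congr (fun θ _ => ?_) h4, ?_⟩
      · exact (hvP (hsub (circleMap_mem_sphere' w r θ))).symm
      · rw [Real.circleAverage_congr_sphere (hvP.mono hsub), hvP hwP]
        exact h5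
  refine ⟨δ, hδ, fun z hz hzδ => (h3 z hz hzδ).trans (le_trans ?_ (hvf.le_envelope z))⟩
  rw [hvP hz]
  exact le_max_left _ _

/-- With `f` the barrier of `Q` at `ζ`, every competitor lies below `1 - f` near `ζ`: on `Q` the
competitor vanishes and `f ≤ 1` near it, while on the circle of radius `R` it is at most 1 and `f ≤
0`. -/
theorem dirichletEnvelope_near_zero {P Q : Set ℂ} (hP : IsClosed P) (hQ : IsClosed Q)
    (hd : Disjoint P Q) {ζ : ℂ} (hζ : ζ ∈ Q) (hr : MeetsSmallCircles Q ζ) {ε : ℝ} (hε : 0 < ε) :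
    ∃ δ > 0, ∀ z ∉ P, ‖z - ζ‖ < δ → dirichletEnvelope P Q z ≤ ε := by
  obtain ⟨R, hR, hs, hb⟩ := hr.exists_pos_lt hP (disjoint_right.mp hd hζ)
  obtain ⟨δ, hδ, f, hf, h1, h2, h3⟩ := exists_barrier hQ hR hs hε
  have hO : IsOpen (P ∪ Q)ᶜ := (hP.union hQ).isOpen_compl
  refine ⟨min δ R, lt_min hδ hR, fun z hz hzδ => dirichletEnvelope_le fun v hv => ?_⟩
  by_cases hzQ : z ∈ Q
  · rw [hv.eq_zero z hzQ]; exact hε.le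
  set W : Set ℂ := (P ∪ Q)ᶜ ∩ Metric.ball ζ R with hW
  have hcont : ∀ w ∉ P, w ∉ Q → ContinuousAt (fun z => v z + (f z + -1)) w := fun w hwP hwQ =>
    (hv.continuousOn.continuousAt (hP.isOpen_compl.mem_nhds hwP)).add
      ((hf.continuousOn.continuousAt (hQ.isOpen_compl.mem_nhds hwQ)).add continuousAt_const)
  have key := nonpos_of_localSubmeanOn (W := W) (hO.inter Metric.isOpen_ball)
    (Metric.isBounded_ball.subset inter_subset_right) (g := fun z => v z + (f z + -1))
    (ContinuousOn.upperSemicontinuousOn fun w hw => (hcont w (fun h => hw.1 (Or.inl h))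
      (fun h => hw.1 (Or.inr h))).continuousWithinAt)
    (fun w hw => (hv.submean w hw.1).add ((hf.add (meanValueOn_const (-1) _)).localSubmeanAt
      (hQ.isOpen_compl.mem_nhds fun h => hw.1 (Or.inr h))))
    (fun ξ hξ c hc => by
      have hξb : ξ ∈ Metric.closedBall ζ R := Metric.closure_ball_subset_closedBall
        (closure_mono inter_subset_right (frontier_subset_closure hξ))
      have hξP : ξ ∉ P := hb hξb
      by_cases hξQ : ξ ∈ Q
      · have hvξ : ContinuousAt v ξ := hv.continuousOn.continuousAt (hP.isOpen_compl.mem_nhds hξP)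
        have := hvξ.eventually_lt_const (show v ξ < c by rwa [hv.eq_zero ξ hξQ])
        filter_upwards [mem_nhdsWithin_of_mem_nhds this, self_mem_nhdsWithin] with w hw hwW
        linarith [h1 w fun h => hwW.1 (Or.inr h)]
      · have hξR : R ≤ ‖ξ - ζ‖ := by
          by_contra! h
          have hξW : ξ ∈ W := ⟨by rintro (h | h); exacts [hξP h, hξQ h], by
            rwa [Metric.mem_ball, dist_eq_norm]⟩
          rw [(hO.inter Metric.isOpen_ball).frontier_eq] at hξ
          exact hξ.2 hξW
        have := (hcont ξ hξP hξQ).eventually_lt_const (show v ξ + (f ξ + -1) < c by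
          linarith [h2 ξ hξQ hξR, hv.le_one ξ])
        exact mem_nhdsWithin_of_mem_nhds this)
  have hzW : z ∈ W := ⟨by rintro (h | h); exacts [hz h, hzQ h], by
    rw [Metric.mem_ball, dist_eq_norm]; exact hzδ.trans_le (min_le_right _ _)⟩
  linarith [key z hzW, h3 z hzQ (hzδ.trans_le (min_le_left _ _))]

/-- The solution of the Dirichlet problem with boundary values `1` on `P` and `0` on `Q`, extended
to the plane by these values. -/
structure IsDirichletSolution (P Q : Set ℂ) (U : ℂ → ℝ) : Prop where
  continuous : Continuous U
  nonneg : ∀ z, 0 ≤ U z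
  le_one : ∀ z, U z ≤ 1
  eq_one : ∀ z ∈ P, U z = 1
  eq_zero : ∀ z ∈ Q, U z = 0
  meanValueOn : MeanValueOn U (P ∪ Q)ᶜ

theorem exists_isDirichletSolution {P Q : Set ℂ} (hP : IsClosed P) (hQ : IsClosed Q)
    (hd : Disjoint P Q) (hPr : ∀ ζ ∈ P, MeetsSmallCircles P ζ)
    (hQr : ∀ ζ ∈ Q, MeetsSmallCircles Q ζ) : ∃ U, IsDirichletSolution P Q U := by
  classical
  set U : ℂ → ℝ := fun z => if z ∈ P then 1 else dirichletEnvelope P Q z with hU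
  have hUP : ∀ z ∈ P, U z = 1 := fun z hz => if_pos hz
  have hUe : ∀ z ∉ P, U z = dirichletEnvelope P Q z := fun z hz => if_neg hz
  have hU0 : ∀ z, 0 ≤ U z := by
    intro z
    by_cases hz : z ∈ P
    · rw [hUP z hz]; exact zero_le_one
    · rw [hUe z hz]; exact (isDirichletSub_zero P Q).le_envelope z
  have hU1 : ∀ z, U z ≤ 1 := by
    intro z
    by_cases hz : z ∈ P
    · rw [hUP z hz]
    · rw [hUe z hz]; exact dirichletEnvelope_le fun v hv => hv.le_one z
  have hUQ : ∀ z ∈ Q, U z = 0 := by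
    intro z hz
    rw [hUe z (disjoint_right.mp hd hz)]
    exact le_antisymm (dirichletEnvelope_le fun v hv => (hv.eq_zero z hz).le)
      ((isDirichletSub_zero P Q).le_envelope z)
  have hmv : MeanValueOn U (P ∪ Q)ᶜ := (meanValueOn_dirichletEnvelope hP hQ).congr
    fun z hz => hUe z fun h => hz (Or.inl h)
  refine ⟨U, ?_, hU0, hU1, hUP, hUQ, hmv⟩
  rw [continuous_iff_continuousAt]
  intro ζ
  by_cases hζP : ζ ∈ P
  · refine Metric.continuousAt_iff.mpr fun ε hε => ?_
    obtain ⟨δ, hδ, h⟩ := dirichletEnvelope_near_one hP hQ hd hζP (hPr ζ hζP) (half_pos hε)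
    refine ⟨δ, hδ, fun {z} hz => ?_⟩
    rw [hUP ζ hζP, Real.dist_eq, abs_lt]
    refine ⟨?_, by linarith [hU1 z]⟩
    by_cases hzP : z ∈ P
    · rw [hUP z hzP]; linarith
    · have := h z hzP (by rwa [← dist_eq_norm])
      rw [hUe z hzP]; linarith
  by_cases hζQ : ζ ∈ Q
  · refine Metric.continuousAt_iff.mpr fun ε hε => ?_
    obtain ⟨δ, hδ, h⟩ := dirichletEnvelope_near_zero hP hQ hd hζQ (hQr ζ hζQ) (half_pos hε)
    obtain ⟨δ', hδ', hb⟩ := Metric.isOpen_iff.mp hP.isOpen_compl ζ hζP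
    refine ⟨min δ δ', lt_min hδ hδ', fun {z} hz => ?_⟩
    have hzP : z ∉ P := hb (hz.trans_le (min_le_right _ _))
    have h1 := h z hzP (by rw [← dist_eq_norm]; exact hz.trans_le (min_le_left _ _))
    rw [hUQ ζ hζQ, Real.dist_eq, sub_zero, abs_of_nonneg (hU0 z), hUe z hzP]
    linarith
  · exact hmv.continuousOn.continuousAt ((hP.union hQ).isOpen_compl.mem_nhds
      (by rintro (h | h); exacts [hζP h, hζQ h]))

/-- At points of `Q` the value 0 is the global minimum, so the submean inequality crosses `Q` for
free. Exchanging the roles of `P` and `Q` by `symm` gives the supermean inequality across `P`. -/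
theorem IsDirichletSolution.localSubmeanAt {P Q : Set ℂ} {U : ℂ → ℝ}
    (h : IsDirichletSolution P Q U) (hP : IsClosed P) (hQ : IsClosed Q) {w : ℂ} (hw : w ∉ P) :
    LocalSubmeanAt U w := by
  by_cases hwQ : w ∈ Q
  · refine ⟨1, one_pos, fun r _ => ⟨h.continuous.continuousOn.circleIntegrable', ?_⟩⟩
    rw [h.eq_zero w hwQ]
    exact Real.circleAverage_nonneg_of_nonneg fun z _ => h.nonneg z
  · exact h.meanValueOn.localSubmeanAt ((hP.union hQ).isOpen_compl.mem_nhds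
      (by rintro (h | h); exacts [hw h, hwQ h]))

theorem IsDirichletSolution.le_circleAverage {P Q : Set ℂ} {U : ℂ → ℝ}
    (h : IsDirichletSolution P Q U) (hP : IsClosed P) (hQ : IsClosed Q) {w : ℂ} {r : ℝ}
    (hr : 0 ≤ r) (hw : Metric.closedBall w r ⊆ Pᶜ) : U w ≤ Real.circleAverage U w r :=
  le_circleAverage_of_localSubmean hr h.continuous.continuousOn fun _ hz =>
    h.localSubmeanAt hP hQ (hw (Metric.ball_subset_closedBall hz))

theorem IsDirichletSolution.symm {P Q : Set ℂ} {U : ℂ → ℝ} (h : IsDirichletSolution P Q U) :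
    IsDirichletSolution Q P fun z => 1 - U z :=
  ⟨continuous_const.sub h.continuous, fun z => by linarith [h.le_one z],
    fun z => by linarith [h.nonneg z], fun z hz => by rw [h.eq_zero z hz]; ring,
    fun z hz => by rw [h.eq_one z hz]; ring,
    by rw [union_comm]; exact (meanValueOn_const 1 _).sub h.meanValueOn⟩

theorem IsDirichletSolution.circleAverage_le {P Q : Set ℂ} {U : ℂ → ℝ}
    (h : IsDirichletSolution P Q U) (hP : IsClosed P) (hQ : IsClosed Q) {w : ℂ} {r : ℝ}
    (hr : 0 ≤ r) (hw : Metric.closedBall w r ⊆ Qᶜ) : Real.circleAverage U w r ≤ U w := by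
  have h1 := h.symm.le_circleAverage hQ hP hr hw
  rw [Real.circleAverage_fun_sub (circleIntegrable_const 1 w r)
    h.continuous.continuousOn.circleIntegrable', Real.circleAverage_const] at h1
  linarith

/-! ### Symmetry of circle averages and the bump kernel -/

theorem continuous_circleAverage_comp {φ : ℂ → ℝ} (hφ : Continuous φ) {ρ : ℂ → ℝ}
    (hρ : Continuous ρ) : Continuous fun z => Real.circleAverage φ z (ρ z) := by
  simp only [Real.circleAverage_def, smul_eq_mul]
  have h : Continuous fun z => ∫ θ in (0 : ℝ)..2 * Real.pi, φ (circleMap z (ρ z) θ) := by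
    apply intervalIntegral.continuous_parametric_intervalIntegral_of_continuous'
    simp only [Function.uncurry_def, circleMap]
    fun_prop
  exact continuous_const.mul h

theorem circleMap_eq_add (w : ℂ) (r θ : ℝ) : circleMap w r θ = w + circleMap 0 r θ := by
  simp [circleMap]

theorem circleMap_neg_radius_eq_sub (w : ℂ) (r θ : ℝ) :
    circleMap w (-r) θ = w - circleMap 0 r θ := by
  simp [circleMap, sub_eq_add_neg]

/-- Averaging over circles is symmetric. -/
theorem integral_circleAverage_mul {U φ : ℂ → ℝ} (hU : Continuous U) {R₀ : ℝ}
    (hR₀ : ∀ z, R₀ ≤ ‖z‖ → U z = 0) (hm : Measurable φ) (hφ : LocallyIntegrable φ) (r : ℝ) :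
    ∫ w, Real.circleAverage U w r * φ w = ∫ w, U w * Real.circleAverage φ w r := by
  have hcs : HasCompactSupport U := HasCompactSupport.intro (isCompact_closedBall (0 : ℂ) R₀)
    fun z hz => hR₀ z (by simpa using (not_le.mp fun h => hz (by simpa using h)).le)
  obtain ⟨C, hC⟩ := hU.bounded_above_of_compact_support hcs
  set ν : Measure ℝ := volume.restrict (Ioc 0 (2 * Real.pi)) with hν
  set c : ℝ → ℂ := fun θ => circleMap 0 r θ with hc
  have hcc : Continuous c := continuous_circleMap 0 r
  have hcn : ∀ θ, ‖c θ‖ = |r| := fun θ => norm_circleMap_zero r θ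
  have hB : IntegrableOn φ (Metric.closedBall 0 (R₀ + |r|)) :=
    hφ.integrableOn_isCompact (isCompact_closedBall _ _)
  have hF : Integrable (fun p : ℂ × ℝ => U (p.1 + c p.2) * φ p.1) (volume.prod ν) := by
    have h1 : Integrable (fun p : ℂ × ℝ =>
        C * |(Metric.closedBall (0 : ℂ) (R₀ + |r|)).indicator φ p.1|) (volume.prod ν) :=
      (((integrable_indicator_iff Metric.isClosed_closedBall.measurableSet).mpr hB).abs.comp_fst
        ν).const_mul C
    refine h1.mono' ?_ (Eventually.of_forall fun p => ?_)
    · exact (((hU.comp (continuous_fst.add (hcc.comp continuous_snd))).measurable).mul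
        (hm.comp measurable_fst)).aestronglyMeasurable
    · by_cases hp : p.1 ∈ Metric.closedBall (0 : ℂ) (R₀ + |r|)
      · rw [indicator_of_mem hp, norm_mul, Real.norm_eq_abs (φ p.1)]
        exact mul_le_mul_of_nonneg_right (hC _) (abs_nonneg _)
      · have : U (p.1 + c p.2) = 0 := by
          refine hR₀ _ ?_
          have h2 : R₀ + |r| < ‖p.1‖ := by simpa using hp
          have h3 : ‖p.1‖ ≤ ‖p.1 + c p.2‖ + ‖c p.2‖ := by
            simpa using norm_sub_le (p.1 + c p.2) (c p.2)
          rw [hcn] at h3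
          linarith
        rw [this, indicator_of_notMem hp]
        simp
  have hG : Integrable (fun p : ℂ × ℝ => U p.1 * φ (p.1 - c p.2)) (volume.prod ν) := by
    have hmeas : AEStronglyMeasurable (fun p : ℂ × ℝ => U p.1 * φ (p.1 - c p.2))
        (volume.prod ν) := by
      refine ((hU.measurable.comp measurable_fst).mul (hm.comp ?_)).aestronglyMeasurable
      exact (continuous_fst.sub (hcc.comp continuous_snd)).measurable
    have hF' := (integrable_prod_iff' hF.aestronglyMeasurable).mp hF
    rw [integrable_prod_iff' hmeas]
    constructor
    · filter_upwards [hF'.1] with θ hθ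
      simpa using hθ.comp_sub_right (c θ)
    · refine hF'.2.congr (Eventually.of_forall fun θ => ?_)
      have := integral_sub_right_eq_self (fun x : ℂ => ‖U (x + c θ) * φ x‖) (μ := volume) (c θ)
      simpa using this.symm
  -- The circle is symmetric about its centre, so the average may be written with `w - c θ`, the
  -- form produced by translating the area integral.
  have hA : ∀ w, Real.circleAverage φ w r = (2 * Real.pi)⁻¹ * ∫ θ, φ (w - c θ) ∂ν := by
    intro w
    rw [← Real.circleAverage_neg_radius, Real.circleAverage_def,
      intervalIntegral.integral_of_le (by positivity), smul_eq_mul]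
    simp only [circleMap_neg_radius_eq_sub w, hc, hν]
  have hA' : ∀ w, Real.circleAverage U w r = (2 * Real.pi)⁻¹ * ∫ θ, U (w + c θ) ∂ν := by
    intro w
    rw [Real.circleAverage_def, intervalIntegral.integral_of_le (by positivity), smul_eq_mul]
    simp only [circleMap_eq_add w, hc, hν]
  calc ∫ w, Real.circleAverage U w r * φ w
      = (2 * Real.pi)⁻¹ * ∫ w, ∫ θ, U (w + c θ) * φ w ∂ν := by
        rw [← integral_const_mul]
        refine integral_congr_ae (Eventually.of_forall fun w => ?_)
        simp only [hA', integral_mul_const, mul_assoc]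
    _ = (2 * Real.pi)⁻¹ * ∫ θ, (∫ w, U (w + c θ) * φ w) ∂ν := by
        rw [integral_integral_swap hF]
    _ = (2 * Real.pi)⁻¹ * ∫ θ, (∫ w, U w * φ (w - c θ)) ∂ν := by
        congr 1
        refine integral_congr_ae (Eventually.of_forall fun θ => ?_)
        have := integral_sub_right_eq_self (fun x : ℂ => U (x + c θ) * φ x) (μ := volume) (c θ)
        simpa using this.symm
    _ = (2 * Real.pi)⁻¹ * ∫ w, ∫ θ, U w * φ (w - c θ) ∂ν := by
        rw [integral_integral_swap (f := fun w θ => U w * φ (w - c θ)) hG]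
    _ = ∫ w, U w * Real.circleAverage φ w r := by
        rw [← integral_const_mul]
        refine integral_congr_ae (Eventually.of_forall fun w => ?_)
        simp only [hA, integral_const_mul]
        ring

/-- The difference between the logarithmic kernel and its average over circles of radius `r`. -/
noncomputable def logBump (r : ℝ) (x : ℂ) : ℝ := Real.posLog (r / ‖x‖)

theorem logBump_nonneg (r : ℝ) (x : ℂ) : 0 ≤ logBump r x := Real.posLog_nonneg

theorem measurable_logBump (r : ℝ) : Measurable (logBump r) := by
  unfold logBump Real.posLog
  fun_prop

theorem logBump_eq_zero {r : ℝ} (hr : 0 ≤ r) {x : ℂ} (hx : r ≤ ‖x‖) : logBump r x = 0 := by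
  unfold logBump
  rw [Real.posLog_eq_zero_iff, abs_of_nonneg (by positivity)]
  exact div_le_one_of_le₀ hx (norm_nonneg x)

theorem logBump_eq_log_max_sub {r : ℝ} (hr : 0 < r) {x : ℂ} (hx : x ≠ 0) :
    logBump r x = Real.log (max r ‖x‖) - Real.log ‖x‖ := by
  have hx' : 0 < ‖x‖ := norm_pos_iff.mpr hx
  rcases le_total ‖x‖ r with h | h
  · rw [max_eq_left h, ← Real.log_div hr.ne' hx'.ne']
    refine Real.posLog_eq_log ?_
    rw [abs_of_nonneg (by positivity)]
    exact (one_le_div hx').mpr h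
  · rw [logBump_eq_zero hr.le h, max_eq_right h, sub_self]

theorem logBump_smul {r : ℝ} (hr : 0 < r) (x : ℂ) : logBump r (r • x) = logBump 1 x := by
  unfold logBump
  rw [norm_smul, Real.norm_of_nonneg hr.le, div_mul_eq_div_div, div_self hr.ne']

/-- In polar coordinates the integrand is `y log (1 / y) ≤ 1` on `(0, 1]` and 0 beyond. -/
theorem integrable_logBump_one : Integrable (logBump 1) := by
  have : logBump 1 = fun x : ℂ => (fun t : ℝ => Real.posLog (1 / t)) ‖x‖ := rfl
  rw [this]
  refine (integrable_fun_norm_addHaar (μ := volume) (f := fun t : ℝ => Real.posLog (1 / t))).mpr ?_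
  rw [Complex.finrank_real_complex]
  have h1 : IntegrableOn (fun _ : ℝ => (1 : ℝ)) (Ioc 0 1) := by simp
  have h2 : IntegrableOn (fun y : ℝ => (Ioc (0 : ℝ) 1).indicator (fun _ => (1 : ℝ)) y) (Ioi 0) :=
    ((integrable_indicator_iff measurableSet_Ioc).mpr h1).integrableOn
  refine h2.mono' ?_ ?_
  · refine Measurable.aestronglyMeasurable ?_
    unfold Real.posLog
    fun_prop
  · filter_upwards [ae_restrict_mem measurableSet_Ioi] with y hy
    have hy0 : (0 : ℝ) < y := hy
    rcases le_or_gt y 1 with h | h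
    · rw [indicator_of_mem (show y ∈ Ioc (0 : ℝ) 1 from ⟨hy0, h⟩), norm_smul, Real.norm_of_nonneg
        Real.posLog_nonneg, Real.posLog_eq_log (by
          rw [abs_of_nonneg (by positivity)]; exact (one_le_div hy0).mpr h)]
      have h3 := Real.log_le_sub_one_of_pos (show (0 : ℝ) < 1 / y by positivity)
      have h4 : y * (1 / y) = 1 := by field_simp
      simp only [Nat.add_one_sub_one, pow_one, Real.norm_of_nonneg hy0.le]
      nlinarith
    · have : Real.posLog (1 / y) = 0 := by
        rw [Real.posLog_eq_zero_iff, abs_of_nonneg (by positivity)]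
        exact div_le_one_of_le₀ h.le hy0.le
      simp only [this, smul_zero, norm_zero]
      exact indicator_nonneg (fun _ _ => zero_le_one) y

theorem integrable_logBump {r : ℝ} (hr : 0 < r) : Integrable (logBump r) := by
  rw [← integrable_comp_smul_iff volume (logBump r) hr.ne']
  simpa only [logBump_smul hr] using integrable_logBump_one

theorem integral_logBump {r : ℝ} (hr : 0 < r) :
    ∫ x, logBump r x = r ^ 2 * ∫ x, logBump 1 x := by
  have := Measure.integral_comp_smul volume (logBump r) r
  simp only [logBump_smul hr, Complex.finrank_real_complex, smul_eq_mul] at this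
  rw [this, abs_of_nonneg (by positivity)]
  field_simp

/-- Only positivity of this constant matters, as it enters as a normalization. -/
theorem integral_logBump_one_pos : 0 < ∫ x, logBump 1 x := by
  rw [integral_pos_iff_support_of_nonneg (logBump_nonneg 1) integrable_logBump_one]
  have hsub : Metric.ball (1 / 2 : ℂ) (1 / 4) ⊆ Function.support (logBump 1) := by
    intro x hx
    rw [Metric.mem_ball, dist_eq_norm] at hx
    have h1 : ‖x‖ < 1 := by
      have := norm_add_le (x - 1 / 2) (1 / 2)
      rw [sub_add_cancel] at this
      norm_num at this hx ⊢
      linarith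
    have h2 : 0 < ‖x‖ := by
      by_contra! h
      rw [norm_le_zero_iff.mp h] at hx
      norm_num at hx
    have h3 : x ≠ 0 := norm_pos_iff.mp h2
    rw [Function.mem_support, logBump_eq_log_max_sub one_pos h3, max_eq_left h1.le, Real.log_one]
    have := Real.log_neg h2 h1
    linarith
  exact (Metric.measure_ball_pos volume _ (by norm_num)).trans_le (measure_mono hsub)

/-- The averages against the normalized kernels `logBump r` approximate the values. -/
theorem abs_average_logBump_sub_le {U : ℂ → ℝ} {z : ℂ} {r ε : ℝ} (hr : 0 < r)
    (hi : Integrable fun w => U w * logBump r (w - z))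
    (h : ∀ w, ‖w - z‖ < r → |U w - U z| ≤ ε) :
    |((∫ x, logBump 1 x) * r ^ 2)⁻¹ * (∫ w, U w * logBump r (w - z)) - U z| ≤ ε := by
  have hκ := integral_logBump_one_pos
  have hiz : Integrable fun w => logBump r (w - z) := (integrable_logBump hr).comp_sub_right z
  have hk : ∫ w, logBump r (w - z) = (∫ x, logBump 1 x) * r ^ 2 := by
    rw [integral_sub_right_eq_self (logBump r) z, integral_logBump hr, mul_comm]
  have hpos : 0 < (∫ x, logBump 1 x) * r ^ 2 := by positivity
  have h1 : |∫ w, (U w - U z) * logBump r (w - z)| ≤ ∫ w, ε * logBump r (w - z) := by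
    rw [← Real.norm_eq_abs]
    refine norm_integral_le_of_norm_le (hiz.const_mul ε) (Eventually.of_forall fun w => ?_)
    rw [norm_mul, Real.norm_eq_abs, Real.norm_of_nonneg (logBump_nonneg _ _)]
    rcases lt_or_ge ‖w - z‖ r with hw | hw
    · exact mul_le_mul_of_nonneg_right (h w hw) (logBump_nonneg _ _)
    · rw [logBump_eq_zero hr.le hw, mul_zero, mul_zero]
  have h2 : ∫ w, (U w - U z) * logBump r (w - z) =
      (∫ w, U w * logBump r (w - z)) - U z * ((∫ x, logBump 1 x) * r ^ 2) := by
    simp only [sub_mul]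
    rw [integral_sub hi (hiz.const_mul (U z)), integral_const_mul, hk]
  rw [integral_const_mul, hk, h2] at h1
  have e : ((∫ x, logBump 1 x) * r ^ 2)⁻¹ * (∫ w, U w * logBump r (w - z)) - U z =
      ((∫ x, logBump 1 x) * r ^ 2)⁻¹ * ((∫ w, U w * logBump r (w - z)) -
        U z * ((∫ x, logBump 1 x) * r ^ 2)) := by
    field_simp
  rw [e, abs_mul, abs_of_pos (inv_pos.mpr hpos), inv_mul_le_iff₀ hpos]
  linarith

theorem integrable_mul_logBump {U : ℂ → ℝ} (hU : Continuous U) {R₀ : ℝ}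
    (hR₀ : ∀ z, R₀ ≤ ‖z‖ → U z = 0) {r : ℝ} (hr : 0 < r) (z : ℂ) :
    Integrable fun w => U w * logBump r (w - z) := by
  have hcs : HasCompactSupport U := HasCompactSupport.intro (isCompact_closedBall (0 : ℂ) R₀)
    fun z hz => hR₀ z (by simpa using (not_le.mp fun h => hz (by simpa using h)).le)
  obtain ⟨C, hC⟩ := hU.bounded_above_of_compact_support hcs
  exact ((integrable_logBump hr).comp_sub_right z).bdd_mul hU.aestronglyMeasurable
    (Eventually.of_forall hC)

theorem log_norm_eq (x : ℂ) : Real.log ‖x‖ = Real.log (max 1 ‖x‖) - logBump 1 x := by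
  rcases eq_or_ne x 0 with rfl | hx
  · simp [logBump]
  · rw [logBump_eq_log_max_sub one_pos hx]; ring

theorem continuous_log_max {r : ℝ} (hr : 0 < r) :
    Continuous fun x : ℂ => Real.log (max r ‖x‖) :=
  Continuous.log (by fun_prop) fun x => (hr.trans_le (le_max_left _ _)).ne'

theorem locallyIntegrable_log_norm_sub (z : ℂ) :
    LocallyIntegrable fun w => Real.log ‖w - z‖ := by
  simp only [fun w => log_norm_eq (w - z)]
  refine LocallyIntegrable.sub ?_ ?_
  · exact ((continuous_log_max one_pos).comp (continuous_sub_right z)).locallyIntegrable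
  · exact ((integrable_logBump one_pos).comp_sub_right z).locallyIntegrable

theorem integrable_continuous_mul {U φ : ℂ → ℝ} (hU : Continuous U) {R₀ : ℝ}
    (hR₀ : ∀ z, R₀ ≤ ‖z‖ → U z = 0) (hφ : LocallyIntegrable φ) :
    Integrable fun w => U w * φ w := by
  have hcs : HasCompactSupport U := HasCompactSupport.intro (isCompact_closedBall (0 : ℂ) R₀)
    fun z hz => hR₀ z (by simpa using (not_le.mp fun h => hz (by simpa using h)).le)
  simpa using hφ.integrable_smul_left_of_hasCompactSupport hU hcs

theorem circleAverage_eq_zero_of_le_norm {U : ℂ → ℝ} {R₀ : ℝ} (hR₀ : ∀ z, R₀ ≤ ‖z‖ → U z = 0)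
    {r : ℝ} (hr : 0 ≤ r) {w : ℂ} (hw : R₀ + r ≤ ‖w‖) : Real.circleAverage U w r = 0 := by
  rw [← Real.circleAverage_const 0 w r]
  refine Real.circleAverage_congr_sphere fun z hz => hR₀ z ?_
  rw [abs_of_nonneg hr, mem_sphere_iff_norm] at hz
  have : ‖w‖ ≤ ‖z‖ + ‖z - w‖ := by simpa using norm_sub_le z (z - w)
  linarith

theorem integral_sub_circleAverage_mul {U φ : ℂ → ℝ} (hU : Continuous U) {R₀ : ℝ}
    (hR₀ : ∀ z, R₀ ≤ ‖z‖ → U z = 0) (hm : Measurable φ) (hφ : LocallyIntegrable φ) {r : ℝ}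
    (hr : 0 ≤ r) (hA : Continuous fun w => Real.circleAverage φ w r) :
    ∫ w, (U w - Real.circleAverage U w r) * φ w =
      ∫ w, U w * (φ w - Real.circleAverage φ w r) := by
  simp only [sub_mul, mul_sub]
  rw [integral_sub (integrable_continuous_mul hU hR₀ hφ), integral_sub
    (integrable_continuous_mul hU hR₀ hφ) (integrable_continuous_mul hU hR₀ hA.locallyIntegrable),
    integral_circleAverage_mul hU hR₀ hm hφ]
  exact integrable_continuous_mul (R₀ := R₀ + r)
    (continuous_circleAverage_comp hU continuous_const)
    (fun z hz => circleAverage_eq_zero_of_le_norm hR₀ hr hz) hφ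

/-- Moved onto the kernel, the averaging operator leaves `logBump r`, which is nonnegative,
supported in a disc of radius `r` and has integral proportional to `r ^ 2`: after normalization, an
approximate identity. -/
theorem integral_sub_circleAverage_mul_neg_log {U : ℂ → ℝ} (hU : Continuous U) {R₀ : ℝ}
    (hR₀ : ∀ z, R₀ ≤ ‖z‖ → U z = 0) {r : ℝ} (hr : 0 < r) (z : ℂ) :
    ∫ w, (U w - Real.circleAverage U w r) * -Real.log ‖w - z‖ =
      ∫ w, U w * logBump r (w - z) := by
  have hA : (fun w => Real.circleAverage (fun w => Real.log ‖w - z‖) w r) =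
      fun w => Real.log (max r ‖w - z‖) := funext fun w => circleAverage_log_norm_sub z w hr
  have h := integral_sub_circleAverage_mul hU hR₀ (φ := fun w => Real.log ‖w - z‖) (by fun_prop)
    (locallyIntegrable_log_norm_sub z) hr.le (by
      rw [hA]; exact (continuous_log_max hr).comp (continuous_sub_right z))
  simp only [mul_neg]
  rw [integral_neg, h, ← integral_neg]
  refine integral_congr_ae ?_
  filter_upwards [compl_mem_ae_iff.mpr (measure_singleton z)] with w hw
  rw [congrFun hA w, logBump_eq_log_max_sub hr (sub_ne_zero.mpr hw)]
  ring

/-! ### The mean value defect as approximate Riesz mass -/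

/-- Pairing antipodal points of the circle cancels the first-order term, and the gradient is
Lipschitz, so the symmetric second difference is quadratic in `r`. -/
theorem exists_circleAverage_sub_le_sq {ψ : ℂ → ℝ} (hψ : ContDiff ℝ 2 ψ)
    (hc : HasCompactSupport ψ) :
    ∃ C, ∀ w r, |ψ w - Real.circleAverage ψ w r| ≤ C * r ^ 2 := by
  have hψ' : ContDiff ℝ 1 (fderiv ℝ ψ) := hψ.fderiv_right (by norm_num)
  obtain ⟨C, hC⟩ := hψ'.lipschitzWith_of_hasCompactSupport (hc.fderiv (𝕜 := ℝ)) one_ne_zero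
  have hd : Differentiable ℝ ψ := hψ.differentiable (by norm_num)
  have key : ∀ w h : ℂ, |ψ (w + h) + ψ (w - h) - 2 * ψ w| ≤ 2 * C * ‖h‖ ^ 2 := by
    intro w h
    have hg : ∀ t ∈ Icc (0 : ℝ) 1, HasDerivWithinAt
        (fun t : ℝ => ψ (w + t • h) + ψ (w - t • h))
        ((fderiv ℝ ψ (w + t • h) - fderiv ℝ ψ (w - t • h)) h) (Icc 0 1) t := by
      intro t _
      have h1 : HasDerivAt (fun t : ℝ => w + t • h) h t := by
        simpa using ((hasDerivAt_id t).smul_const h).const_add w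
      have h2 : HasDerivAt (fun t : ℝ => w - t • h) (-h) t := by
        simpa using ((hasDerivAt_id t).smul_const h).const_sub w
      have h3 := (hd (w + t • h)).hasFDerivAt.comp_hasDerivAt t h1
      have h4 := (hd (w - t • h)).hasFDerivAt.comp_hasDerivAt t h2
      exact ((h3.add h4).hasDerivWithinAt (s := Icc 0 1)).congr_deriv (by simp [sub_eq_add_neg])
    have hb : ∀ t ∈ Icc (0 : ℝ) 1,
        ‖(fderiv ℝ ψ (w + t • h) - fderiv ℝ ψ (w - t • h)) h‖ ≤ 2 * C * ‖h‖ ^ 2 := by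
      intro t ht
      refine (ContinuousLinearMap.le_opNorm _ _).trans ?_
      have h5 := hC.dist_le_mul (w + t • h) (w - t • h)
      rw [dist_eq_norm, dist_eq_norm, show w + t • h - (w - t • h) = (2 * t) • h by
        rw [mul_smul, two_smul]; abel, norm_smul, Real.norm_of_nonneg (by linarith [ht.1])] at h5
      have h6 : (C : ℝ) * (2 * t * ‖h‖) ≤ C * (2 * ‖h‖) := by
        refine mul_le_mul_of_nonneg_left ?_ C.2
        nlinarith [norm_nonneg h, ht.2]
      calc _ ≤ C * (2 * ‖h‖) * ‖h‖ := mul_le_mul_of_nonneg_right (h5.trans h6) (norm_nonneg h)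
        _ = _ := by ring
    have := (convex_Icc (0 : ℝ) 1).norm_image_sub_le_of_norm_hasDerivWithin_le hg hb
      (left_mem_Icc.mpr zero_le_one) (right_mem_Icc.mpr zero_le_one)
    simp only [one_smul, zero_smul, add_zero, sub_zero, norm_one, mul_one, Real.norm_eq_abs] at this
    rwa [show ψ w + ψ w = 2 * ψ w by ring] at this
  refine ⟨C, fun w r => ?_⟩
  have hci : ∀ r, CircleIntegrable ψ w r := fun r => hψ.continuous.continuousOn.circleIntegrable'
  have e : 2 * (Real.circleAverage ψ w r - ψ w) = (2 * Real.pi)⁻¹ *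
      ∫ θ in (0 : ℝ)..2 * Real.pi, (ψ (w + circleMap 0 r θ) + ψ (w - circleMap 0 r θ) - 2 * ψ w) := by
    simp only [← circleMap_eq_add, ← circleMap_neg_radius_eq_sub]
    rw [intervalIntegral.integral_sub (IntervalIntegrable.add (hci r) (hci (-r)))
      intervalIntegrable_const,
      intervalIntegral.integral_add (hci r) (hci (-r)), intervalIntegral.integral_const]
    have h1 := Real.circleAverage_def (f := ψ) (c := w) (R := r)
    have h2 := Real.circleAverage_def (f := ψ) (c := w) (R := -r)
    rw [Real.circleAverage_neg_radius] at h2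
    simp only [smul_eq_mul] at h1 h2 ⊢
    rw [mul_sub (2 * Real.pi)⁻¹, mul_add, ← h1, ← h2]
    field_simp
    ring
  have hb : ‖∫ θ in (0 : ℝ)..2 * Real.pi,
      (ψ (w + circleMap 0 r θ) + ψ (w - circleMap 0 r θ) - 2 * ψ w)‖ ≤
      2 * C * r ^ 2 * |2 * Real.pi - 0| := by
    refine intervalIntegral.norm_integral_le_of_norm_le_const fun θ _ => ?_
    have := key w (circleMap 0 r θ)
    rwa [norm_circleMap_zero, sq_abs] at this
  rw [sub_zero, abs_of_pos (by positivity : 0 < 2 * Real.pi), Real.norm_eq_abs] at hb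
  have h3 : |2 * (Real.circleAverage ψ w r - ψ w)| ≤ 2 * C * r ^ 2 := by
    rw [e, abs_mul, abs_of_pos (by positivity : 0 < (2 * Real.pi)⁻¹), inv_mul_le_iff₀ (by positivity)]
    linarith
  rw [abs_mul, abs_two] at h3
  rw [abs_sub_comm]
  linarith

/-- The normalized defect of the mean value property of `U` on circles of radius `r`. -/
noncomputable def meanDefect (U : ℂ → ℝ) (r : ℝ) (w : ℂ) : ℝ :=
  ((∫ x, logBump 1 x) * r ^ 2)⁻¹ * (U w - Real.circleAverage U w r)

theorem continuous_meanDefect {U : ℂ → ℝ} (hU : Continuous U) (r : ℝ) :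
    Continuous (meanDefect U r) :=
  continuous_const.mul (hU.sub (continuous_circleAverage_comp hU continuous_const))

theorem meanDefect_eq_zero_of_le_norm {U : ℂ → ℝ} {R₀ : ℝ} (hR₀ : ∀ z, R₀ ≤ ‖z‖ → U z = 0)
    {r : ℝ} (hr : 0 ≤ r) {w : ℂ} (hw : R₀ + r ≤ ‖w‖) : meanDefect U r w = 0 := by
  rw [meanDefect, hR₀ w (by linarith), circleAverage_eq_zero_of_le_norm hR₀ hr hw]
  simp

/-- By symmetry the defect moves onto `ψ`, where its order `r ^ 2` cancels the normalization. This
gives the bound on masses needed for weak compactness. -/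
theorem exists_forall_integral_meanDefect_mul_le {U : ℂ → ℝ} (hU : Continuous U) {R₀ : ℝ}
    (hR₀ : ∀ z, R₀ ≤ ‖z‖ → U z = 0) {ψ : ℂ → ℝ} (hψ : ContDiff ℝ 2 ψ)
    (hc : HasCompactSupport ψ) :
    ∃ C, ∀ r > 0, |∫ w, meanDefect U r w * ψ w| ≤ C := by
  obtain ⟨C, hC⟩ := exists_circleAverage_sub_le_sq hψ hc
  have hκ := integral_logBump_one_pos
  have hcs : HasCompactSupport U := HasCompactSupport.intro (isCompact_closedBall (0 : ℂ) R₀)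
    fun z hz => hR₀ z (by simpa using (not_le.mp fun h => hz (by simpa using h)).le)
  have hUi : Integrable U := hU.integrable_of_hasCompactSupport hcs
  refine ⟨(∫ x, logBump 1 x)⁻¹ * ((∫ w, |U w|) * C), fun r hr => ?_⟩
  have hpos : 0 < (∫ x, logBump 1 x) * r ^ 2 := by positivity
  have h1 : ∫ w, meanDefect U r w * ψ w = ((∫ x, logBump 1 x) * r ^ 2)⁻¹ *
      ∫ w, U w * (ψ w - Real.circleAverage ψ w r) := by
    rw [← integral_sub_circleAverage_mul hU hR₀ hψ.continuous.measurable
      hψ.continuous.locallyIntegrable hr.le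
      (continuous_circleAverage_comp hψ.continuous continuous_const), ← integral_const_mul]
    simp only [meanDefect, mul_assoc]
  have h2 : ‖∫ w, U w * (ψ w - Real.circleAverage ψ w r)‖ ≤ ∫ w, |U w| * (C * r ^ 2) := by
    refine norm_integral_le_of_norm_le (hUi.abs.mul_const _) (Eventually.of_forall fun w => ?_)
    rw [norm_mul, Real.norm_eq_abs, Real.norm_eq_abs]
    exact mul_le_mul_of_nonneg_left (hC w r) (abs_nonneg _)
  rw [integral_mul_const, Real.norm_eq_abs] at h2
  rw [h1, abs_mul, abs_of_pos (inv_pos.mpr hpos), inv_mul_le_iff₀ hpos]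
  refine h2.trans (le_of_eq ?_)
  field_simp

/-- The symmetry of averaging, applied against the constant 1, which has no defect. -/
theorem integral_meanDefect {U : ℂ → ℝ} (hU : Continuous U) {R₀ : ℝ}
    (hR₀ : ∀ z, R₀ ≤ ‖z‖ → U z = 0) {r : ℝ} (hr : 0 < r) : ∫ w, meanDefect U r w = 0 := by
  have h := integral_sub_circleAverage_mul hU hR₀ (φ := fun _ => 1) measurable_const
    continuous_const.locallyIntegrable hr.le (by simp only [Real.circleAverage_const]; exact continuous_const)
  simp only [Real.circleAverage_const, sub_self, mul_zero, integral_zero, mul_one] at h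
  simp only [meanDefect]
  rw [integral_const_mul, h, mul_zero]

/-- The Riesz representation before passage to the limit: the integral is an average of `U` over a
disc shrinking to `z`. -/
theorem tendsto_integral_meanDefect_mul_neg_log {U : ℂ → ℝ} (hU : Continuous U) {R₀ : ℝ}
    (hR₀ : ∀ z, R₀ ≤ ‖z‖ → U z = 0) (z : ℂ) :
    Tendsto (fun r => ∫ w, meanDefect U r w * -Real.log ‖w - z‖) (𝓝[>] 0) (𝓝 (U z)) := by
  refine Metric.tendsto_nhdsWithin_nhds.mpr fun ε hε => ?_
  obtain ⟨δ, hδ, h⟩ := Metric.continuousAt_iff.mp hU.continuousAt (ε / 2) (half_pos hε)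
  refine ⟨δ, hδ, fun {r} hr hrδ => ?_⟩
  have hr0 : 0 < r := hr
  rw [Real.dist_eq, sub_zero, abs_of_pos hr0] at hrδ
  have e : ∫ w, meanDefect U r w * -Real.log ‖w - z‖ =
      ((∫ x, logBump 1 x) * r ^ 2)⁻¹ * ∫ w, U w * logBump r (w - z) := by
    rw [← integral_sub_circleAverage_mul_neg_log hU hR₀ hr0, ← integral_const_mul]
    simp only [meanDefect, mul_assoc]
  rw [e, Real.dist_eq]
  refine lt_of_le_of_lt (abs_average_logBump_sub_le hr0 (integrable_mul_logBump hU hR₀ hr0 z)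
    (ε := ε / 2) fun w hw => ?_) (half_lt_self hε)
  exact (h (by rw [dist_eq_norm]; exact hw.trans hrδ)).le

/-! ### Passage to the limit: representation by potentials -/

theorem exists_contDiff_bump {S T : Set ℂ} (hS : IsCompact S) (hT : IsClosed T)
    (hd : Disjoint S T) :
    ∃ ψ : ℂ → ℝ, ContDiff ℝ 2 ψ ∧ HasCompactSupport ψ ∧ (∀ z ∈ S, ψ z = 1) ∧ ∀ z ∈ T, ψ z = 0 := by
  obtain ⟨R, hR⟩ := hS.isBounded.subset_ball 0
  obtain ⟨f, hf0, hf1, -⟩ := exists_contMDiffMap_zero_one_of_isClosed (n := 2)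
    (modelWithCornersSelf ℝ ℂ) (s := T ∪ (Metric.ball 0 R)ᶜ) (t := S)
    (hT.union Metric.isOpen_ball.isClosed_compl) hS.isClosed
    (disjoint_union_left.mpr ⟨hd.symm, disjoint_left.mpr fun z hz hzS => hz (hR hzS)⟩)
  refine ⟨f, contMDiff_iff_contDiff.mp f.contMDiff, ?_, fun z hz => hf1 hz,
    fun z hz => hf0 (Or.inl hz)⟩
  exact HasCompactSupport.intro (isCompact_closedBall (0 : ℂ) R) fun z hz =>
    hf0 (Or.inr fun h => hz (Metric.ball_subset_closedBall h))

theorem exists_pairwise_disjoint_cthickening {ι : Type*} [Finite ι] {E : ι → Set ℂ}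
    (hE : ∀ k, IsCompact (E k)) (hd : Pairwise fun k l => Disjoint (E k) (E l)) :
    ∃ δ > 0, ∀ r ≤ δ,
      Pairwise fun k l => Disjoint (Metric.cthickening r (E k)) (Metric.cthickening r (E l)) := by
  classical
  have h : ∀ k l, ∃ δ > 0, k ≠ l →
      Disjoint (Metric.cthickening δ (E k)) (Metric.cthickening δ (E l)) := by
    intro k l
    by_cases hkl : k = l
    · exact ⟨1, one_pos, fun h => absurd hkl h⟩
    · obtain ⟨δ, hδ, h⟩ := (hd hkl).exists_cthickenings (hE k) (hE l).isClosed
      exact ⟨δ, hδ, fun _ => h⟩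
  choose δ hδ h using h
  rcases isEmpty_or_nonempty ι with he | he
  · exact ⟨1, one_pos, fun r _ k => he.elim k⟩
  obtain ⟨p, hp⟩ := Finite.exists_min fun p : ι × ι => δ p.1 p.2
  refine ⟨δ p.1 p.2, hδ _ _, fun r hr k l hkl => ?_⟩
  have := hp (k, l)
  exact (h k l hkl).mono (Metric.cthickening_mono (hr.trans this) _)
    (Metric.cthickening_mono (hr.trans this) _)

/-- Weak compactness of measures of bounded mass on a compact set. A free ultrafilter takes the
place of a subsequence, so several sequences converge simultaneously. -/
theorem exists_tendsto_ultrafilter_finiteMeasure {S : Set ℂ} (hS : IsCompact S)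
    {m : ℕ → FiniteMeasure ℂ} {C : NNReal} (hm : ∀ i, (m i).mass ≤ C) (hz : ∀ i, m i Sᶜ = 0) :
    ∃ μ : FiniteMeasure ℂ, μ Sᶜ = 0 ∧ Tendsto m (hyperfilter ℕ) (𝓝 μ) := by
  have h := isCompact_iff_ultrafilter_le_nhds'.mp
    (isCompact_setOfPred_finiteMeasure_le_of_isCompact C hS) ((hyperfilter ℕ).map m)
    (Ultrafilter.mem_map.mpr (univ_mem' fun i => ⟨hm i, hz i⟩))
  obtain ⟨μ, hμ, hle⟩ := h
  exact ⟨μ, hμ.2, hle⟩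

theorem hyperfilter_le_atTop : (hyperfilter ℕ : Filter ℕ) ≤ atTop := by
  rw [← Nat.cofinite_eq_atTop]
  exact hyperfilter_le_cofinite

/-- A continuous compactly supported function that has the mean value property off finitely many
disjoint compact sets, and is super- or submean near each of them, is the corresponding signed sum
of logarithmic potentials of measures on these sets. -/
theorem exists_potential_representation {ι : Type*} [Fintype ι] {E : ι → Set ℂ}
    (hE : ∀ k, IsCompact (E k)) (hne : ∀ k, (E k).Nonempty)
    (hd : Pairwise fun k l => Disjoint (E k) (E l)) {σ : ι → ℝ} (hσ : ∀ k, σ k * σ k = 1)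
    {U : ℂ → ℝ} (hU : Continuous U) {R₀ : ℝ} (hR₀ : ∀ z, R₀ ≤ ‖z‖ → U z = 0)
    (hmv : ∀ w r, 0 ≤ r → (∀ k, Disjoint (Metric.closedBall w r) (E k)) →
      Real.circleAverage U w r = U w)
    {r₀ : ℝ} (hr₀ : 0 < r₀) (hsgn : ∀ k, ∀ w ∈ Metric.cthickening r₀ (E k), ∀ r, 0 < r → r < r₀ →
      0 ≤ σ k * (U w - Real.circleAverage U w r)) :
    ∃ μ : ι → Measure ℂ, (∀ k, IsFiniteMeasure (μ k)) ∧ (∀ k, μ k (E k)ᶜ = 0) ∧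
      (∀ z, (∀ k, z ∉ E k) → U z = ∑ k, σ k * logPotential (μ k) z) ∧
      ∑ k, σ k * (μ k).real univ = 0 := by
  classical
  obtain ⟨δ, hδ, hdis⟩ := exists_pairwise_disjoint_cthickening hE hd
  set ρ : ℝ := min δ r₀ with hρ
  have hρ0 : 0 < ρ := lt_min hδ hr₀
  set N : ι → Set ℂ := fun k => Metric.cthickening ρ (E k) with hN
  have hNc : ∀ k, IsCompact (N k) := fun k => (hE k).cthickening
  have hNd : Pairwise fun k l => Disjoint (N k) (N l) := hdis ρ (min_le_left _ _)
  have hκ := integral_logBump_one_pos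
  have hmemN : ∀ k w, w ∈ N k ↔ Metric.infDist w (E k) ≤ ρ := by
    intro k w
    rw [hN, Metric.mem_cthickening_iff, Metric.infDist, ENNReal.le_ofReal_iff_toReal_le
      (Metric.infEDist_ne_top (hne k)) hρ0.le]
  -- vanishing of the defect away from the sets
  have hvan : ∀ r, 0 ≤ r → ∀ w, (∀ k, r < Metric.infDist w (E k)) → meanDefect U r w = 0 := by
    intro r hr w hw
    rw [meanDefect, hmv w r hr, sub_self, mul_zero]
    intro k
    rw [disjoint_left]
    intro z hz hzE
    have := Metric.infDist_le_dist_of_mem (x := w) hzE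
    rw [dist_comm] at this
    exact absurd (this.trans hz) (not_le.mpr (hw k))
  have hvanN : ∀ r, 0 ≤ r → r ≤ ρ → ∀ k, ∀ w ∈ N k, r < Metric.infDist w (E k) →
      meanDefect U r w = 0 := by
    intro r hr hrρ k w hw hlt
    refine hvan r hr w fun l => ?_
    by_cases hkl : k = l
    · rwa [← hkl]
    · by_contra! h
      exact disjoint_left.mp (hNd hkl) hw ((hmemN l w).mpr (h.trans hrρ))
  -- integrals against the defect split
  have hsplit : ∀ r, 0 < r → r < ρ → ∀ φ : ℂ → ℝ, LocallyIntegrable φ →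
      ∑ k, ∫ w in N k, meanDefect U r w * φ w = ∫ w, meanDefect U r w * φ w := by
    intro r hr hrρ φ hφ
    have hi : Integrable fun w => meanDefect U r w * φ w :=
      integrable_continuous_mul (R₀ := R₀ + r) (continuous_meanDefect hU r)
        (fun z hz => meanDefect_eq_zero_of_le_norm hR₀ hr.le hz) hφ
    rw [← integral_iUnion_fintype (fun k => (hNc k).measurableSet) hNd fun k => hi.integrableOn]
    refine setIntegral_eq_integral_of_forall_compl_eq_zero fun w hw => ?_
    rw [hvan r hr.le w fun k => ?_, zero_mul]
    by_contra! h
    exact hw (mem_iUnion.mpr ⟨k, (hmemN k w).mpr (h.trans hrρ.le)⟩)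
  -- the approximating measures
  set r : ℕ → ℝ := fun i => ρ / (i + 2) with hr
  have hr0 : ∀ i, 0 < r i := fun i => by positivity
  have hrρ : ∀ i, r i < ρ := fun i => by
    rw [hr, div_lt_iff₀ (by positivity)]
    nlinarith [(Nat.cast_nonneg i : (0 : ℝ) ≤ i)]
  have hrt : Tendsto r atTop (𝓝[>] 0) := by
    refine tendsto_nhdsWithin_iff.mpr ⟨?_, Eventually.of_forall hr0⟩
    exact tendsto_const_nhds.div_atTop
      (tendsto_atTop_add_const_right _ _ tendsto_natCast_atTop_atTop)
  have hnn : ∀ k i, ∀ w ∈ N k, 0 ≤ σ k * meanDefect U (r i) w := by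
    intro k i w hw
    have h1 := hsgn k w (Metric.cthickening_mono (min_le_right _ _) _ hw) (r i) (hr0 i)
      ((hrρ i).trans_le (min_le_right _ _))
    have h2 : 0 < ((∫ x, logBump 1 x) * r i ^ 2)⁻¹ := by have := hr0 i; positivity
    have h3 : σ k * meanDefect U (r i) w = ((∫ x, logBump 1 x) * r i ^ 2)⁻¹ *
        (σ k * (U w - Real.circleAverage U w (r i))) := by rw [meanDefect]; ring
    rw [h3]
    exact mul_nonneg h2.le h1
  have hdi : ∀ k i, IntegrableOn (fun w => σ k * meanDefect U (r i) w) (N k) := fun k i =>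
    (continuous_const.mul (continuous_meanDefect hU _)).continuousOn.integrableOn_compact (hNc k)
  set m : ι → ℕ → Measure ℂ := fun k i => (volume.restrict (N k)).withDensity
    fun w => ENNReal.ofReal (σ k * meanDefect U (r i) w) with hm
  have hdm : ∀ k i, Measurable fun w => ENNReal.ofReal (σ k * meanDefect U (r i) w) := fun k i =>
    (continuous_const.mul (continuous_meanDefect hU _)).measurable.ennreal_ofReal
  have hmfin : ∀ k i, IsFiniteMeasure (m k i) := fun k i =>
    isFiniteMeasure_withDensity_ofReal (hdi k i).2
  have hmint : ∀ k i, ∀ φ : ℂ → ℝ,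
      ∫ w, φ w ∂(m k i) = σ k * ∫ w in N k, meanDefect U (r i) w * φ w := by
    intro k i φ
    rw [hm]
    simp only
    rw [integral_withDensity_eq_integral_toReal_smul (hdm k i)
      (Eventually.of_forall fun _ => ENNReal.ofReal_lt_top), ← integral_const_mul]
    refine setIntegral_congr_fun (hNc k).measurableSet fun w hw => ?_
    simp only [smul_eq_mul]
    rw [ENNReal.toReal_ofReal (hnn k i w hw), mul_assoc]
  have hmac : ∀ k i, ∀ s : Set ℂ, volume.restrict (N k) s = 0 → m k i s = 0 := fun k i s hs =>
    withDensity_absolutelyContinuous _ _ hs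
  have hmN : ∀ k i, m k i (N k)ᶜ = 0 := fun k i => hmac k i _ (by
    rw [Measure.restrict_apply (hNc k).measurableSet.compl]; simp)
  have hmnear : ∀ k i, ∀ᵐ w ∂(m k i), Metric.infDist w (E k) ≤ r i := by
    intro k i
    rw [hm]
    simp only
    rw [ae_withDensity_iff (hdm k i)]
    filter_upwards [ae_restrict_mem (hNc k).measurableSet] with w hw hw'
    by_contra! h
    rw [hvanN (r i) (hr0 i).le (hrρ i).le k w hw h, mul_zero, ENNReal.ofReal_zero] at hw'
    exact hw' rfl
  have hmass : ∀ k, ∃ C : NNReal, ∀ i, m k i univ ≤ C := by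
    intro k
    -- A cut-off that is 1 on `N k` and 0 on the other neighbourhoods turns the mass of `m k i` into
    -- an integral of the defect over the plane, which is bounded uniformly in the radius.
    obtain ⟨ψ, hψ, hψc, hψ1, hψ0⟩ := exists_contDiff_bump (hNc k)
      (T := ⋃ l ∈ {l | l ≠ k}, N l) ((toFinite _).isClosed_biUnion fun l _ => (hNc l).isClosed)
      (by
        simp only [disjoint_iUnion_right]
        exact fun l hl => hNd (Ne.symm hl))
    obtain ⟨C, hC⟩ := exists_forall_integral_meanDefect_mul_le hU hR₀ hψ hψc
    refine ⟨C.toNNReal, fun i => ?_⟩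
    have h1 : (m k i).real univ = σ k * ∫ w, meanDefect U (r i) w * ψ w := by
      rw [← hsplit (r i) (hr0 i) (hrρ i) ψ hψ.continuous.locallyIntegrable,
        Finset.sum_eq_single_of_mem k (Finset.mem_univ k)]
      · rw [← hmint, ← integral_congr_ae (f := fun _ => (1 : ℝ))]
        · simp
        · filter_upwards [compl_mem_ae_iff.mpr (hmN k i)] with w hw
          rw [compl_compl] at hw
          exact (hψ1 w hw).symm
      · intro l _ hl
        rw [← integral_zero ℂ ℝ (μ := volume.restrict (N l))]
        refine setIntegral_congr_fun (hNc l).measurableSet fun w hw => ?_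
        simp only [hψ0 w (mem_biUnion (show l ∈ {l | l ≠ k} from hl) hw), mul_zero]
    have h2 : |σ k| = 1 := by
      have := hσ k
      rw [← abs_mul_abs_self] at this
      nlinarith [abs_nonneg (σ k)]
    have h3 : (m k i).real univ ≤ C := by
      rw [h1]
      refine (le_abs_self _).trans ?_
      rw [abs_mul, h2, one_mul]
      exact hC (r i) (hr0 i)
    have := hmfin k i
    rw [Measure.real, ← ENNReal.le_ofReal_iff_toReal_le (measure_ne_top _ _)
      (measureReal_nonneg.trans h3)] at h3
    exact h3
  choose C hC using hmass
  let M : ι → ℕ → FiniteMeasure ℂ := fun k i => ⟨m k i, hmfin k i⟩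
  have hlim : ∀ k, ∃ μ : FiniteMeasure ℂ, μ (N k)ᶜ = 0 ∧
      Tendsto (M k) (hyperfilter ℕ) (𝓝 μ) := by
    intro k
    refine exists_tendsto_ultrafilter_finiteMeasure (hNc k) (C := C k) (fun i => ?_) fun i => ?_
    · rw [← ENNReal.coe_le_coe, FiniteMeasure.ennreal_mass]
      exact hC k i
    · rw [← ENNReal.coe_eq_zero, FiniteMeasure.ennreal_coeFn_eq_coeFn_toMeasure]
      exact hmN k i
  choose μ hμN hμ using hlim
  have hconv : ∀ k, ∀ φ : BoundedContinuousFunction ℂ ℝ,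
      Tendsto (fun i => ∫ w, φ w ∂(m k i)) (hyperfilter ℕ) (𝓝 (∫ w, φ w ∂(μ k : Measure ℂ))) :=
    fun k φ => FiniteMeasure.tendsto_iff_forall_integral_tendsto.mp (hμ k) φ
  have hrh : Tendsto r (hyperfilter ℕ) (𝓝[>] 0) := hrt.mono_left hyperfilter_le_atTop
  -- the limits are carried by the sets
  have hμE : ∀ k, (μ k : Measure ℂ) (E k)ᶜ = 0 := by
    intro k
    -- Truncated distance to `E k` as a test function: `m k i` lives within `r i` of `E k`, so its
    -- integrals are at most `r i` times the mass bound and vanish in the limit.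
    set φ : BoundedContinuousFunction ℂ ℝ := BoundedContinuousFunction.ofNormedAddCommGroup
      (fun w => min 1 (Metric.infDist w (E k)))
      (continuous_const.min (Metric.continuous_infDist_pt _)) 1 (fun w => by
        rw [Real.norm_of_nonneg (le_min zero_le_one Metric.infDist_nonneg)]
        exact min_le_left _ _) with hφ
    have hφa : ∀ w, φ w = min 1 (Metric.infDist w (E k)) := fun w => rfl
    have hφ0 : ∀ w, 0 ≤ φ w := fun w => le_min zero_le_one Metric.infDist_nonneg
    have h1 : Tendsto (fun i => ∫ w, φ w ∂(m k i)) (hyperfilter ℕ) (𝓝 0) := by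
      have h2 : Tendsto (fun i => r i * (C k : ℝ)) (hyperfilter ℕ) (𝓝 0) := by
        simpa using (hrh.mono_right nhdsWithin_le_nhds).mul_const (C k : ℝ)
      refine squeeze_zero (fun i => integral_nonneg hφ0) (fun i => ?_) h2
      have := hmfin k i
      have h3 : ∫ w, φ w ∂(m k i) ≤ ∫ _w, r i ∂(m k i) := by
        refine integral_mono_ae (φ.integrable _) (integrable_const _) ?_
        filter_upwards [hmnear k i] with w hw
        exact (min_le_right _ _).trans hw
      refine h3.trans ?_
      rw [integral_const, smul_eq_mul, mul_comm]
      refine mul_le_mul_of_nonneg_left ?_ (hr0 i).le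
      exact ENNReal.toReal_mono ENNReal.coe_ne_top (hC k i)
    have h2 := tendsto_nhds_unique (hconv k φ) h1
    rw [integral_eq_zero_iff_of_nonneg hφ0 (φ.integrable _)] at h2
    refine measure_mono_null (fun w hw => ?_) h2
    intro h
    have h3 : min 1 (Metric.infDist w (E k)) = 0 := h
    have h4 : 0 < Metric.infDist w (E k) :=
      ((hE k).isClosed.notMem_iff_infDist_pos (hne k)).mp hw
    exact absurd h3 (lt_min one_pos h4).ne'
  refine ⟨fun k => μ k, fun k => inferInstance, hμE, fun z hz => ?_, ?_⟩
  · -- the potential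
    have hEu : IsCompact (⋃ k, E k) := isCompact_iUnion hE
    obtain ⟨M, η, hη, hM⟩ := exists_abs_log_norm_sub_le (isCompact_singleton (x := z)) hEu
      (disjoint_singleton_left.mpr (by simpa using hz))
    obtain ⟨B, hB⟩ := (hEu.isBounded.union (isCompact_singleton (x := z)).isBounded).exists_norm_le
    have hlow : ∀ k w, Metric.infDist w (E k) < η / 2 → η / 2 ≤ ‖w - z‖ := by
      intro k w hw
      obtain ⟨y, hy, hwy⟩ := (Metric.infDist_lt_iff (hne k)).mp hw
      have h1 := (hM z rfl y (mem_iUnion.mpr ⟨k, hy⟩) z (by simp [hη.le])).2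
      rw [dist_eq_norm] at hwy
      have h2 : ‖z - y‖ ≤ ‖w - z‖ + ‖w - y‖ := by
        rw [norm_sub_rev w z]; simpa using norm_add_le (z - w) (w - y)
      linarith
    have hupp : ∀ k w, Metric.infDist w (E k) < η / 2 → ‖w - z‖ ≤ 2 * B + η := by
      intro k w hw
      obtain ⟨y, hy, hwy⟩ := (Metric.infDist_lt_iff (hne k)).mp hw
      have h1 := hB y (Or.inl (mem_iUnion.mpr ⟨k, hy⟩))
      have h2 := hB z (Or.inr rfl)
      rw [dist_eq_norm] at hwy
      have h3 : ‖w - z‖ ≤ ‖w - y‖ + (‖y‖ + ‖z‖) := by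
        have := (norm_add_le (w - y) (y - z)).trans (add_le_add_right (norm_sub_le y z) _)
        simpa using this
      linarith
    -- The kernel is clipped to a bounded continuous function, as weak convergence requires. Both
    -- clipping levels are inactive within `η / 2` of the sets `E k`.
    set g : ℂ → ℝ := fun w => -Real.log (min (2 * B + η) (max (η / 2) ‖w - z‖)) with hg
    have hB0 : 0 ≤ B := (norm_nonneg z).trans (hB z (Or.inr rfl))
    have hgc : Continuous g := by
      refine (Continuous.log (by fun_prop) fun w => ?_).neg
      exact (lt_min (by linarith) ((half_pos hη).trans_le (le_max_left _ _))).ne'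
    have hgeq : ∀ k w, Metric.infDist w (E k) < η / 2 → g w = -Real.log ‖w - z‖ := by
      intro k w hw
      simp only [hg]
      rw [max_eq_right (hlow k w hw), min_eq_right (hupp k w hw)]
    set φ : BoundedContinuousFunction ℂ ℝ := BoundedContinuousFunction.ofNormedAddCommGroup g hgc
      (|Real.log (η / 2)| + |Real.log (2 * B + η)|) (fun w => by
        rw [Real.norm_eq_abs, hg, abs_neg]
        exact abs_log_le_of_mem_Icc (half_pos hη) (le_min (by linarith) (le_max_left _ _))
          (min_le_left _ _)) with hφ
    have hφa : ∀ w, φ w = g w := fun w => rfl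
    have hpot : ∀ k, ∫ w, φ w ∂(μ k : Measure ℂ) = logPotential (μ k) z := by
      intro k
      rw [logPotential_eq_neg, ← integral_neg]
      refine integral_congr_ae ?_
      filter_upwards [compl_mem_ae_iff.mpr (hμE k)] with w hw
      rw [compl_compl] at hw
      rw [hφa, hgeq k w (by rw [Metric.infDist_zero_of_mem hw]; exact half_pos hη), norm_sub_rev]
    -- Once `r i < η / 2`, the defect lives where the clipped and the true kernel coincide.
    have hev : ∀ᶠ i in (hyperfilter ℕ : Filter ℕ), ∑ k, σ k * ∫ w, φ w ∂(m k i) =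
        ∫ w, meanDefect U (r i) w * -Real.log ‖w - z‖ := by
      have := (hrh.mono_right nhdsWithin_le_nhds).eventually (gt_mem_nhds (half_pos hη))
      filter_upwards [this] with i hi
      have hi' : r i < η / 2 := hi
      rw [← hsplit (r i) (hr0 i) (hrρ i) (fun w => -Real.log ‖w - z‖)
        (locallyIntegrable_log_norm_sub z).neg]
      refine Finset.sum_congr rfl fun k _ => ?_
      rw [hmint, ← mul_assoc, hσ, one_mul]
      refine setIntegral_congr_fun (hNc k).measurableSet fun w hw => ?_
      rcases lt_or_ge (Metric.infDist w (E k)) (η / 2) with h | h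
      · simp only [hφa, hgeq k w h]
      · simp only [hvanN (r i) (hr0 i).le (hrρ i).le k w hw (hi'.trans_le h), zero_mul]
    have h1 : Tendsto (fun i => ∑ k, σ k * ∫ w, φ w ∂(m k i)) (hyperfilter ℕ)
        (𝓝 (∑ k, σ k * logPotential (μ k) z)) := by
      refine tendsto_finsetSum _ fun k _ => ?_
      rw [← hpot]
      exact (hconv k φ).const_mul _
    exact tendsto_nhds_unique
      (((tendsto_integral_meanDefect_mul_neg_log hU hR₀ z).comp hrh).congr' (by
        filter_upwards [hev] with i hi using hi.symm)) h1
  · have h1 : ∀ i, ∑ k, σ k * (m k i).real univ = 0 := by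
      intro i
      rw [← integral_meanDefect hU hR₀ (hr0 i)]
      have := hsplit (r i) (hr0 i) (hrρ i) (fun _ => 1) continuous_const.locallyIntegrable
      simp only [mul_one] at this
      rw [← this]
      refine Finset.sum_congr rfl fun k _ => ?_
      have h2 := hmint k i fun _ => 1
      simp only [integral_const, smul_eq_mul, mul_one] at h2
      rw [h2, ← mul_assoc, hσ, one_mul]
    have h2 : Tendsto (fun i => ∑ k, σ k * (m k i).real univ) (hyperfilter ℕ)
        (𝓝 (∑ k, σ k * (μ k : Measure ℂ).real univ)) := by
      refine tendsto_finsetSum _ fun k _ => Tendsto.const_mul _ ?_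
      simpa using hconv k (BoundedContinuousFunction.const ℂ 1)
    simp only [h1] at h2
    exact tendsto_nhds_unique h2 tendsto_const_nhds

/-! ### Plane topology of the boundary components -/

/-- Polar coordinates exhibit the set as an image of `I ×ˢ univ`. The cases needed are punctured
discs and exteriors of discs. -/
theorem isPreconnected_norm_sub_mem (c : ℂ) {I : Set ℝ} (hI : OrdConnected I) (h0 : I ⊆ Ici 0) :
    IsPreconnected {z : ℂ | ‖z - c‖ ∈ I} := by
  have h : {z : ℂ | ‖z - c‖ ∈ I} = (fun p : ℝ × ℝ => circleMap c p.1 p.2) '' (I ×ˢ univ) := by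
    ext z
    constructor
    · intro hz
      refine ⟨(‖z - c‖, Complex.arg (z - c)), ⟨hz, mem_univ _⟩, ?_⟩
      simp only [circleMap]
      rw [Complex.norm_mul_exp_arg_mul_I]
      ring
    · rintro ⟨⟨s, θ⟩, ⟨hs, -⟩, rfl⟩
      simp only [mem_ofPred_eq, circleMap_sub_center, norm_circleMap_zero]
      rwa [abs_of_nonneg (h0 hs)]
  rw [h]
  refine (hI.isPreconnected.prod isPreconnected_univ).image _ (Continuous.continuousOn ?_)
  simp only [circleMap]
  fun_prop

theorem isClosed_connectedComponentIn {S : Set ℂ} (hS : IsClosed S) (x : ℂ) :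
    IsClosed (connectedComponentIn S x) := by
  by_cases hx : x ∈ S
  · refine isClosed_of_closure_subset ?_
    exact isPreconnected_connectedComponentIn.closure.subset_connectedComponentIn
      (subset_closure (mem_connectedComponentIn hx))
      (hS.closure_subset_iff.mpr (connectedComponentIn_subset S x))
  · rw [connectedComponentIn_eq_empty hx]
    exact isClosed_empty

theorem eq_of_mem_componentsOf {S C D : Set ℂ} (hC : C ∈ componentsOf S) (hD : D ∈ componentsOf S)
    {x : ℂ} (hxC : x ∈ C) (hxD : x ∈ D) : C = D := by
  obtain ⟨a, -, rfl⟩ := hC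
  obtain ⟨b, -, rfl⟩ := hD
  rw [connectedComponentIn_eq hxC, connectedComponentIn_eq hxD]

theorem subset_of_mem_componentsOf {S C : Set ℂ} (hC : C ∈ componentsOf S) : C ⊆ S := by
  obtain ⟨a, -, rfl⟩ := hC
  exact connectedComponentIn_subset S a

theorem isClosed_of_mem_componentsOf {S C : Set ℂ} (hS : IsClosed S) (hC : C ∈ componentsOf S) :
    IsClosed C := by
  obtain ⟨a, -, rfl⟩ := hC
  exact isClosed_connectedComponentIn hS a

theorem isPreconnected_of_mem_componentsOf {S C : Set ℂ} (hC : C ∈ componentsOf S) :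
    IsPreconnected C := by
  obtain ⟨a, -, rfl⟩ := hC
  exact isPreconnected_connectedComponentIn

theorem subset_of_mem_componentsOf_of_inter {S C T : Set ℂ} (hC : C ∈ componentsOf S)
    (hT : IsPreconnected T) (hTS : T ⊆ S) (h : (T ∩ C).Nonempty) : T ⊆ C := by
  obtain ⟨a, -, rfl⟩ := hC
  obtain ⟨x, hxT, hxC⟩ := h
  rw [connectedComponentIn_eq hxC]
  exact hT.subset_connectedComponentIn hxT hTS

/-- The distance to `ζ` takes every value between 0 and its value at a second point of `S`. -/
theorem meetsSmallCircles_of_isPreconnected {S : Set ℂ} (hS : IsPreconnected S)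
    (hn : S.Nontrivial) {ζ : ℂ} (hζ : ζ ∈ S) : MeetsSmallCircles S ζ := by
  obtain ⟨y, hy, hne⟩ := hn.exists_ne ζ
  refine ⟨‖y - ζ‖, norm_pos_iff.mpr (sub_ne_zero.mpr hne), fun s hs => ?_⟩
  have := hS.intermediate_value hζ hy (f := fun z => ‖z - ζ‖) (by fun_prop)
  obtain ⟨z, hz, h⟩ := this (show s ∈ Icc ‖ζ - ζ‖ ‖y - ζ‖ by simpa using hs)
  exact ⟨z, hz, h⟩

theorem MeetsSmallCircles.mono {S T : Set ℂ} {ζ : ℂ} (h : MeetsSmallCircles S ζ) (hST : S ⊆ T) :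
    MeetsSmallCircles T ζ := by
  obtain ⟨R, hR, h⟩ := h
  exact ⟨R, hR, fun s hs => (h s hs).imp fun z hz => ⟨hST hz.1, hz.2⟩⟩

theorem IsPreconnected.inter_frontier_nonempty {S T : Set ℂ} (hS : IsPreconnected S)
    (h1 : (S ∩ T).Nonempty) (h2 : (S \ T).Nonempty) : (S ∩ frontier T).Nonempty := by
  by_contra h
  rw [not_nonempty_iff_eq_empty] at h
  obtain ⟨x, hxS, hxT⟩ := h1
  obtain ⟨y, hyS, hyT⟩ := h2
  have hsub : S ⊆ interior T ∪ (closure T)ᶜ := fun z hz => by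
    by_contra hcon
    simp only [mem_union, mem_compl_iff, not_or, not_not] at hcon
    exact (h ▸ (⟨hz, hcon.2, hcon.1⟩ : z ∈ S ∩ frontier T) : z ∈ (∅ : Set ℂ))
  have hx : x ∈ interior T := (hsub hxS).resolve_right fun h => h (subset_closure hxT)
  have hy : y ∈ (closure T)ᶜ := (hsub hyS).resolve_left fun h => hyT (interior_subset h)
  obtain ⟨z, -, hz1, hz2⟩ := hS _ _ isOpen_interior isClosed_closure.isOpen_compl hsub
    ⟨x, hxS, hx⟩ ⟨y, hyS, hy⟩
  exact hz2 (subset_closure (interior_subset hz1))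

/-- The complement of a finitely connected domain without its non-degenerate components. -/
def degeneratePoints (Ω : Set ℂ) {n : ℕ} (K : Fin (n + 1) → Set ℂ) : Set ℂ :=
  Ωᶜ \ ⋃ k, K k

namespace IsBoundaryLabelling

variable {Ω : Set ℂ} {n : ℕ} {Γ K : Fin (n + 1) → Set ℂ}

theorem isClosed_fill (h : IsBoundaryLabelling Ω Γ K) (hΩ : IsOpen Ω) (k : Fin (n + 1)) :
    IsClosed (K k) :=
  isClosed_of_mem_componentsOf hΩ.isClosed_compl (h.component k)

theorem isPreconnected_fill (h : IsBoundaryLabelling Ω Γ K) (k : Fin (n + 1)) :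
    IsPreconnected (K k) :=
  isPreconnected_of_mem_componentsOf (h.component k)

theorem fill_subset_compl (h : IsBoundaryLabelling Ω Γ K) (k : Fin (n + 1)) : K k ⊆ Ωᶜ :=
  subset_of_mem_componentsOf (h.component k)

theorem disjoint_fill (h : IsBoundaryLabelling Ω Γ K) : Pairwise fun k l => Disjoint (K k) (K l) :=
  fun k l hkl => disjoint_left.mpr fun x hx hy => hkl <| h.injective <| by
    rw [← h.frontier_eq, ← h.frontier_eq,
      eq_of_mem_componentsOf (h.component k) (h.component l) hx hy]

theorem boundary_mem (h : IsBoundaryLabelling Ω Γ K) (k : Fin (n + 1)) :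
    Γ k ∈ componentsOf (frontier Ω) ∧ (Γ k).Nontrivial := by
  have : Γ k ∈ range Γ := mem_range_self k
  rwa [h.range_eq] at this

theorem boundary_subset_fill (h : IsBoundaryLabelling Ω Γ K) (hΩ : IsOpen Ω) (k : Fin (n + 1)) :
    Γ k ⊆ K k :=
  h.frontier_eq k ▸ (h.isClosed_fill hΩ k).frontier_subset

theorem boundary_subset_frontier (h : IsBoundaryLabelling Ω Γ K) (k : Fin (n + 1)) :
    Γ k ⊆ frontier Ω :=
  subset_of_mem_componentsOf (h.boundary_mem k).1

theorem isClosed_boundary (h : IsBoundaryLabelling Ω Γ K) (k : Fin (n + 1)) : IsClosed (Γ k) :=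
  isClosed_of_mem_componentsOf isClosed_frontier (h.boundary_mem k).1

theorem isCompact_boundary (h : IsBoundaryLabelling Ω Γ K) (hΩ : Bornology.IsBounded Ω)
    (k : Fin (n + 1)) : IsCompact (Γ k) :=
  Metric.isCompact_of_isClosed_isBounded (h.isClosed_boundary k)
    (hΩ.closure.subset ((h.boundary_subset_frontier k).trans frontier_subset_closure))

theorem disjoint_boundary (h : IsBoundaryLabelling Ω Γ K) (hΩ : IsOpen Ω) :
    Pairwise fun k l => Disjoint (Γ k) (Γ l) := fun _ _ hkl =>
  (h.disjoint_fill hkl).mono (h.boundary_subset_fill hΩ _) (h.boundary_subset_fill hΩ _)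

theorem frontier_inter_fill (h : IsBoundaryLabelling Ω Γ K) (k : Fin (n + 1)) :
    frontier Ω ∩ K k = Γ k ∩ K k := by
  ext x
  refine ⟨fun hx => ⟨?_, hx.2⟩, fun hx => ⟨h.boundary_subset_frontier k hx.1, hx.2⟩⟩
  rw [← h.frontier_eq k]
  refine ⟨subset_closure hx.2, fun hxi => ?_⟩
  have h1 : x ∈ closure Ω := hx.1.1
  obtain ⟨y, hy, hyΩ⟩ := mem_closure_iff.mp h1 _ isOpen_interior hxi
  exact h.fill_subset_compl k (interior_subset hy) hyΩ

theorem nontrivial_fill (h : IsBoundaryLabelling Ω Γ K) (hΩ : IsOpen Ω) (k : Fin (n + 1)) :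
    (K k).Nontrivial :=
  (h.boundary_mem k).2.mono (h.boundary_subset_fill hΩ k)

theorem meetsSmallCircles_fill (h : IsBoundaryLabelling Ω Γ K) (hΩ : IsOpen Ω) {k : Fin (n + 1)}
    {ζ : ℂ} (hζ : ζ ∈ K k) : MeetsSmallCircles (K k) ζ :=
  meetsSmallCircles_of_isPreconnected (h.isPreconnected_fill k) (h.nontrivial_fill hΩ k) hζ

/-- A point of the complement that lies in no non-degenerate component is isolated. -/
theorem exists_ball_of_mem_degeneratePoints (h : IsBoundaryLabelling Ω Γ K)
    (hΩ : IsBoundedFinitelyConnectedDomain Ω) {p : ℂ} (hp : p ∈ degeneratePoints Ω K) :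
    connectedComponentIn (frontier Ω) p = {p} ∧ p ∈ frontier Ω ∧
      ∃ r > 0, Metric.ball p r \ {p} ⊆ Ω := by
  obtain ⟨hpΩ, hpK⟩ := hp
  set C := connectedComponentIn Ωᶜ p with hCdef
  have hC : C ∈ componentsOf Ωᶜ := ⟨p, hpΩ, rfl⟩
  have hpC : p ∈ C := mem_connectedComponentIn hpΩ
  have hCc : IsClosed C := isClosed_of_mem_componentsOf hΩ.isOpen.isClosed_compl hC
  have hCsub := subset_of_mem_componentsOf hC
  obtain ⟨q, hq⟩ := hΩ.isConnected.nonempty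
  -- A frontier point `x` of the component `C` lies on `∂Ω`: otherwise a ball about `x` would lie in
  -- the complement of `Ω`, hence in `C`. The aim is to show `C = {x}`, so that `x = p`.
  obtain ⟨x, hx⟩ : (frontier C).Nonempty :=
    nonempty_frontier_iff.mpr ⟨⟨p, hpC⟩, fun h => hCsub (h ▸ mem_univ q) hq⟩
  have hxC : x ∈ C := hCc.frontier_subset hx
  have hxΩ : x ∉ Ω := hCsub hxC
  have hxf : x ∈ frontier Ω := by
    rw [hΩ.isOpen.frontier_eq]
    refine ⟨?_, hxΩ⟩
    by_contra hcl
    obtain ⟨r, hr, hb⟩ := Metric.isOpen_iff.mp isClosed_closure.isOpen_compl x hcl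
    have : Metric.ball x r ⊆ C := subset_of_mem_componentsOf_of_inter hC Metric.isPreconnected_ball
      (hb.trans (compl_subset_compl.mpr subset_closure)) ⟨x, Metric.mem_ball_self hr, hxC⟩
    exact hx.2 (mem_interior.mpr ⟨_, this, Metric.isOpen_ball, Metric.mem_ball_self hr⟩)
  set B := connectedComponentIn (frontier Ω) x with hB
  have hBm : B ∈ componentsOf (frontier Ω) := ⟨x, hxf, rfl⟩
  have hxB : x ∈ B := mem_connectedComponentIn hxf
  -- A non-degenerate boundary component through `x` would be some `Γ k`, and `C` would be `K k`.
  have hBs : B = {x} := by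
    refine (not_nontrivial_iff.mp fun hn => ?_).eq_singleton_of_mem hxB
    have : B ∈ range Γ := by rw [h.range_eq]; exact ⟨hBm, hn⟩
    obtain ⟨k, hk⟩ := this
    have hxk : x ∈ K k := h.boundary_subset_fill hΩ.isOpen k (hk ▸ hxB)
    have := eq_of_mem_componentsOf hC (h.component k) hxC hxk
    exact hpK (mem_iUnion.mpr ⟨k, this ▸ hpC⟩)
  -- the other components of the boundary stay away from `x`
  set T := ⋃ A ∈ componentsOf (frontier Ω) \ {B}, A with hT
  have hTc : IsClosed T := (hΩ.finite_components.subset sdiff_subset).isClosed_biUnion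
    fun A hA => isClosed_of_mem_componentsOf isClosed_frontier hA.1
  have hxT : x ∉ T := by
    simp only [hT, mem_iUnion, not_exists]
    intro A hA hxA
    exact hA.2 (eq_of_mem_componentsOf hA.1 hBm hxA hxB)
  obtain ⟨r, hr, hb⟩ := Metric.isOpen_iff.mp hTc.isOpen_compl x hxT
  have hfr : ∀ y ∈ Metric.ball x r, y ∈ frontier Ω → y = x := by
    intro y hy hyf
    by_contra hne
    refine hb hy (mem_iUnion₂.mpr ⟨connectedComponentIn (frontier Ω) y, ⟨⟨y, hyf, rfl⟩, fun h => ?_⟩,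
      mem_connectedComponentIn hyf⟩)
    have h1 : y ∈ B := by
      rw [← show connectedComponentIn (frontier Ω) y = B from h]
      exact mem_connectedComponentIn hyf
    rw [hBs] at h1
    exact hne h1
  have hpre : IsPreconnected (Metric.ball x r \ {x}) := by
    have := isPreconnected_norm_sub_mem x (I := Ioo 0 r) ordConnected_Ioo fun s hs => hs.1.le
    refine (congrArg IsPreconnected ?_).mp this
    ext z
    simp only [mem_ofPred_eq, mem_Ioo, norm_pos_iff, sub_ne_zero, Set.mem_sdiff, mem_ball_iff_norm,
      mem_singleton_iff]
    exact and_comm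
  -- The punctured disc is connected, meets `Ω` and misses `∂Ω`.
  have hsub : Metric.ball x r \ {x} ⊆ Ω := by
    obtain ⟨y, hy, hyΩ⟩ := Metric.mem_closure_iff.mp hxf.1 r hr |>.imp fun y hy => hy.symm
    rw [dist_comm] at hy
    by_contra hcon
    obtain ⟨w, hw, hwΩ⟩ := not_subset.mp hcon
    obtain ⟨v, hv, hvf⟩ := hpre.inter_frontier_nonempty (T := Ω)
      ⟨y, ⟨hy, fun h => hxΩ (h ▸ hyΩ)⟩, hyΩ⟩ ⟨w, hw, hwΩ⟩
    exact hv.2 (hfr v hv.1 hvf)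
  -- The point `x` is isolated in the connected set `C`, which therefore has no second point.
  have hpx : p = x := by
    by_contra hne
    obtain ⟨z, hzC, hz1, hz2⟩ := (isPreconnected_of_mem_componentsOf hC) (Metric.ball x r) {x}ᶜ
      Metric.isOpen_ball isOpen_compl_singleton (fun z _ => by
        by_cases hz : z = x
        · exact Or.inl (hz ▸ Metric.mem_ball_self hr)
        · exact Or.inr hz) ⟨x, hxC, Metric.mem_ball_self hr⟩ ⟨p, hpC, hne⟩
    exact hCsub hzC (hsub ⟨hz1, hz2⟩)
  subst hpx
  exact ⟨hBs, hxf, r, hr, hsub⟩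

theorem finite_degeneratePoints (h : IsBoundaryLabelling Ω Γ K)
    (hΩ : IsBoundedFinitelyConnectedDomain Ω) : (degeneratePoints Ω K).Finite := by
  refine Finite.of_finite_image (f := fun p => ({p} : Set ℂ)) (hΩ.finite_components.subset ?_)
    (singleton_injective.injOn)
  rintro _ ⟨p, hp, rfl⟩
  obtain ⟨h1, h2, -⟩ := h.exists_ball_of_mem_degeneratePoints hΩ hp
  exact ⟨p, h2, h1.symm⟩

theorem compl_iUnion_fill (h : IsBoundaryLabelling Ω Γ K) :
    (⋃ k, K k)ᶜ = Ω ∪ degeneratePoints Ω K := by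
  ext z
  simp only [degeneratePoints, mem_compl_iff, mem_union, Set.mem_sdiff]
  by_cases hz : z ∈ Ω
  · simp only [hz, true_or, iff_true]
    intro h'
    obtain ⟨k, hk⟩ := mem_iUnion.mp h'
    exact h.fill_subset_compl k hk hz
  · simp [hz]

/-- The exterior of a large disc is connected and disjoint from `Ω`, and the unbounded set `K 0`
meets it. -/
theorem exists_compl_ball_subset (h : IsBoundaryLabelling Ω Γ K) (hΩ : Bornology.IsBounded Ω) :
    ∃ R > 0, Ω ⊆ Metric.ball 0 R ∧ (Metric.ball 0 R)ᶜ ⊆ K 0 := by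
  obtain ⟨R, hR⟩ := hΩ.subset_ball 0
  have hR1 : Ω ⊆ Metric.ball 0 (max R 1) := hR.trans (Metric.ball_subset_ball (le_max_left _ _))
  refine ⟨max R 1, by positivity, hR1, ?_⟩
  have hpre := isPreconnected_norm_sub_mem 0 (I := Ici (max R 1)) ordConnected_Ici
    (Ici_subset_Ici.mpr (by positivity))
  have he : {z : ℂ | ‖z - 0‖ ∈ Ici (max R 1)} = (Metric.ball 0 (max R 1))ᶜ := by
    ext z
    simp only [sub_zero, mem_Ici, mem_ofPred_eq, mem_compl_iff, mem_ball_zero_iff, not_lt]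
  rw [he] at hpre
  refine subset_of_mem_componentsOf_of_inter (h.component 0) hpre (compl_subset_compl.mpr hR1) ?_
  by_contra hcon
  refine h.outer ((Metric.isBounded_ball (x := (0 : ℂ)) (r := max R 1)).subset fun z hz => ?_)
  by_contra hz'
  exact hcon ⟨z, hz', hz⟩

theorem fill_subset_ball (h : IsBoundaryLabelling Ω Γ K) {R : ℝ}
    (hR : (Metric.ball 0 R)ᶜ ⊆ K 0) {k : Fin (n + 1)} (hk : k ≠ 0) : K k ⊆ Metric.ball 0 R :=
  fun _ hz => by_contra fun hz' => disjoint_left.mp (h.disjoint_fill hk) hz (hR hz')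

end IsBoundaryLabelling

/-! ### Harmonic measure as the solution of the Dirichlet problem -/

/-- A sum of terms `log (D / ‖z - p‖)`, where `D` bounds all distances from `Ω` to `F`. Small
multiples of it make the points of `F` irrelevant for bounded functions. -/
theorem exists_polar_barrier {Ω F : Set ℂ} (hΩ : Bornology.IsBounded Ω) (hF : F.Finite)
    (hd : Disjoint Ω F) :
    ∃ S : ℂ → ℝ, MeanValueOn S Ω ∧ (∀ z ∈ Ω, 0 ≤ S z) ∧ ∀ p ∈ F, Tendsto S (𝓝[Ω] p) atTop := by
  obtain ⟨R, hR⟩ := (hΩ.union hF.isBounded).exists_norm_le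
  set D : ℝ := 2 * R with hD
  have hnn : ∀ z ∈ Ω, ∀ p ∈ F, 0 ≤ Real.log D - Real.log ‖z - p‖ := by
    intro z hz p hp
    have h1 : 0 < ‖z - p‖ :=
      norm_pos_iff.mpr (sub_ne_zero.mpr fun h => disjoint_left.mp hd hz (h ▸ hp))
    have h2 : ‖z - p‖ ≤ D := by
      have := norm_sub_le z p
      have := hR z (Or.inl hz)
      have := hR p (Or.inr hp)
      linarith
    linarith [Real.log_le_log h1 h2]
  refine ⟨fun z => ∑ p ∈ hF.toFinset, (Real.log D - Real.log ‖z - p‖),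
    MeanValueOn.sum _ fun p hp => (meanValueOn_const _ _).sub
      ((meanValueOn_log_norm_sub p).mono fun z hz h =>
        disjoint_left.mp hd hz (mem_singleton_iff.mp h ▸ (hF.mem_toFinset.mp hp))),
    fun z hz => Finset.sum_nonneg fun p hp => hnn z hz p (hF.mem_toFinset.mp hp), fun p hp => ?_⟩
  have hlim : Tendsto (fun z => Real.log D - Real.log ‖z - p‖) (𝓝[Ω] p) atTop := by
    have h1 : Tendsto (fun z : ℂ => ‖z - p‖) (𝓝[Ω] p) (𝓝[≠] 0) := by
      refine tendsto_nhdsWithin_iff.mpr ⟨?_, ?_⟩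
      · have : ContinuousAt (fun z : ℂ => ‖z - p‖) p := by fun_prop
        simpa using this.tendsto.mono_left nhdsWithin_le_nhds
      · filter_upwards [self_mem_nhdsWithin] with z hz
        exact norm_ne_zero_iff.mpr (sub_ne_zero.mpr fun h => disjoint_left.mp hd hz (h ▸ hp))
    have h2 := tendsto_neg_atBot_atTop.comp (Real.tendsto_log_nhdsNE_zero.comp h1)
    simpa [sub_eq_add_neg] using tendsto_atTop_add_const_left _ (Real.log D) h2
  refine tendsto_atTop_mono' _ ?_ hlim
  filter_upwards [self_mem_nhdsWithin] with z hz
  exact Finset.single_le_sum (f := fun p => Real.log D - Real.log ‖z - p‖)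
    (fun q hq => hnn z hz q (hF.mem_toFinset.mp hq)) (hF.mem_toFinset.mpr hp)

/-- A bounded continuous function with the mean value property that has the boundary values `φ` off
finitely many points is the Perron solution. -/
theorem perronSolution_eq_of_tendsto {Ω F : Set ℂ} (hΩo : IsOpen Ω) (hΩ : Bornology.IsBounded Ω)
    (hF : F.Finite) (hd : Disjoint Ω F) {φ U : ℂ → ℝ} (hU : MeanValueOn U Ω) {a b : ℝ}
    (ha : ∀ z ∈ Ω, a ≤ U z) (hb : ∀ z ∈ Ω, U z ≤ b)
    (hbd : ∀ ζ ∈ frontier Ω, ζ ∉ F → Tendsto U (𝓝[Ω] ζ) (𝓝 (φ ζ))) {z : ℂ} (hz : z ∈ Ω) :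
    perronSolution Ω φ z = U z := by
  obtain ⟨S, hS, hS0, hSt⟩ := exists_polar_barrier hΩ hF hd
  have hle : ∀ u ∈ perronFamily Ω φ, u z ≤ U z := by
    rintro u ⟨hu, hub⟩
    refine le_of_forall_pos_le_add fun ε hε => ?_
    have hS1 : 0 < S z + 1 := by linarith [hS0 z hz]
    -- Adding `η * S` settles the comparison at the exceptional points, where `S` tends to infinity,
    -- and costs at most `ε` at the fixed point `z`.
    set η := ε / (S z + 1) with hη
    have hη0 : 0 < η := div_pos hε hS1
    have key := nonpos_of_localSubmeanOn hΩo hΩ (g := fun w => u w + -(U w + η * S w)) ?_ ?_ ?_ z hz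
    · have h1 : η * S z ≤ ε := by
        rw [hη, div_mul_eq_mul_div, div_le_iff₀ hS1]
        nlinarith
      linarith
    · refine hu.usc.add ?_
      exact ((hU.add (hS.const_mul η)).continuousOn.neg).upperSemicontinuousOn
    · intro w hw
      exact LocalSubmeanAt.add (hu.submean w hw)
        ((hU.add (hS.const_mul η)).neg.localSubmeanAt (hΩo.mem_nhds hw))
    · intro ζ hζ c hc
      by_cases hζF : ζ ∈ F
      · filter_upwards [hub ζ hζ (φ ζ + 1) (by linarith), self_mem_nhdsWithin,
          (hSt ζ hζF).eventually_ge_atTop ((φ ζ + 1 - a) / η)] with w h1 h2 h3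
        rw [div_le_iff₀ hη0] at h3
        nlinarith [ha w h2]
      · filter_upwards [hub ζ hζ (φ ζ + c / 2) (by linarith), self_mem_nhdsWithin,
          (hbd ζ hζ hζF).eventually_const_lt (u := φ ζ - c / 2) (by linarith)] with w h1 h2 h3
        nlinarith [mul_nonneg hη0.le (hS0 w h2)]
  have hmem : ∀ η > 0, (fun w => U w + -(η * S w)) ∈ perronFamily Ω φ := by
    intro η hη
    have hm := hU.add (hS.const_mul η).neg
    refine ⟨⟨hm.continuousOn.upperSemicontinuousOn,
      fun w hw => hm.localSubmeanAt (hΩo.mem_nhds hw)⟩, fun ζ hζ c hc => ?_⟩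
    by_cases hζF : ζ ∈ F
    · filter_upwards [self_mem_nhdsWithin,
        (hSt ζ hζF).eventually_gt_atTop ((b - c) / η)] with w h2 h3
      rw [div_lt_iff₀ hη] at h3
      nlinarith [hb w h2]
    · filter_upwards [self_mem_nhdsWithin, (hbd ζ hζ hζF).eventually_lt_const hc] with w h2 h3
      nlinarith [mul_nonneg hη.le (hS0 w h2)]
  refine le_antisymm (csSup_le ⟨_, _, hmem 1 one_pos, rfl⟩ ?_) ?_
  · rintro y ⟨u, hu, rfl⟩
    exact hle u hu
  · refine le_of_forall_pos_le_add fun ε hε => ?_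
    have hS1 : 0 < S z + 1 := by linarith [hS0 z hz]
    have hη0 : 0 < ε / (S z + 1) := div_pos hε hS1
    have h1 := le_csSup (a := U z + -(ε / (S z + 1) * S z)) (s := {y | ∃ u ∈ perronFamily Ω φ, y = u z})
      ⟨U z, by rintro y ⟨u, hu, rfl⟩; exact hle u hu⟩ ⟨_, hmem _ hη0, rfl⟩
    have h2 : ε / (S z + 1) * S z ≤ ε := by
      rw [div_mul_eq_mul_div, div_le_iff₀ hS1]
      nlinarith
    rw [perronSolution]
    linarith

theorem isClosed_iUnion_ne {n : ℕ} {F : Fin (n + 1) → Set ℂ} (hF : ∀ k, IsClosed (F k)) (j : Fin (n + 1)) :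
    IsClosed (⋃ k ∈ {k | k ≠ j}, F k) :=
  (toFinite _).isClosed_biUnion fun k _ => hF k

theorem union_iUnion_ne {n : ℕ} (F : Fin (n + 1) → Set ℂ) (j : Fin (n + 1)) :
    F j ∪ ⋃ k ∈ {k | k ≠ j}, F k = ⋃ k, F k := by
  ext z
  simp only [mem_union, mem_iUnion, mem_ofPred_eq, exists_prop]
  constructor
  · rintro (hz | ⟨k, -, hz⟩)
    exacts [⟨j, hz⟩, ⟨k, hz⟩]
  · rintro ⟨k, hz⟩
    by_cases hk : k = j
    · exact Or.inl (hk ▸ hz)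
    · exact Or.inr ⟨k, hk, hz⟩

namespace IsBoundaryLabelling

variable {Ω : Set ℂ} {n : ℕ} {Γ K : Fin (n + 1) → Set ℂ}

theorem exists_dirichletSolution (h : IsBoundaryLabelling Ω Γ K) (hΩ : IsOpen Ω)
    (j : Fin (n + 1)) : ∃ U, IsDirichletSolution (K j) (⋃ k ∈ {k | k ≠ j}, K k) U := by
  refine exists_isDirichletSolution (h.isClosed_fill hΩ j) (isClosed_iUnion_ne (fun k => h.isClosed_fill hΩ k) j) ?_
    (fun ζ hζ => h.meetsSmallCircles_fill hΩ hζ) fun ζ hζ => ?_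
  · simp only [disjoint_iUnion_right]
    exact fun k hk => h.disjoint_fill (Ne.symm hk)
  · obtain ⟨k, hk, hζ⟩ := mem_iUnion₂.mp hζ
    exact (h.meetsSmallCircles_fill hΩ hζ).mono (subset_biUnion_of_mem hk)

/-- By continuity `U` attains its own values at every boundary point. On `∂Ω ∩ K k` these are the
values of the indicator of `Γ j`, and the boundary points outside all `K k` form a finite set. -/
theorem harmonicMeasure_eq (h : IsBoundaryLabelling Ω Γ K)
    (hΩ : IsBoundedFinitelyConnectedDomain Ω) {j : Fin (n + 1)} {U : ℂ → ℝ}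
    (hU : IsDirichletSolution (K j) (⋃ k ∈ {k | k ≠ j}, K k) U) {z : ℂ} (hz : z ∈ Ω) :
    harmonicMeasure Ω z (Γ j) = U z := by
  refine perronSolution_eq_of_tendsto hΩ.isOpen hΩ.isBounded (h.finite_degeneratePoints hΩ)
    (disjoint_left.mpr fun w hw hw' => hw'.1 hw) (hU.meanValueOn.mono ?_)
    (fun z _ => hU.nonneg z) (fun z _ => hU.le_one z) (fun ζ hζ hζF => ?_) hz
  · rw [union_iUnion_ne, h.compl_iUnion_fill]
    exact subset_union_left
  · have hv : U ζ = (Γ j).indicator (fun _ => 1) ζ := by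
      have hζΩ : ζ ∉ Ω := fun h' => by
        rw [hΩ.isOpen.frontier_eq] at hζ
        exact hζ.2 h'
      have hζK : ζ ∈ ⋃ k, K k := by_contra fun h' => hζF ⟨hζΩ, h'⟩
      obtain ⟨k, hk⟩ := mem_iUnion.mp hζK
      by_cases hkj : k = j
      · subst hkj
        have h1 : ζ ∈ Γ k ∩ K k := h.frontier_inter_fill k ▸ ⟨hζ, hk⟩
        rw [hU.eq_one ζ hk, indicator_of_mem h1.1]
      · rw [hU.eq_zero ζ (mem_biUnion hkj hk), indicator_of_notMem]
        exact fun h' => disjoint_left.mp (h.disjoint_fill hkj) hk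
          (h.boundary_subset_fill hΩ.isOpen j h')
    rw [← hv]
    exact hU.continuous.continuousAt.tendsto.mono_left nhdsWithin_le_nhds

end IsBoundaryLabelling

/-! ### Minimum principle -/

theorem eq_zero_of_circleAverage_le_zero {V : ℂ → ℝ} (hV : Continuous V) (h0 : ∀ z, 0 ≤ V z) {w z : ℂ}
    (h : Real.circleAverage V w ‖z - w‖ ≤ 0) : V z = 0 := by
  by_contra hne
  have hpos : 0 < V z := (h0 z).lt_of_ne' hne
  have hc : Continuous fun θ => V (circleMap w ‖z - w‖ θ) := hV.comp (continuous_circleMap _ _)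
  obtain ⟨θ, hθ, hz⟩ : z ∈ circleMap w ‖z - w‖ '' Ioc 0 (2 * Real.pi) := by
    rw [image_circleMap_Ioc]
    simp
  have h1 : 0 < ∫ θ in (0 : ℝ)..2 * Real.pi, V (circleMap w ‖z - w‖ θ) :=
    intervalIntegral.integral_pos Real.two_pi_pos hc.continuousOn (fun _ _ => h0 _)
      ⟨θ, ⟨hθ.1.le, hθ.2⟩, by rwa [hz]⟩
  rw [Real.circleAverage_def, smul_eq_mul] at h
  have h2 : 0 < (2 * Real.pi)⁻¹ := inv_pos.mpr Real.two_pi_pos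
  exact absurd h (not_le.mpr (mul_pos h2 h1))

theorem MeanValueOn.eq_zero_of_nonneg {V : ℂ → ℝ} {S : Set ℂ} (h : MeanValueOn V S)
    (hV : Continuous V) (h0 : ∀ z, 0 ≤ V z) {w : ℂ} {ρ : ℝ} (hw : Metric.ball w ρ ⊆ S)
    (hw0 : V w = 0) : ∀ z ∈ Metric.ball w ρ, V z = 0 := fun z hz =>
  eq_zero_of_circleAverage_le_zero hV h0 (w := w) (by
    rw [h.circleAverage_eq w _ (norm_nonneg _), hw0]
    exact (Metric.closedBall_subset_ball (mem_ball_iff_norm.mp hz)).trans hw)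

/-- The mean value property across `ζ` carries the zero to a point of `Ω`. Inside `Ω` the zero set
is open and relatively closed. -/
theorem MeanValueOn.eq_zero_of_isPreconnected {V : ℂ → ℝ} {Ω : Set ℂ} (h : MeanValueOn V Ω)
    (hΩ : IsOpen Ω) (hc : IsPreconnected Ω) (hV : Continuous V) (h0 : ∀ z, 0 ≤ V z) {ζ : ℂ}
    {ρ : ℝ} (hρ : 0 < ρ) (hζ : ζ ∈ closure Ω) (hζ0 : V ζ = 0) (hm : MeanValueOn V (Metric.ball ζ ρ)) :
    ∀ z ∈ closure Ω, V z = 0 := by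
  obtain ⟨x, hxΩ, hx⟩ := Metric.mem_closure_iff.mp hζ ρ hρ
  have hx0 : V x = 0 := hm.eq_zero_of_nonneg hV h0 subset_rfl hζ0 x (by rwa [Metric.mem_ball, dist_comm])
  have hint : ∀ z ∈ Ω, V z = 0 := by
    by_contra! hcon
    obtain ⟨y, hyΩ, hy⟩ := hcon
    have hopen : ∀ z ∈ Ω, V z = 0 → z ∈ interior {z | V z = 0} := fun z hz hz0 => by
      obtain ⟨r, hr, hb⟩ := Metric.isOpen_iff.mp hΩ z hz
      exact mem_interior.mpr ⟨_, h.eq_zero_of_nonneg hV h0 hb hz0, Metric.isOpen_ball,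
        Metric.mem_ball_self hr⟩
    obtain ⟨z, hzΩ, hz1, hz2⟩ := hc (interior {z | V z = 0}) {z | V z ≠ 0} isOpen_interior
      (isOpen_ne_fun hV continuous_const) (fun z hz => (em (V z = 0)).imp (hopen z hz) id)
      ⟨x, hxΩ, hopen x hxΩ hx0⟩ ⟨y, hyΩ, hy⟩
    exact hz2 (interior_subset (s := {z | V z = 0}) hz1)
  exact fun z hz => closure_minimal hint (isClosed_eq hV continuous_const) hz

/-! ### Equilibrium measures of a condenser -/

/-- The sign with which the potential of the `k`-th measure enters the representation. -/
noncomputable def componentSign {n : ℕ} (j k : Fin (n + 1)) : ℝ := if k = j then 1 else -1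

theorem componentSign_self {n : ℕ} (j : Fin (n + 1)) : componentSign j j = 1 := if_pos rfl

theorem componentSign_of_ne {n : ℕ} {j k : Fin (n + 1)} (h : k ≠ j) : componentSign j k = -1 :=
  if_neg h

theorem componentSign_mul_self {n : ℕ} (j k : Fin (n + 1)) :
    componentSign j k * componentSign j k = 1 := by
  unfold componentSign
  split_ifs <;> norm_num

theorem sum_componentSign_mul {n : ℕ} (j : Fin (n + 1)) (f : Fin (n + 1) → ℝ) :
    ∑ k, componentSign j k * f k = f j - ∑ k ∈ Finset.univ.erase j, f k := by
  rw [← Finset.add_sum_erase _ _ (Finset.mem_univ j), componentSign_self, one_mul, sub_eq_add_neg,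
    ← Finset.sum_neg_distrib]
  congr 1
  refine Finset.sum_congr rfl fun k hk => ?_
  rw [componentSign_of_ne (Finset.ne_of_mem_erase hk), neg_one_mul]

section Family

variable {n : ℕ} {F : Fin (n + 1) → Set ℂ} {j : Fin (n + 1)} {U : ℂ → ℝ}

/-- A disc that misses all the frontiers either lies inside one plate, where `U` is constant, or
misses all plates. -/
theorem IsDirichletSolution.circleAverage_eq
    (hU : IsDirichletSolution (F j) (⋃ k ∈ {k | k ≠ j}, F k) U) {w : ℂ} {r : ℝ}
    (hr : 0 ≤ r) (hd : ∀ k, Disjoint (Metric.closedBall w r) (frontier (F k))) :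
    Real.circleAverage U w r = U w := by
  have hw := Metric.mem_closedBall_self (x := w) hr
  by_cases hk : ∃ k, (Metric.closedBall w r ∩ F k).Nonempty
  · obtain ⟨k, hk⟩ := hk
    have hsub : Metric.closedBall w r ⊆ F k := by
      by_contra hcon
      obtain ⟨z, hz, hz'⟩ := Metric.isPreconnected_closedBall.inter_frontier_nonempty hk
        (not_subset.mp hcon)
      exact disjoint_left.mp (hd k) hz hz'
    have hconst : ∀ z ∈ Metric.closedBall w r, U z = U w := fun z hz => by
      by_cases hkj : k = j
      · rw [hU.eq_one z (hkj ▸ hsub hz), hU.eq_one w (hkj ▸ hsub hw)]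
      · rw [hU.eq_zero z (mem_biUnion hkj (hsub hz)), hU.eq_zero w (mem_biUnion hkj (hsub hw))]
    exact Real.circleAverage_const_on_circle fun z hz => hconst z (sphere_abs_subset hr subset_rfl hz)
  · refine hU.meanValueOn.circleAverage_eq w r hr fun z hz hz' => hk ?_
    rw [union_iUnion_ne] at hz'
    obtain ⟨k, hzk⟩ := mem_iUnion.mp hz'
    exact ⟨k, z, hz, hzk⟩

/-- The equilibrium measures of a condenser whose plates are finitely many disjoint closed sets. -/
theorem IsDirichletSolution.exists_measures
    (hU : IsDirichletSolution (F j) (⋃ k ∈ {k | k ≠ j}, F k) U) (hF : ∀ k, IsClosed (F k))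
    (hd : Pairwise fun k l => Disjoint (F k) (F l)) (hc : ∀ k, IsCompact (frontier (F k)))
    (hne : ∀ k, (frontier (F k)).Nonempty) {R : ℝ} (hR : ∀ z, R ≤ ‖z‖ → U z = 0) :
    ∃ μ : Fin (n + 1) → Measure ℂ, (∀ k, IsFiniteMeasure (μ k)) ∧
      (∀ k, μ k (frontier (F k))ᶜ = 0) ∧
      (∀ z, (∀ k, z ∉ frontier (F k)) → U z = ∑ k, componentSign j k * logPotential (μ k) z) ∧
      ∑ k, componentSign j k * (μ k).real univ = 0 := by
  have hfr : ∀ k, frontier (F k) ⊆ F k := fun k => (hF k).frontier_subset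
  have hδ : ∀ k, ∃ δ, 0 < δ ∧ Metric.cthickening δ (frontier (F k)) ⊆ (⋃ l ∈ {l | l ≠ k}, F l)ᶜ :=
    fun k => (hc k).exists_cthickening_subset_open (isClosed_iUnion_ne hF k).isOpen_compl
      (fun z hz hz' => by
        obtain ⟨l, hl, hz'⟩ := mem_iUnion₂.mp hz'
        exact disjoint_left.mp (hd hl) hz' (hfr k hz))
  choose δ hδ0 hδ using hδ
  obtain ⟨k₀, hk₀⟩ := Finite.exists_min δ
  -- Half of the separation is spent on the position of the centre and half on the radius, so the
  -- disc misses all plates other than `F k`.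
  have hball : ∀ k, ∀ w ∈ Metric.cthickening (δ k₀ / 2) (frontier (F k)), ∀ r, 0 < r →
      r < δ k₀ / 2 → ∀ l, l ≠ k → Metric.closedBall w r ⊆ (F l)ᶜ := by
    intro k w hw r hr hr' l hl z hz hzl
    refine hδ k ?_ (mem_biUnion (show l ∈ {l | l ≠ k} from hl) hzl)
    refine Metric.cthickening_mono (hk₀ k) _ ?_
    have hpos := half_pos (hδ0 k₀)
    have h1 : z ∈ Metric.cthickening (δ k₀ / 2)
        (Metric.cthickening (δ k₀ / 2) (frontier (F k))) :=
      Metric.mem_cthickening_of_dist_le z w _ _ hw (hz.trans hr'.le)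
    have := Metric.cthickening_cthickening_subset hpos.le hpos.le (frontier (F k)) h1
    rwa [add_halves] at this
  refine exists_potential_representation hc hne
    (fun k l hkl => (hd hkl).mono (hfr k) (hfr l)) (componentSign_mul_self j) hU.continuous hR
    (fun w r hr hd => hU.circleAverage_eq hr hd) (half_pos (hδ0 k₀)) (fun k w hw r hr hr' => ?_)
  by_cases hkj : k = j
  · subst hkj
    rw [componentSign_self, one_mul, sub_nonneg]
    refine hU.circleAverage_le (hF k) (isClosed_iUnion_ne hF k) hr.le fun z hz hz' => ?_
    obtain ⟨l, hl, hz'⟩ := mem_iUnion₂.mp hz'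
    exact hball k w hw r hr hr' l hl hz hz'
  · have := hU.le_circleAverage (hF j) (isClosed_iUnion_ne hF j) hr.le
      (hball k w hw r hr hr' j (Ne.symm hkj))
    rw [componentSign_of_ne hkj]
    linarith

end Family

/-! ### Existence of the measures and their supports -/

namespace IsBoundaryLabelling

variable {Ω : Set ℂ} {n : ℕ} {Γ K : Fin (n + 1) → Set ℂ}

/-- Here `j ≠ 0` is essential: `K 0` carries the value 0, so `U` vanishes outside a large disc. -/
theorem exists_measures (h : IsBoundaryLabelling Ω Γ K)
    (hΩ : IsBoundedFinitelyConnectedDomain Ω) {j : Fin (n + 1)} (hj : j ≠ 0) {U : ℂ → ℝ}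
    (hU : IsDirichletSolution (K j) (⋃ k ∈ {k | k ≠ j}, K k) U) :
    ∃ μ : Fin (n + 1) → Measure ℂ, (∀ k, IsFiniteMeasure (μ k)) ∧ (∀ k, μ k (Γ k)ᶜ = 0) ∧
      (∀ z, (∀ k, z ∉ Γ k) → U z = ∑ k, componentSign j k * logPotential (μ k) z) ∧
      ∑ k, componentSign j k * (μ k).real univ = 0 := by
  obtain ⟨R, -, -, hR⟩ := h.exists_compl_ball_subset hΩ.isBounded
  simp only [← h.frontier_eq]
  refine hU.exists_measures (fun k => h.isClosed_fill hΩ.isOpen k) h.disjoint_fill (fun k => ?_)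
    (fun k => ?_) (R := R) fun z hz => ?_
  · rw [h.frontier_eq]
    exact h.isCompact_boundary hΩ.isBounded k
  · rw [h.frontier_eq]
    exact (h.boundary_mem k).2.nonempty
  · exact hU.eq_zero z (mem_biUnion (show (0 : Fin (n + 1)) ∈ {k | k ≠ j} from hj.symm)
      (hR (by simpa using hz)))

/-- The measures of the representation charge every boundary arc. -/
theorem boundary_subset_support (h : IsBoundaryLabelling Ω Γ K)
    (hΩ : IsBoundedFinitelyConnectedDomain Ω) {j : Fin (n + 1)} (hj : j ≠ 0) {U : ℂ → ℝ}
    (hU : IsDirichletSolution (K j) (⋃ k ∈ {k | k ≠ j}, K k) U) {μ : Fin (n + 1) → Measure ℂ}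
    (hfin : ∀ k, IsFiniteMeasure (μ k)) (hμ : ∀ k, μ k (Γ k)ᶜ = 0)
    (heq : ∀ z, (∀ k, z ∉ Γ k) → U z = ∑ k, componentSign j k * logPotential (μ k) z)
    (k : Fin (n + 1)) : Γ k ⊆ (μ k).support := by
  intro ζ hζ
  by_contra hns
  obtain ⟨N, hN, hN0⟩ := Measure.notMem_support_iff_exists.mp hns
  have hζK := h.boundary_subset_fill hΩ.isOpen k hζ
  have hζl : ζ ∉ ⋃ l ∈ {l | l ≠ k}, K l := fun hz => by
    obtain ⟨l, hl, hz⟩ := mem_iUnion₂.mp hz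
    exact disjoint_left.mp (h.disjoint_fill hl) hz hζK
  obtain ⟨ρ, hρ, hb⟩ := Metric.mem_nhds_iff.mp (inter_mem hN
    ((isClosed_iUnion_ne (fun k => h.isClosed_fill hΩ.isOpen k) k).isOpen_compl.mem_nhds hζl))
  have hbl : ∀ l, l ≠ k → ∀ z ∈ Metric.ball ζ ρ, z ∉ K l := fun l hl z hz hzl =>
    (hb hz).2 (mem_biUnion (show l ∈ {l | l ≠ k} from hl) hzl)
  -- If `μ k` does not charge the ball, the right-hand side is harmonic in it. It equals `U` off the
  -- nowhere dense set `Γ k`, hence throughout the ball by continuity.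
  have hmv : MeanValueOn (fun z => ∑ l, componentSign j l * logPotential (μ l) z)
      (Metric.ball ζ ρ) := by
    refine MeanValueOn.sum _ fun l _ => MeanValueOn.const_mul ?_ _
    have := hfin l
    by_cases hl : l = k
    · subst hl
      refine (meanValueOn_logPotential (T := Γ l \ Metric.ball ζ ρ)
        ((h.isCompact_boundary hΩ.isBounded l).diff Metric.isOpen_ball) ?_).mono
        fun z hz hz' => hz'.2 hz
      refine measure_mono_null (t := (Γ l)ᶜ ∪ N) (fun z hz => ?_) (measure_union_null (hμ l) hN0)
      by_cases hzl : z ∈ Γ l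
      · exact Or.inr (hb (by_contra fun hzb => hz ⟨hzl, hzb⟩)).1
      · exact Or.inl hzl
    · exact (meanValueOn_logPotential (h.isCompact_boundary hΩ.isBounded l) (hμ l)).mono
        fun z hz hz' => hbl l hl z hz (h.boundary_subset_fill hΩ.isOpen l hz')
  have hUeq : EqOn U (fun z => ∑ l, componentSign j l * logPotential (μ l) z)
      (Metric.ball ζ ρ) := by
    have h1 : EqOn U (fun z => ∑ l, componentSign j l * logPotential (μ l) z)
        (Metric.ball ζ ρ \ Γ k) := fun z hz => heq z fun l hzl => by
      by_cases hl : l = k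
      · exact hz.2 (hl ▸ hzl)
      · exact hbl l hl z hz.1 (h.boundary_subset_fill hΩ.isOpen l hzl)
    refine h1.of_subset_closure hU.continuous.continuousOn hmv.continuousOn sdiff_subset
      fun z hz => ?_
    have hdense : Dense (Γ k)ᶜ := by
      rw [← interior_eq_empty_iff_dense_compl, ← h.frontier_eq k]
      exact interior_frontier (h.isClosed_fill hΩ.isOpen k)
    exact hdense.open_subset_closure_inter Metric.isOpen_ball hz
  have hUb : MeanValueOn U (Metric.ball ζ ρ) := hmv.congr hUeq
  have hUΩ : MeanValueOn U Ω := hU.meanValueOn.mono (by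
    rw [union_iUnion_ne, h.compl_iUnion_fill]; exact subset_union_left)
  have hζc : ζ ∈ closure Ω := (h.boundary_subset_frontier k hζ).1
  have hcl : ∀ l, ∃ z ∈ closure Ω, z ∈ K l := fun l => by
    obtain ⟨z, hz⟩ := (h.boundary_mem l).2.nonempty
    exact ⟨z, (h.boundary_subset_frontier l hz).1, h.boundary_subset_fill hΩ.isOpen l hz⟩
  -- The nonnegative function `1 - U` for `k = j`, and `U` otherwise, vanishes at `ζ` and hence on
  -- the closure of `Ω`. This fails at a point of `Γ 0`, respectively `Γ j`.
  by_cases hk : k = j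
  · subst hk
    obtain ⟨z, hz, hz0⟩ := hcl 0
    have hV := hU.symm
    have := ((meanValueOn_const 1 _).sub hUΩ).eq_zero_of_isPreconnected hΩ.isOpen
      hΩ.isConnected.isPreconnected hV.continuous hV.nonneg hρ hζc (hV.eq_zero ζ hζK)
      ((meanValueOn_const 1 _).sub hUb) z hz
    simp only [hU.eq_zero z (mem_biUnion (show (0 : Fin (n + 1)) ∈ {l | l ≠ k} from hj.symm) hz0)]
      at this
    norm_num at this
  · obtain ⟨z, hz, hzj⟩ := hcl j
    have := hUΩ.eq_zero_of_isPreconnected hΩ.isOpen hΩ.isConnected.isPreconnected hU.continuous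
      hU.nonneg hρ hζc (hU.eq_zero ζ (mem_biUnion (show k ∈ {l | l ≠ j} from hk) hζK)) hUb z hz
    rw [hU.eq_one z hzj] at this
    exact one_ne_zero this

end IsBoundaryLabelling

/-! ### Winding numbers of a C¹ Jordan curve -/

/-- The integral `∫ γ' / (γ - z)` over `[a, b]`. -/
noncomputable def cauchyIntegral (γ : ℝ → ℂ) (a b : ℝ) (z : ℂ) : ℂ :=
  ∫ t in a..b, deriv γ t / (γ t - z)

theorem intervalIntegrable_deriv_div_sub {γ : ℝ → ℂ} (hγ : ContDiff ℝ 1 γ) {a b : ℝ} (hab : a ≤ b)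
    {z : ℂ} (hz : ∀ t ∈ Icc a b, γ t ≠ z) :
    IntervalIntegrable (fun t => deriv γ t / (γ t - z)) volume a b := by
  refine ContinuousOn.intervalIntegrable ?_
  rw [uIcc_of_le hab]
  exact (hγ.continuous_deriv le_rfl).continuousOn.div
    (hγ.continuous.sub continuous_const).continuousOn fun t ht => sub_ne_zero.mpr (hz t ht)

theorem integral_deriv_div_eq_log_sub {f : ℝ → ℂ} {f' : ℝ → ℂ} {a b : ℝ} (hab : a ≤ b)
    (hf : ∀ t ∈ Icc a b, HasDerivAt f (f' t) t) (hs : ∀ t ∈ Icc a b, f t ∈ Complex.slitPlane)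
    (hi : IntervalIntegrable (fun t => f' t / f t) volume a b) :
    ∫ t in a..b, f' t / f t = Complex.log (f b) - Complex.log (f a) := by
  refine intervalIntegral.integral_eq_sub_of_hasDerivAt (f := fun t => Complex.log (f t)) (fun t ht => ?_) hi
  rw [uIcc_of_le hab] at ht
  exact (hf t ht).clog_real (hs t ht)

/-- The quotient `(γ - z') / (γ - z) = 1 - (z' - z) / (γ - z)` stays within distance less than 1 of
1, so the principal logarithm is a primitive along the whole arc. For a closed curve the end terms
cancel, which gives local constancy. -/
theorem cauchyIntegral_sub_eq {γ : ℝ → ℂ} (hγ : ContDiff ℝ 1 γ) {a b : ℝ} (hab : a ≤ b) {z z' : ℂ}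
    (h : ∀ t ∈ Icc a b, ‖z' - z‖ < ‖γ t - z‖) :
    cauchyIntegral γ a b z' - cauchyIntegral γ a b z =
      Complex.log (1 - (z' - z) / (γ b - z)) - Complex.log (1 - (z' - z) / (γ a - z)) := by
  have hz : ∀ t ∈ Icc a b, γ t - z ≠ 0 := fun t ht =>
    norm_pos_iff.mp ((norm_nonneg _).trans_lt (h t ht))
  have hz' : ∀ t ∈ Icc a b, γ t - z' ≠ 0 := fun t ht h0 => by
    have := h t ht
    rw [sub_eq_zero.mp h0] at this
    exact lt_irrefl _ this
  have hi := intervalIntegrable_deriv_div_sub hγ hab fun t ht => sub_ne_zero.mp (hz t ht)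
  have hi' := intervalIntegrable_deriv_div_sub hγ hab fun t ht => sub_ne_zero.mp (hz' t ht)
  have hd : ∀ t, HasDerivAt γ (deriv γ t) t := fun t => (hγ.differentiable one_ne_zero t).hasDerivAt
  have key : ∀ t ∈ Icc a b, deriv γ t / (γ t - z') - deriv γ t / (γ t - z) =
      ((z' - z) * deriv γ t / (γ t - z) ^ 2) / (1 - (z' - z) / (γ t - z)) := fun t ht => by
    have h1 := hz t ht
    have h2 := hz' t ht
    have h3 : 1 - (z' - z) / (γ t - z) = (γ t - z') / (γ t - z) := by
      field_simp
      ring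
    rw [h3]
    field_simp
    ring
  rw [cauchyIntegral, cauchyIntegral, ← intervalIntegral.integral_sub hi' hi,
    ← integral_deriv_div_eq_log_sub (f := fun t => 1 - (z' - z) / (γ t - z))
      (f' := fun t => (z' - z) * deriv γ t / (γ t - z) ^ 2) hab (fun t ht => ?_) (fun t ht => ?_)]
  · refine intervalIntegral.integral_congr fun t ht => ?_
    rw [uIcc_of_le hab] at ht
    exact key t ht
  · refine (hi'.sub hi).congr fun t ht => ?_
    rw [uIoc_of_le hab] at ht
    exact key t (Ioc_subset_Icc_self ht)
  · have := ((hasDerivAt_const t (z' - z)).div ((hd t).sub_const z) (hz t ht)).const_sub 1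
    refine this.congr_deriv ?_
    simp only [zero_mul, zero_sub, neg_div, neg_neg]
  · refine Complex.mem_slitPlane_of_norm_lt_one (z := -((z' - z) / (γ t - z))) ?_
    rw [norm_neg, norm_div, div_lt_one ((norm_nonneg _).trans_lt (h t ht))]
    exact h t ht

theorem exists_pos_lt_norm_sub {γ : ℝ → ℂ} (hγ : Continuous γ) {a b : ℝ} {z : ℂ}
    (hz : ∀ t ∈ Icc a b, γ t ≠ z) : ∃ δ > 0, ∀ t ∈ Icc a b, δ < ‖γ t - z‖ := by
  have hc : IsCompact (γ '' Icc a b) := isCompact_Icc.image hγ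
  have hzc : z ∈ (γ '' Icc a b)ᶜ := by
    rintro ⟨t, ht, h⟩
    exact hz t ht h
  obtain ⟨δ, hδ, h⟩ := Metric.isOpen_iff.mp hc.isClosed.isOpen_compl z hzc
  refine ⟨δ / 2, half_pos hδ, fun t ht => ?_⟩
  by_contra! hle
  exact h (mem_ball_iff_norm.mpr (hle.trans_lt (half_lt_self hδ))) ⟨t, ht, rfl⟩

theorem continuousAt_cauchyIntegral {γ : ℝ → ℂ} (hγ : ContDiff ℝ 1 γ) {a b : ℝ} (hab : a ≤ b)
    {z : ℂ} (hz : ∀ t ∈ Icc a b, γ t ≠ z) : ContinuousAt (cauchyIntegral γ a b) z := by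
  obtain ⟨δ, hδ, h⟩ := exists_pos_lt_norm_sub hγ.continuous hz
  have hl : ∀ t, ContinuousAt (fun z' => Complex.log (1 - (z' - z) / (γ t - z))) z := fun t => by
    refine ContinuousAt.clog (by fun_prop) ?_
    simp
  have hc : ContinuousAt (fun z' => cauchyIntegral γ a b z +
      (Complex.log (1 - (z' - z) / (γ b - z)) - Complex.log (1 - (z' - z) / (γ a - z)))) z :=
    continuousAt_const.add ((hl b).sub (hl a))
  refine hc.congr ?_
  filter_upwards [Metric.ball_mem_nhds z hδ] with z' hz'
  rw [← cauchyIntegral_sub_eq hγ hab fun t ht => (mem_ball_iff_norm.mp hz').trans (h t ht)]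
  ring

theorem cauchyIntegral_eq_of_isPreconnected {γ : ℝ → ℂ} (hγ : ContDiff ℝ 1 γ) {a b : ℝ}
    (hab : a ≤ b) (hcl : γ a = γ b) {S : Set ℂ} (hS : IsPreconnected S)
    (hSγ : ∀ z ∈ S, ∀ t ∈ Icc a b, γ t ≠ z) {x y : ℂ} (hx : x ∈ S) (hy : y ∈ S) :
    cauchyIntegral γ a b x = cauchyIntegral γ a b y := by
  have hloc : ∀ z ∈ S, ∃ δ > 0, ∀ z' ∈ Metric.ball z δ,
      cauchyIntegral γ a b z' = cauchyIntegral γ a b z := fun z hz => by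
    obtain ⟨δ, hδ, h⟩ := exists_pos_lt_norm_sub hγ.continuous (hSγ z hz)
    refine ⟨δ, hδ, fun z' hz' => ?_⟩
    have := cauchyIntegral_sub_eq hγ hab fun t ht => (mem_ball_iff_norm.mp hz').trans (h t ht)
    rwa [hcl, sub_self, sub_eq_zero] at this
  by_contra hne
  have hop : ∀ z ∈ S, ∀ p : ℂ → Prop, p (cauchyIntegral γ a b z) →
      z ∈ interior {z | p (cauchyIntegral γ a b z)} := fun z hz p hp => by
    obtain ⟨δ, hδ, h⟩ := hloc z hz
    exact mem_interior.mpr ⟨Metric.ball z δ, fun z' hz' => show p _ by rwa [h z' hz'],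
      Metric.isOpen_ball, Metric.mem_ball_self hδ⟩
  obtain ⟨z, -, hz1, hz2⟩ := hS (interior {z | cauchyIntegral γ a b z = cauchyIntegral γ a b x})
    (interior {z | cauchyIntegral γ a b z ≠ cauchyIntegral γ a b x}) isOpen_interior isOpen_interior
    (fun z hz => (em _).imp (hop z hz fun w => w = cauchyIntegral γ a b x)
      (hop z hz fun w => w ≠ cauchyIntegral γ a b x))
    ⟨x, hx, hop x hx (fun w => w = cauchyIntegral γ a b x) rfl⟩
    ⟨y, hy, hop y hy (fun w => w ≠ cauchyIntegral γ a b x) (Ne.symm hne)⟩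
  exact interior_subset (s := {z | cauchyIntegral γ a b z ≠ cauchyIntegral γ a b x}) hz2
    (interior_subset (s := {z | cauchyIntegral γ a b z = cauchyIntegral γ a b x}) hz1)

theorem tendsto_cauchyIntegral_cobounded {γ : ℝ → ℂ} (hγ : ContDiff ℝ 1 γ) {a b : ℝ}
    (hab : a ≤ b) : Tendsto (cauchyIntegral γ a b) (Bornology.cobounded ℂ) (𝓝 0) := by
  obtain ⟨M, hM⟩ := (isCompact_Icc (a := a) (b := b)).exists_bound_of_continuousOn
    hγ.continuous.continuousOn
  obtain ⟨M', hM'⟩ := (isCompact_Icc (a := a) (b := b)).exists_bound_of_continuousOn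
    (hγ.continuous_deriv le_rfl).continuousOn
  have hM0 : 0 ≤ M' := (norm_nonneg _).trans (hM' a ⟨le_rfl, hab⟩)
  have hlim : Tendsto (fun z : ℂ => M' / (‖z‖ - M) * |b - a|) (Bornology.cobounded ℂ) (𝓝 0) := by
    have h1 : Tendsto (fun z : ℂ => ‖z‖ - M) (Bornology.cobounded ℂ) atTop :=
      tendsto_atTop_add_const_right _ _ tendsto_norm_cobounded_atTop
    simpa using (h1.const_div_atTop M').mul_const |b - a|
  refine squeeze_zero_norm' ?_ hlim
  filter_upwards [tendsto_norm_cobounded_atTop.eventually_gt_atTop M] with z hz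
  refine intervalIntegral.norm_integral_le_of_norm_le_const fun t ht => ?_
  rw [uIoc_of_le hab] at ht
  have ht := Ioc_subset_Icc_self ht
  have h1 := hM t ht
  have h2 : ‖z‖ - ‖γ t‖ ≤ ‖γ t - z‖ := by rw [norm_sub_rev]; exact norm_sub_norm_le z (γ t)
  rw [norm_div]
  exact div_le_div₀ hM0 (hM' t ht) (sub_pos.mpr hz) (by linarith)

theorem log_neg_of_im_pos {w : ℂ} (hw : 0 < w.im) :
    Complex.log w - Complex.log (-w) = Real.pi * Complex.I := by
  rw [Complex.log, Complex.log, norm_neg, Complex.arg_neg_eq_arg_sub_pi_of_im_pos hw]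
  push_cast
  ring

theorem tendsto_log_add_ofReal {w : ℂ} (hw : w.im ≠ 0) :
    Tendsto (fun ε : ℝ => Complex.log (w + ε)) (𝓝[>] 0) (𝓝 (Complex.log w)) := by
  have : ContinuousAt (fun ε : ℝ => Complex.log (w + ε)) 0 := by
    refine ContinuousAt.clog (by fun_prop) ?_
    simpa using Complex.mem_slitPlane_iff.mpr (Or.inr hw)
  simpa using this.tendsto.mono_left nhdsWithin_le_nhds

/-- The factor `κ / c` cancels in the integrand and rotates the arc, seen from `p + ε κ c`, into the
slit plane; `κ * κ = -1` turns the offset into `+ε`. The choices `κ = ± i` are the two sides of the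
curve. -/
theorem cauchyIntegral_add_mul_eq {γ : ℝ → ℂ} (hγ : ContDiff ℝ 1 γ) {a b : ℝ} (hab : a ≤ b)
    {p c κ : ℂ} (hc : c ≠ 0) (hκ : κ * κ = -1) {ε : ℝ}
    (hs : ∀ t ∈ Icc a b, κ * ((γ t - p) / c) + ε ∈ Complex.slitPlane) :
    cauchyIntegral γ a b (p + ε * (κ * c)) =
      Complex.log (κ * ((γ b - p) / c) + ε) - Complex.log (κ * ((γ a - p) / c) + ε) := by
  have hκ0 : κ ≠ 0 := fun h => by simp [h] at hκ
  have e : ∀ t, κ * ((γ t - p) / c) + ε = κ / c * (γ t - (p + ε * (κ * c))) := fun t => by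
    field_simp
    linear_combination (ε : ℂ) * hκ * c
  have hne : ∀ t ∈ Icc a b, γ t - (p + ε * (κ * c)) ≠ 0 := fun t ht h => by
    have := Complex.slitPlane_ne_zero (hs t ht)
    rw [e, h, mul_zero] at this
    exact this rfl
  have e2 : ∀ t ∈ Icc a b, deriv γ t / (γ t - (p + ε * (κ * c))) =
      κ / c * deriv γ t / (κ / c * (γ t - (p + ε * (κ * c)))) := fun t ht => by
    have := hne t ht
    field_simp
  have hi := intervalIntegrable_deriv_div_sub hγ hab fun t ht => sub_ne_zero.mp (hne t ht)
  have hd : ∀ t, HasDerivAt γ (deriv γ t) t := fun t => (hγ.differentiable one_ne_zero t).hasDerivAt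
  rw [e, e, ← integral_deriv_div_eq_log_sub
    (f := fun t => κ / c * (γ t - (p + ε * (κ * c)))) (f' := fun t => κ / c * deriv γ t) hab
    (fun t _ => ((hd t).sub_const _).const_mul _) (fun t ht => e t ▸ hs t ht)
    (hi.congr fun t ht => e2 t (Ioc_subset_Icc_self (by rwa [uIoc_of_le hab] at ht)))]
  refine intervalIntegral.integral_congr fun t ht => ?_
  rw [uIcc_of_le hab] at ht
  exact e2 t ht

/-- The Cauchy integral of a simple closed curve jumps by `2πi` across the curve. -/
theorem tendsto_cauchyIntegral_sub {γ : ℝ → ℂ} (hγ : ContDiff ℝ 1 γ) (hp : Function.Periodic γ 1)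
    (hinj : InjOn γ (Ico 0 1)) {t₀ : ℝ} (hc : deriv γ t₀ ≠ 0) :
    Tendsto (fun ε : ℝ => cauchyIntegral γ 0 1 (γ t₀ + ε * (Complex.I * deriv γ t₀)) -
      cauchyIntegral γ 0 1 (γ t₀ + ε * (-Complex.I * deriv γ t₀))) (𝓝[>] 0)
      (𝓝 (2 * Real.pi * Complex.I)) := by
  set c := deriv γ t₀ with hcdef
  set p := γ t₀ with hpdef
  have hd : HasDerivAt γ c t₀ := (hγ.differentiable one_ne_zero t₀).hasDerivAt
  obtain ⟨η₀, hη₀, hnear⟩ : ∃ η > 0, ∀ t, |t - t₀| ≤ η →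
      ‖(γ t - p) / c - ((t - t₀ : ℝ) : ℂ)‖ ≤ |t - t₀| / 2 := by
    have h1 := hd.isLittleO.bound (c := ‖c‖ / 2) (by positivity)
    obtain ⟨η, hη, h⟩ := Metric.nhds_basis_closedBall.eventually_iff.mp h1
    refine ⟨η, hη, fun t ht => ?_⟩
    have h2 := h (show t ∈ Metric.closedBall t₀ η from ht)
    have h3 : (γ t - p) / c - ((t - t₀ : ℝ) : ℂ) = (γ t - γ t₀ - (t - t₀) • c) / c := by
      rw [Complex.real_smul, hpdef]
      field_simp
    rw [h3, norm_div, div_le_iff₀ (norm_pos_iff.mpr hc)]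
    rw [Real.norm_eq_abs] at h2
    linarith
  -- The bound `1 / 4` keeps the near arc shorter than a period.
  set η := min η₀ (1 / 4) with hη
  have hη0 : 0 < η := lt_min hη₀ (by norm_num)
  have hη4 : η ≤ 1 / 4 := min_le_right _ _
  have hre : ∀ t, |t - t₀| ≤ η → |((γ t - p) / c).re - (t - t₀)| ≤ |t - t₀| / 2 := fun t ht => by
    have := (Complex.abs_re_le_norm _).trans (hnear t (ht.trans (min_le_left _ _)))
    simpa using this
  -- In the coordinate `(γ - p) / c` the curve has nonzero real part for `t ≠ t₀` near `t₀`, and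
  -- multiplication by `± i` makes this an imaginary part. At `t₀` itself the value is `ε > 0`.
  have hslit : ∀ κ : ℂ, (κ = Complex.I ∨ κ = -Complex.I) → ∀ ε : ℝ, 0 < ε →
      ∀ t ∈ Icc (t₀ - η) (t₀ + η), κ * ((γ t - p) / c) + ε ∈ Complex.slitPlane := by
    intro κ hκ ε hε t ht
    have h1 := hre t (abs_le.mpr ⟨by linarith [ht.1], by linarith [ht.2]⟩)
    rcases eq_or_ne t t₀ with rfl | hne
    · simp [← hpdef, Complex.mem_slitPlane_iff, hε]
    · refine Complex.mem_slitPlane_iff.mpr (Or.inr ?_)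
      have h2 : ((γ t - p) / c).re ≠ 0 := fun h0 => by
        rw [h0, zero_sub, abs_neg] at h1
        have := abs_pos.mpr (sub_ne_zero.mpr hne)
        linarith
      rcases hκ with rfl | rfl <;> simpa using h2
  have hII : Complex.I * Complex.I = -1 := Complex.I_mul_I
  have hII' : -Complex.I * -Complex.I = -1 := by rw [neg_mul_neg, Complex.I_mul_I]
  have hle : t₀ - η ≤ t₀ + η := by linarith
  have hle' : t₀ + η ≤ t₀ - η + 1 := by linarith
  set A := (γ (t₀ + η) - p) / c with hA
  set B := (γ (t₀ - η) - p) / c with hB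
  have hA0 : 0 < A.re := by
    have := hre (t₀ + η) (by simp [abs_of_pos hη0])
    rw [add_sub_cancel_left, abs_of_pos hη0] at this
    have := (abs_le.mp this).1
    linarith
  have hB0 : B.re < 0 := by
    have := hre (t₀ - η) (by simp [abs_of_pos hη0])
    rw [sub_sub_cancel_left, abs_neg, abs_of_pos hη0] at this
    have := (abs_le.mp this).2
    linarith
  -- the arc away from the point
  have hfar : ∀ t ∈ Icc (t₀ + η) (t₀ - η + 1), γ t ≠ p := by
    intro t ht h
    have e1 : γ (Int.fract t) = γ (Int.fract t₀) := by
      have hfr : ∀ s, γ (Int.fract s) = γ s := fun s => by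
        have := hp.sub_int_mul_eq (x := s) ⌊s⌋
        rwa [mul_one, Int.self_sub_floor] at this
      rw [hfr, hfr, h]
    have e2 := hinj ⟨Int.fract_nonneg t, Int.fract_lt_one t⟩
      ⟨Int.fract_nonneg t₀, Int.fract_lt_one t₀⟩ e1
    obtain ⟨m, hm⟩ := Int.fract_eq_fract.mp e2
    have h1 : (0 : ℝ) < m := by rw [← hm]; linarith [ht.1]
    have h2 : (m : ℝ) < 1 := by rw [← hm]; linarith [ht.2]
    have h3 : (0 : ℤ) < m := by exact_mod_cast h1
    have h4 : m < (1 : ℤ) := by exact_mod_cast h2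
    omega
  have hcont : ContinuousAt (cauchyIntegral γ (t₀ + η) (t₀ - η + 1)) p :=
    continuousAt_cauchyIntegral hγ hle' hfar
  obtain ⟨δ, hδ, hδfar⟩ := exists_pos_lt_norm_sub hγ.continuous hfar
  have hto : ∀ κ : ℂ, Tendsto (fun ε : ℝ => p + ε * (κ * c)) (𝓝[>] 0) (𝓝 p) := fun κ => by
    have : ContinuousAt (fun ε : ℝ => p + ε * (κ * c)) 0 := by fun_prop
    simpa using this.tendsto.mono_left nhdsWithin_le_nhds
  have hdp : Function.Periodic (deriv γ) 1 := fun t => by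
    rw [← deriv_comp_add_const]
    exact congrArg (fun f => deriv f t) (funext hp)
  have hdec : ∀ κ : ℂ, (κ = Complex.I ∨ κ = -Complex.I) → ∀ᶠ ε : ℝ in 𝓝[>] 0,
      cauchyIntegral γ 0 1 (p + ε * (κ * c)) = Complex.log (κ * A + ε) - Complex.log (κ * B + ε) +
        cauchyIntegral γ (t₀ + η) (t₀ - η + 1) (p + ε * (κ * c)) := by
    intro κ hκ
    filter_upwards [self_mem_nhdsWithin, (hto κ).eventually (Metric.ball_mem_nhds p hδ)]
      with ε hε hb
    have hκ2 : κ * κ = -1 := by rcases hκ with rfl | rfl <;> assumption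
    have hs := hslit κ hκ ε hε
    have hκ0 : κ ≠ 0 := fun h => by simp [h] at hκ2
    rw [← cauchyIntegral_add_mul_eq hγ hle hc hκ2 hs]
    have hper : Function.Periodic (fun t => deriv γ t / (γ t - (p + ε * (κ * c)))) 1 := fun t => by
      simp only [hp t, hdp t]
    have h1 := hper.intervalIntegral_add_eq 0 (t₀ - η)
    rw [zero_add] at h1
    rw [cauchyIntegral, h1, cauchyIntegral, cauchyIntegral,
      intervalIntegral.integral_add_adjacent_intervals]
    · refine intervalIntegrable_deriv_div_sub hγ hle fun t ht h0 => ?_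
      have h2 := Complex.slitPlane_ne_zero (hs t ht)
      rw [h0, add_sub_cancel_left] at h2
      refine h2 ?_
      field_simp
      linear_combination (ε : ℂ) * hκ2
    · refine intervalIntegrable_deriv_div_sub hγ hle' fun t ht h0 => ?_
      have h2 := hδfar t ht
      rw [h0] at h2
      exact absurd (mem_ball_iff_norm.mp hb) (not_lt.mpr h2.le)
  have hI := hdec Complex.I (Or.inl rfl)
  have hI' := hdec (-Complex.I) (Or.inr rfl)
  have hAim : (Complex.I * A).im ≠ 0 := by simpa using hA0.ne'
  have hBim : (Complex.I * B).im ≠ 0 := by simpa using hB0.ne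
  have hAim' : (-Complex.I * A).im ≠ 0 := by simpa using hA0.ne'
  have hBim' : (-Complex.I * B).im ≠ 0 := by simpa using hB0.ne
  have hlim := (((tendsto_log_add_ofReal hAim).sub (tendsto_log_add_ofReal hBim)).add
    (hcont.tendsto.comp (hto Complex.I))).sub
    (((tendsto_log_add_ofReal hAim').sub (tendsto_log_add_ofReal hBim')).add
    (hcont.tendsto.comp (hto (-Complex.I))))
  have hval : Complex.log (Complex.I * A) - Complex.log (Complex.I * B) +
      cauchyIntegral γ (t₀ + η) (t₀ - η + 1) p -
      (Complex.log (-Complex.I * A) - Complex.log (-Complex.I * B) +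
      cauchyIntegral γ (t₀ + η) (t₀ - η + 1) p) = 2 * Real.pi * Complex.I := by
    -- Each of the two ends of the near arc contributes `πi` to the jump; the far arc contributes
    -- equally from both sides and cancels.
    have h1 := log_neg_of_im_pos (w := Complex.I * A) (by simpa using hA0)
    have h2 := log_neg_of_im_pos (w := -Complex.I * B) (by simpa using hB0)
    rw [← neg_mul] at h1
    rw [← neg_mul, neg_neg] at h2
    linear_combination h1 + h2
  rw [hval] at hlim
  refine hlim.congr' ?_
  filter_upwards [hI, hI'] with ε h1 h2
  rw [h1, h2]
  rfl

namespace IsC1JordanDomain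

variable {D : Set ℂ} {γ : ℝ → ℂ}

theorem curve_notMem (h : IsC1JordanDomain D γ) (t : ℝ) : γ t ∉ D := fun ht => by
  have : γ t ∈ frontier D := h.range_eq ▸ mem_range_self t
  rw [h.isOpen.frontier_eq] at this
  exact this.2 ht

theorem isCompact_range (h : IsC1JordanDomain D γ) : IsCompact (range γ) := by
  have := isCompact_Icc.image (s := Icc (0 : ℝ) (0 + 1)) h.contDiff.continuous
  rwa [h.periodic.image_Icc one_pos] at this

/-- Off the closed domain the Cauchy integral drops by `2πi`. -/
theorem cauchyIntegral_sub (h : IsC1JordanDomain D γ) {x w : ℂ} (hx : x ∈ D) (hw : w ∉ closure D) :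
    cauchyIntegral γ 0 1 x - cauchyIntegral γ 0 1 w = 2 * Real.pi * Complex.I := by
  have hγ1 := h.contDiff
  have hcl : γ 0 = γ 1 := by simpa using (h.periodic 0).symm
  -- The segment from `w` to a nearest point of the curve is normal to the curve and meets it only
  -- at that point. So the Cauchy integral is constant along it, and it approaches the curve in the
  -- direction required by the jump relation.
  obtain ⟨t₁, hmin⟩ : ∃ t₁, ∀ t, ‖γ t₁ - w‖ ≤ ‖γ t - w‖ := by
    obtain ⟨_, ⟨t₁, rfl⟩, ht⟩ := h.isCompact_range.exists_isMinOn (range_nonempty γ)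
      (f := fun z => ‖z - w‖) (by fun_prop)
    exact ⟨t₁, fun t => ht (mem_range_self t)⟩
  set p := γ t₁ with hp
  set c := deriv γ t₁ with hc
  have hc0 : c ≠ 0 := h.deriv_ne_zero t₁
  have hwr : ∀ t, γ t ≠ w := fun t ht => hw (ht ▸ frontier_subset_closure
    (h.range_eq ▸ mem_range_self t))
  have hpw : w - p ≠ 0 := sub_ne_zero.mpr (hwr t₁).symm
  obtain ⟨l, hl⟩ : ∃ l : ℝ, w - p = l * (Complex.I * c) := by
    have hd : HasDerivAt (fun t => γ t - w) c t₁ :=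
      ((hγ1.differentiable one_ne_zero t₁).hasDerivAt).sub_const w
    have h0 : inner ℝ (p - w) c = 0 := by
      have h1 := hd.norm_sq
      have h2 : IsLocalMin (fun t => ‖γ t - w‖ ^ 2) t₁ := Eventually.of_forall fun t => by
        have := hmin t
        dsimp only
        gcongr
      have := h2.hasDerivAt_eq_zero h1
      linarith
    have h3 : ((w - p) / c).re = 0 := by
      rw [Complex.inner] at h0
      have e : (w - p) / c = -((p - w) * (starRingEnd ℂ) c / (Complex.normSq c : ℂ)) := by
        rw [div_eq_mul_inv, Complex.inv_def]
        push_cast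
        ring
      rw [e, Complex.neg_re, Complex.div_ofReal_re, neg_eq_zero, div_eq_zero_iff]
      left
      rw [← h0]
      simp only [Complex.mul_re, Complex.conj_re, Complex.conj_im]
      ring
    refine ⟨((w - p) / c).im, ?_⟩
    have e : (w - p) / c = ((w - p) / c).im * Complex.I := by
      conv_lhs => rw [← Complex.re_add_im ((w - p) / c), h3]
      simp
    rw [div_eq_iff hc0] at e
    rw [← mul_assoc, ← e]
  have hl0 : l ≠ 0 := fun h0 => hpw (by rw [hl, h0]; simp)
  -- the segment from the nearest point to `w`
  set S : Set ℂ := (fun s : ℝ => p + s * (w - p)) '' Ioc 0 1 with hS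
  have hSpre : IsPreconnected S := isPreconnected_Ioc.image _ (by fun_prop)
  have hwS : w ∈ S := ⟨1, ⟨one_pos, le_rfl⟩, by simp⟩
  have hSr : ∀ z ∈ S, ∀ t, γ t ≠ z := by
    rintro _ ⟨s, hs, rfl⟩ t ht
    have h1 := hmin t
    rw [ht, show p + s * (w - p) - w = ((s - 1 : ℝ) : ℂ) * (w - p) by push_cast; ring, norm_mul,
      Complex.norm_real, Real.norm_eq_abs, norm_sub_rev p w, abs_of_nonpos (by linarith [hs.2])] at h1
    have := norm_pos_iff.mpr hpw
    nlinarith [hs.1]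
  have hmemS : ∀ ε : ℝ, 0 < ε / l → ε / l ≤ 1 → p + ε * (Complex.I * c) ∈ S := fun ε h1 h2 => by
    refine ⟨ε / l, ⟨h1, h2⟩, ?_⟩
    simp only
    rw [hl]
    have : (l : ℂ) ≠ 0 := by exact_mod_cast hl0
    push_cast
    field_simp
  have hSD : ∀ z ∈ S, z ∉ D := fun z hz hzD => by
    obtain ⟨v, hv, hvf⟩ := hSpre.inter_frontier_nonempty ⟨z, hz, hzD⟩
      ⟨w, hwS, fun h => hw (subset_closure h)⟩
    obtain ⟨t, rfl⟩ := h.range_eq ▸ hvf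
    exact hSr _ hv t rfl
  -- The segment lies outside `D`, whereas the left normal points into `D`; so `w` is on the right.
  have hlneg : l < 0 := by
    by_contra! hge
    have hpos : 0 < l := hge.lt_of_ne' hl0
    have h1 : ∀ᶠ ε : ℝ in 𝓝[>] 0, ε < l := nhdsWithin_le_nhds (gt_mem_nhds hpos)
    obtain ⟨ε, hε, h2, h3⟩ := ((h.inner_normal t₁).and (h1.and self_mem_nhdsWithin)).exists
    exact hSD _ (hmemS ε (div_pos h3 hpos) ((div_le_one hpos).mpr h2.le)) hε
  have hright : ∀ᶠ ε : ℝ in 𝓝[>] 0, cauchyIntegral γ 0 1 (p + ε * (-Complex.I * c)) =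
      cauchyIntegral γ 0 1 w := by
    have h1 : ∀ᶠ ε : ℝ in 𝓝[>] 0, ε < -l := nhdsWithin_le_nhds (gt_mem_nhds (by linarith))
    filter_upwards [h1, self_mem_nhdsWithin] with ε h2 h3
    have h3 : 0 < ε := h3
    have hm := hmemS (-ε) (div_pos_of_neg_of_neg (by linarith) hlneg)
      ((div_le_one_of_neg hlneg).mpr (by linarith))
    have e : p + ((-ε : ℝ) : ℂ) * (Complex.I * c) = p + ε * (-Complex.I * c) := by push_cast; ring
    rw [e] at hm
    exact cauchyIntegral_eq_of_isPreconnected hγ1 zero_le_one hcl hSpre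
      (fun z hz t _ => hSr z hz t) hm hwS
  have hleft : ∀ᶠ ε : ℝ in 𝓝[>] 0, cauchyIntegral γ 0 1 (p + ε * (Complex.I * c)) =
      cauchyIntegral γ 0 1 x := by
    filter_upwards [h.inner_normal t₁] with ε hε
    exact cauchyIntegral_eq_of_isPreconnected hγ1 zero_le_one hcl h.isConnected.isPreconnected
      (fun z hz t _ ht => h.curve_notMem t (ht ▸ hz)) hε hx
  have hlim := tendsto_cauchyIntegral_sub hγ1 h.periodic h.injOn hc0
  refine tendsto_nhds_unique (tendsto_const_nhds.congr' ?_) hlim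
  filter_upwards [hleft, hright] with ε h1 h2
  rw [h1, h2]

theorem exists_mem_norm_cauchyIntegral_lt (h : IsC1JordanDomain D γ) {S : Set ℂ}
    (hS : ¬ Bornology.IsBounded S) {ε : ℝ} (hε : 0 < ε) :
    ∃ z ∈ S, ‖cauchyIntegral γ 0 1 z‖ < ε := by
  have h1 := (tendsto_cauchyIntegral_cobounded h.contDiff zero_le_one).norm.eventually_lt_const
    (u := ε) (by simpa using hε)
  by_contra! hcon
  refine hS (Bornology.isBounded_def.mpr ?_)
  filter_upwards [h1] with z hz hzS
  exact absurd hz (not_lt.mpr (hcon z hzS))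

theorem not_isBounded_compl_closure (hD : Bornology.IsBounded D) :
    ¬ Bornology.IsBounded (closure D)ᶜ := fun h => by
  have := hD.closure.union h
  rw [union_compl_self] at this
  exact NoncompactSpace.noncompact_univ (X := ℂ)
    (Metric.isCompact_of_isClosed_isBounded isClosed_univ this)

theorem cauchyIntegral_eq_of_mem (h : IsC1JordanDomain D γ) {x y : ℂ} (hx : x ∈ D) (hy : y ∈ D) :
    cauchyIntegral γ 0 1 x = cauchyIntegral γ 0 1 y :=
  cauchyIntegral_eq_of_isPreconnected h.contDiff zero_le_one (by simpa using (h.periodic 0).symm)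
    h.isConnected.isPreconnected (fun z hz t _ ht => h.curve_notMem t (ht ▸ hz)) hx hy

/-- By the jump relation the value is the same at all points off the closure of `D`, and these
include points near infinity, where it is small. -/
theorem cauchyIntegral_of_isBounded (h : IsC1JordanDomain D γ) (hD : Bornology.IsBounded D) :
    (∀ x ∈ D, cauchyIntegral γ 0 1 x = 2 * Real.pi * Complex.I) ∧
      ∀ w ∉ closure D, cauchyIntegral γ 0 1 w = 0 := by
  obtain ⟨x₀, hx₀⟩ := h.isConnected.nonempty
  have hout : ∀ w ∉ closure D, cauchyIntegral γ 0 1 w = 0 := by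
    intro w hw
    by_contra hne
    obtain ⟨z, hz, hlt⟩ := h.exists_mem_norm_cauchyIntegral_lt (not_isBounded_compl_closure hD)
      (norm_pos_iff.mpr hne)
    have e : cauchyIntegral γ 0 1 z = cauchyIntegral γ 0 1 w := by
      linear_combination h.cauchyIntegral_sub hx₀ hw - h.cauchyIntegral_sub hx₀ hz
    rw [e] at hlt
    exact lt_irrefl _ hlt
  refine ⟨fun x hx => ?_, hout⟩
  obtain ⟨w, hw⟩ : ((closure D)ᶜ).Nonempty := by
    by_contra hemp
    rw [not_nonempty_iff_eq_empty] at hemp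
    exact not_isBounded_compl_closure hD (hemp ▸ Bornology.isBounded_empty)
  rw [← h.cauchyIntegral_sub hx hw, hout w hw, sub_zero]

theorem cauchyIntegral_of_not_isBounded (h : IsC1JordanDomain D γ) (hD : ¬ Bornology.IsBounded D) :
    (∀ x ∈ D, cauchyIntegral γ 0 1 x = 0) ∧
      ∀ w ∉ closure D, cauchyIntegral γ 0 1 w = -(2 * Real.pi * Complex.I) := by
  have hin : ∀ x ∈ D, cauchyIntegral γ 0 1 x = 0 := by
    intro x hx
    by_contra hne
    obtain ⟨z, hz, hlt⟩ := h.exists_mem_norm_cauchyIntegral_lt hD (norm_pos_iff.mpr hne)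
    rw [h.cauchyIntegral_eq_of_mem hz hx] at hlt
    exact lt_irrefl _ hlt
  refine ⟨hin, fun w hw => ?_⟩
  obtain ⟨x, hx⟩ := h.isConnected.nonempty
  rw [← h.cauchyIntegral_sub hx hw, hin x hx, zero_sub, neg_neg]

end IsC1JordanDomain

/-! ### Periods of potentials -/

/-- The derivative of `w ↦ log ‖w‖`, as a real linear functional. -/
noncomputable def logNormDeriv (w : ℂ) : ℂ →L[ℝ] ℝ :=
  Complex.reCLM.comp (ContinuousLinearMap.mul ℝ ℂ w⁻¹)

theorem logNormDeriv_apply (w h : ℂ) : logNormDeriv w h = (h / w).re := by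
  simp [logNormDeriv, div_eq_inv_mul]

theorem hasFDerivAt_log_norm_sub (z : ℂ) {w : ℂ} (hw : w ≠ z) :
    HasFDerivAt (fun w => Real.log ‖w - z‖) (logNormDeriv (w - z)) w := by
  have h0 : w - z ≠ 0 := sub_ne_zero.mpr hw
  have h1 : HasFDerivAt (fun w => ‖w - z‖ ^ 2) _ w := ((hasFDerivAt_id w).sub_const z).norm_sq
  have h2 := (h1.log (pow_ne_zero 2 (norm_ne_zero_iff.mpr h0))).const_mul (1 / 2 : ℝ)
  refine (h2.congr_of_eventuallyEq (Eventually.of_forall fun w => ?_)).congr_fderiv ?_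
  · simp only [Real.log_pow]
    push_cast
    ring
  · ext h
    all_goals
      simp only [logNormDeriv_apply, smul_apply, ContinuousLinearMap.comp_apply,
        smul_eq_mul, ContinuousLinearMap.id_apply, innerSL_apply_apply, id, Complex.inner]
      rw [div_eq_mul_inv h, Complex.inv_def, ← mul_assoc h, Complex.re_mul_ofReal,
        Complex.normSq_eq_norm_sq, nsmul_eq_mul]
      push_cast
      ring

theorem norm_logNormDeriv_le (w : ℂ) : ‖logNormDeriv w‖ ≤ ‖w‖⁻¹ :=
  ContinuousLinearMap.opNorm_le_bound _ (by positivity) fun h => by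
    rw [logNormDeriv_apply, Real.norm_eq_abs]
    refine (Complex.abs_re_le_norm _).trans (le_of_eq ?_)
    rw [norm_div, div_eq_inv_mul]

theorem measurable_logNormDeriv : Measurable logNormDeriv := by
  have h : Continuous fun v : ℂ => Complex.reCLM.comp (ContinuousLinearMap.mul ℝ ℂ v) := by
    fun_prop
  exact h.measurable.comp measurable_inv

theorem hasFDerivAt_logPotential {μ : Measure ℂ} [IsFiniteMeasure μ] {T : Set ℂ}
    (hT : IsCompact T) (hμ : μ Tᶜ = 0) {w : ℂ} (hw : w ∉ T) :
    HasFDerivAt (logPotential μ) (-∫ z, logNormDeriv (w - z) ∂μ) w ∧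
      Integrable (fun z => logNormDeriv (w - z)) μ := by
  have hae : ∀ᵐ z ∂μ, z ∈ T := by
    filter_upwards [compl_mem_ae_iff.mpr hμ] with z hz
    rwa [compl_compl] at hz
  obtain ⟨C, δ, hδ, h⟩ := exists_abs_log_norm_sub_le (isCompact_singleton (x := w)) hT
    (disjoint_singleton_left.mpr hw)
  have hmeas : ∀ w : ℂ, AEStronglyMeasurable (fun z => logNormDeriv (w - z)) μ := fun w =>
    (measurable_logNormDeriv.comp (measurable_const.sub measurable_id)).aestronglyMeasurable
  have hbd : ∀ᵐ z ∂μ, ∀ w' ∈ Metric.ball w δ, ‖logNormDeriv (w' - z)‖ ≤ δ⁻¹ := by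
    filter_upwards [hae] with z hz w' hw'
    refine (norm_logNormDeriv_le _).trans ?_
    exact inv_anti₀ hδ (h w rfl z hz w' (mem_ball_iff_norm.mp hw').le).2
  have key := hasFDerivAt_integral_of_dominated_of_fderiv_le (μ := μ) (𝕜 := ℝ)
    (F := fun w z => Real.log ‖w - z‖) (F' := fun w z => logNormDeriv (w - z)) (x₀ := w)
    (bound := fun _ => δ⁻¹) (Metric.ball_mem_nhds w hδ)
    (Eventually.of_forall fun w => Measurable.aestronglyMeasurable (by fun_prop))
    (integrable_log_norm_sub hT hμ hw) (hmeas w) hbd (integrable_const _) (by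
      filter_upwards [hae] with z hz w' hw'
      refine hasFDerivAt_log_norm_sub z fun he => ?_
      have := (h w rfl z hz w' (mem_ball_iff_norm.mp hw').le).2
      rw [he, sub_self, norm_zero] at this
      linarith)
  refine ⟨?_, Integrable.of_bound (hmeas w) δ⁻¹ (hbd.mono fun z hz =>
    hz w (Metric.mem_ball_self hδ))⟩
  rw [show logPotential μ = fun w => -∫ z, Real.log ‖w - z‖ ∂μ from
    funext fun w => logPotential_eq_neg μ w]
  exact key.neg

/-- Differentiating along the normal `i v` turns the real part of `v / (w - z)` into its imaginary
part, the density of the winding number. -/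
theorem fderiv_logPotential_apply {μ : Measure ℂ} [IsFiniteMeasure μ] {T : Set ℂ}
    (hT : IsCompact T) (hμ : μ Tᶜ = 0) {w : ℂ} (hw : w ∉ T) (v : ℂ) :
    fderiv ℝ (logPotential μ) w (Complex.I * v) = ∫ z, (v / (w - z)).im ∂μ := by
  obtain ⟨h1, h2⟩ := hasFDerivAt_logPotential hT hμ hw
  rw [h1.fderiv, neg_apply, ContinuousLinearMap.integral_apply h2,
    ← integral_neg]
  refine integral_congr_ae (Eventually.of_forall fun z => ?_)
  simp only [logNormDeriv_apply]
  rw [mul_div_assoc, Complex.I_mul_re, neg_neg]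

theorem integral_fderiv_logPotential {μ : Measure ℂ} [IsFiniteMeasure μ] {T : Set ℂ}
    (hT : IsCompact T) (hμ : μ Tᶜ = 0) {γ : ℝ → ℂ} (hγ : ContDiff ℝ 1 γ) {a b : ℝ} (hab : a ≤ b)
    (hγT : ∀ t ∈ Icc a b, γ t ∉ T) :
    IntervalIntegrable (fun t => fderiv ℝ (logPotential μ) (γ t) (Complex.I * deriv γ t)) volume a b ∧
    ∫ t in a..b, fderiv ℝ (logPotential μ) (γ t) (Complex.I * deriv γ t) =
      ∫ z, (cauchyIntegral γ a b z).im ∂μ := by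
  have hae : ∀ᵐ z ∂μ, z ∈ T := by
    filter_upwards [compl_mem_ae_iff.mpr hμ] with z hz
    rwa [compl_compl] at hz
  obtain ⟨C, δ, hδ, h⟩ := exists_abs_log_norm_sub_le (isCompact_Icc.image hγ.continuous) hT
    (disjoint_left.mpr (by rintro _ ⟨t, ht, rfl⟩; exact hγT t ht) : Disjoint (γ '' Icc a b) T)
  obtain ⟨M, hM⟩ := (isCompact_Icc (a := a) (b := b)).exists_bound_of_continuousOn
    (hγ.continuous_deriv le_rfl).continuousOn
  have hdm : Measurable (deriv γ) := (hγ.continuous_deriv le_rfl).measurable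
  have hγm : Measurable γ := hγ.continuous.measurable
  have hprod : Integrable (fun q : ℝ × ℂ => (deriv γ q.1 / (γ q.1 - q.2)).im)
      ((volume.restrict (Ioc a b)).prod μ) := by
    refine Integrable.of_bound (Measurable.aestronglyMeasurable (by fun_prop)) (M * δ⁻¹) ?_
    have h1 : ∀ᵐ q ∂((volume.restrict (Ioc a b)).prod μ), q.1 ∈ Ioc a b :=
      Measure.quasiMeasurePreserving_fst.ae (ae_restrict_mem measurableSet_Ioc)
    have h2 : ∀ᵐ q ∂((volume.restrict (Ioc a b)).prod μ), q.2 ∈ T :=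
      Measure.quasiMeasurePreserving_snd.ae hae
    filter_upwards [h1, h2] with q hq1 hq2
    have hq1 := Ioc_subset_Icc_self hq1
    rw [Real.norm_eq_abs]
    refine (Complex.abs_im_le_norm _).trans ?_
    rw [norm_div, div_eq_mul_inv]
    have h3 := (h _ (mem_image_of_mem γ hq1) q.2 hq2 (γ q.1) (by simp [hδ.le])).2
    exact mul_le_mul (hM _ hq1) (inv_anti₀ hδ h3) (by positivity)
      ((norm_nonneg _).trans (hM _ hq1))
  have heq : ∀ t ∈ Ioc a b, ∫ z, (deriv γ t / (γ t - z)).im ∂μ =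
      fderiv ℝ (logPotential μ) (γ t) (Complex.I * deriv γ t) := fun t ht =>
    (fderiv_logPotential_apply hT hμ (hγT t (Ioc_subset_Icc_self ht)) _).symm
  constructor
  · rw [intervalIntegrable_iff_integrableOn_Ioc_of_le hab]
    exact (hprod.integral_prod_left).congr ((ae_restrict_mem measurableSet_Ioc).mono heq)
  · rw [intervalIntegral.integral_of_le hab, ← setIntegral_congr_fun measurableSet_Ioc heq,
      integral_integral_swap hprod]
    refine integral_congr_ae ?_
    filter_upwards [hae] with z hz
    have hi := intervalIntegrable_deriv_div_sub hγ hab (z := z) fun t ht h0 => hγT t ht (h0 ▸ hz)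
    rw [intervalIntegrable_iff_integrableOn_Ioc_of_le hab] at hi
    rw [cauchyIntegral, intervalIntegral.integral_of_le hab]
    exact integral_im hi

namespace IsBoundaryLabelling

variable {Ω : Set ℂ} {n : ℕ} {Γ K : Fin (n + 1) → Set ℂ}

/-- `Γ k` lies in `D` and the other `Γ l` lie off its closure, so the winding number is constant on
each of them. For bounded `D` only `Γ k` contributes. For `k = 0` the winding number is 0 on `Γ 0`
and -1 on the others, and `htot` converts the sum over the others into the term of `Γ 0`. -/
theorem period_eq (h : IsBoundaryLabelling Ω Γ K) (hΩ : IsBoundedFinitelyConnectedDomain Ω)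
    {j : Fin (n + 1)} {u : ℂ → ℝ} {μ : Fin (n + 1) → Measure ℂ}
    (hfin : ∀ k, IsFiniteMeasure (μ k)) (hμ : ∀ k, μ k (Γ k)ᶜ = 0)
    (heq : ∀ z ∈ Ω, u z = ∑ k, componentSign j k * logPotential (μ k) z)
    (htot : ∑ k, componentSign j k * (μ k).real univ = 0) {k : Fin (n + 1)} {D : Set ℂ}
    {γ : ℝ → ℂ} (hD : IsPeriodContour Ω (K k) D γ) :
    period u γ = componentSign j k * (μ k).real univ := by
  have hγΩ : ∀ t, γ t ∈ Ω := fun t => hD.frontier_subset (hD.jordan.range_eq ▸ mem_range_self t)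
  have hΓΩ : ∀ l, ∀ z ∈ Γ l, z ∉ Ω := fun l z hz =>
    h.fill_subset_compl l (h.boundary_subset_fill hΩ.isOpen l hz)
  have hγΓ : ∀ l t, γ t ∉ Γ l := fun l t ht => hΓΩ l _ ht (hγΩ t)
  have hfd : ∀ t, fderiv ℝ u (γ t) (Complex.I * deriv γ t) = ∑ l, componentSign j l *
      fderiv ℝ (logPotential (μ l)) (γ t) (Complex.I * deriv γ t) := by
    intro t
    have h1 : u =ᶠ[𝓝 (γ t)] fun z => ∑ l, componentSign j l * logPotential (μ l) z := by
      filter_upwards [hΩ.isOpen.mem_nhds (hγΩ t)] with z hz using heq z hz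
    have h2 : HasFDerivAt (fun z => ∑ l, componentSign j l * logPotential (μ l) z)
        (∑ l, componentSign j l • fderiv ℝ (logPotential (μ l)) (γ t)) (γ t) :=
      HasFDerivAt.fun_sum fun l _ => by
        have := hfin l
        have h3 := (hasFDerivAt_logPotential (h.isCompact_boundary hΩ.isBounded l) (hμ l)
          (hγΓ l t)).1
        exact h3.differentiableAt.hasFDerivAt.const_mul _
    rw [h1.fderiv_eq, h2.fderiv]
    simp
  have hper : period u γ = ∑ l, componentSign j l *
      (1 / (2 * Real.pi) * ∫ z, (cauchyIntegral γ 0 1 z).im ∂(μ l)) := by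
    have hl : ∀ l, IntervalIntegrable
        (fun t => fderiv ℝ (logPotential (μ l)) (γ t) (Complex.I * deriv γ t)) volume 0 1 ∧
        ∫ t in (0 : ℝ)..1, fderiv ℝ (logPotential (μ l)) (γ t) (Complex.I * deriv γ t) =
          ∫ z, (cauchyIntegral γ 0 1 z).im ∂(μ l) := fun l => by
      have := hfin l
      exact integral_fderiv_logPotential (h.isCompact_boundary hΩ.isBounded l) (hμ l)
        hD.jordan.contDiff zero_le_one fun t _ => hγΓ l t
    rw [period]
    simp only [hfd]
    rw [intervalIntegral.integral_finsetSum fun l _ => (hl l).1.const_mul _, Finset.mul_sum]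
    refine Finset.sum_congr rfl fun l _ => ?_
    rw [intervalIntegral.integral_const_mul, (hl l).2]
    ring
  have hint : ∀ l (a : ℝ), (∀ z ∈ Γ l, (cauchyIntegral γ 0 1 z).im = a * (2 * Real.pi)) →
      1 / (2 * Real.pi) * ∫ z, (cauchyIntegral γ 0 1 z).im ∂(μ l) = a * (μ l).real univ := by
    intro l a ha
    have h1 : ∫ z, (cauchyIntegral γ 0 1 z).im ∂(μ l) = ∫ _z, a * (2 * Real.pi) ∂(μ l) := by
      refine integral_congr_ae ?_
      filter_upwards [compl_mem_ae_iff.mpr (hμ l)] with z hz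
      rw [compl_compl] at hz
      exact ha z hz
    rw [h1, integral_const, smul_eq_mul]
    have := Real.pi_pos
    field_simp
  have hin : ∀ z ∈ Γ k, z ∈ D := fun z hz => by
    have : z ∈ K k := h.boundary_subset_fill hΩ.isOpen k hz
    rw [← hD.inter_compl] at this
    exact this.1
  have hout : ∀ l, l ≠ k → ∀ z ∈ Γ l, z ∉ closure D := fun l hl z hz hzc => by
    by_cases hzD : z ∈ D
    · have : z ∈ K k := hD.inter_compl ▸ ⟨hzD, hΓΩ l z hz⟩
      exact disjoint_left.mp (h.disjoint_fill hl) (h.boundary_subset_fill hΩ.isOpen l hz) this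
    · refine hΓΩ l z hz (hD.frontier_subset ?_)
      rw [hD.jordan.isOpen.frontier_eq]
      exact ⟨hzc, hzD⟩
  have hKD : K k ⊆ D := hD.inter_compl ▸ inter_subset_left
  rw [hper]
  by_cases hk : k = 0
  · subst hk
    obtain ⟨h1, h2⟩ := hD.jordan.cauchyIntegral_of_not_isBounded fun hb => h.outer (hb.subset hKD)
    have e : ∀ l, 1 / (2 * Real.pi) * ∫ z, (cauchyIntegral γ 0 1 z).im ∂(μ l) =
        if l = 0 then 0 else -(μ l).real univ := by
      intro l
      split_ifs with hl
      · subst hl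
        rw [hint 0 0 fun z hz => by rw [h1 z (hin z hz)]; simp, zero_mul]
      · rw [hint l (-1) fun z hz => by rw [h2 z (hout l hl z hz)]; simp, neg_one_mul]
    simp only [e]
    rw [← Finset.add_sum_erase _ _ (Finset.mem_univ 0)] at htot ⊢
    rw [if_pos rfl, mul_zero, zero_add, Finset.sum_congr rfl fun l hl => by
      rw [if_neg (Finset.ne_of_mem_erase hl), mul_neg], Finset.sum_neg_distrib]
    linarith
  · have hDb : Bornology.IsBounded D := by
      obtain ⟨R, -, -, hR⟩ := h.exists_compl_ball_subset hΩ.isBounded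
      refine (hΩ.isBounded.union
        (Metric.isBounded_ball.subset (h.fill_subset_ball hR hk))).subset fun z hz => ?_
      by_cases hzΩ : z ∈ Ω
      · exact Or.inl hzΩ
      · exact Or.inr (hD.inter_compl ▸ ⟨hz, hzΩ⟩)
    obtain ⟨h1, h2⟩ := hD.jordan.cauchyIntegral_of_isBounded hDb
    rw [Finset.sum_eq_single k]
    · rw [hint k 1 fun z hz => by rw [h1 z (hin z hz)]; simp, one_mul]
    · intro l _ hl
      rw [hint l 0 fun z hz => by rw [h2 z (hout l hl z hz)]; simp, zero_mul, mul_zero]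
    · simp

end IsBoundaryLabelling

/-! ### Potentials with values in `[0, ∞]` -/

/-- The logarithmic kernel, truncated at distance `D` and with its true value `∞` at the origin. -/
noncomputable def logKernel (D : ℝ) (x : ℂ) : ENNReal :=
  if x = 0 then ⊤ else ENNReal.ofReal (logBump D x)

/-- The potential of a measure with respect to the truncated logarithmic kernel. -/
noncomputable def truncatedPotential (D : ℝ) (μ : Measure ℂ) (w : ℂ) : ENNReal :=
  ∫⁻ z, logKernel D (w - z) ∂μ

theorem logKernel_zero (D : ℝ) : logKernel D 0 = ⊤ := if_pos rfl

theorem logKernel_of_ne {D : ℝ} {x : ℂ} (hx : x ≠ 0) :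
    logKernel D x = ENNReal.ofReal (logBump D x) := if_neg hx

theorem logKernel_neg (D : ℝ) (x : ℂ) : logKernel D (-x) = logKernel D x := by
  simp only [logKernel, logBump, norm_neg, neg_eq_zero]

theorem measurable_logKernel (D : ℝ) : Measurable (logKernel D) :=
  Measurable.ite (measurableSet_singleton 0) measurable_const
    (measurable_logBump D).ennreal_ofReal

theorem measurable_logKernel_sub (D : ℝ) : Measurable fun p : ℂ × ℂ => logKernel D (p.1 - p.2) :=
  (measurable_logKernel D).comp (measurable_fst.sub measurable_snd)

theorem measurable_truncatedPotential (D : ℝ) (μ : Measure ℂ) [SFinite μ] :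
    Measurable (truncatedPotential D μ) :=
  (measurable_logKernel_sub D).lintegral_prod_right'

theorem lintegral_truncatedPotential_comm (D : ℝ) (μ ν : Measure ℂ) [SFinite μ] [SFinite ν] :
    ∫⁻ w, truncatedPotential D μ w ∂ν = ∫⁻ w, truncatedPotential D ν w ∂μ := by
  unfold truncatedPotential
  rw [lintegral_lintegral_swap (measurable_logKernel_sub D).aemeasurable]
  refine lintegral_congr fun z => lintegral_congr fun w => ?_
  rw [← logKernel_neg, neg_sub]

theorem logBump_eq_log_sub {D : ℝ} (hD : 0 < D) {x : ℂ} (hx : x ≠ 0) (h : ‖x‖ ≤ D) :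
    logBump D x = Real.log D - Real.log ‖x‖ := by
  rw [logBump_eq_log_max_sub hD hx, max_eq_left h]

/-- With the value `∞` at the origin the kernel is continuous into `[0, ∞]`, so potentials make
sense at every point of the plane, also on the support. -/
theorem continuous_logKernel {D : ℝ} (hD : 0 < D) : Continuous (logKernel D) := by
  refine continuous_iff_continuousAt.mpr fun x => ?_
  by_cases hx : x = 0
  · subst hx
    rw [ContinuousAt, logKernel_zero, ENNReal.tendsto_nhds_top_iff_nnreal]
    intro c
    have h1 : ∀ᶠ x : ℂ in 𝓝 0, ‖x‖ < D * Real.exp (-(c + 1)) := by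
      have : Tendsto (fun x : ℂ => ‖x‖) (𝓝 0) (𝓝 0) := by simpa using tendsto_norm (x := (0 : ℂ))
      exact this.eventually_lt_const (by positivity)
    filter_upwards [h1] with x hx
    by_cases hx0 : x = 0
    · rw [hx0, logKernel_zero]
      exact ENNReal.coe_lt_top
    have hxp := norm_pos_iff.mpr hx0
    have h2 : ‖x‖ ≤ D := hx.le.trans (mul_le_of_le_one_right hD.le
      (Real.exp_le_one_iff.mpr (by linarith [c.coe_nonneg])))
    rw [logKernel_of_ne hx0, logBump_eq_log_sub hD hx0 h2, ENNReal.lt_ofReal_iff_toReal_lt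
      ENNReal.coe_ne_top]
    have h3 := Real.log_lt_log hxp hx
    rw [Real.log_mul hD.ne' (Real.exp_pos _).ne', Real.log_exp] at h3
    simp only [ENNReal.coe_toReal]
    linarith
  · have hev : logKernel D =ᶠ[𝓝 x] fun x =>
        ENNReal.ofReal (Real.log (max D ‖x‖) - Real.log ‖x‖) := by
      filter_upwards [isOpen_ne.mem_nhds hx] with z hz
      rw [logKernel_of_ne hz, logBump_eq_log_max_sub hD hz]
    refine ContinuousAt.congr ?_ hev.symm
    refine ENNReal.continuous_ofReal.continuousAt.comp (ContinuousAt.sub ?_ ?_)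
    · exact (continuousAt_const.max continuous_norm.continuousAt).log (by positivity)
    · exact continuous_norm.continuousAt.log (norm_ne_zero_iff.mpr hx)

/-- If `D` exceeds all distances involved, truncation only adds `log D` times the mass. This shift
is why comparisons of truncated potentials carry additive constants. -/
theorem truncatedPotential_eq_ofReal {μ : Measure ℂ} [IsFiniteMeasure μ] {T : Set ℂ}
    (hT : IsCompact T) (hμ : μ Tᶜ = 0) {w : ℂ} (hw : w ∉ T) {D : ℝ} (hD : 0 < D)
    (h : ∀ z ∈ T, ‖w - z‖ ≤ D) :
    truncatedPotential D μ w = ENNReal.ofReal (logPotential μ w + Real.log D * μ.real univ) ∧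
      0 ≤ logPotential μ w + Real.log D * μ.real univ := by
  have hae : ∀ᵐ z ∂μ, z ∈ T := by
    filter_upwards [compl_mem_ae_iff.mpr hμ] with z hz
    rwa [compl_compl] at hz
  have hi := integrable_log_norm_sub hT hμ hw
  have h0 : ∀ᵐ z ∂μ, 0 ≤ Real.log D - Real.log ‖w - z‖ := hae.mono fun z hz =>
    sub_nonneg.mpr (Real.log_le_log (norm_pos_iff.mpr (sub_ne_zero.mpr fun he => hw (he ▸ hz)))
      (h z hz))
  have e : ∫ z, (Real.log D - Real.log ‖w - z‖) ∂μ =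
      logPotential μ w + Real.log D * μ.real univ := by
    rw [integral_sub (integrable_const _) hi, logPotential_eq_neg, integral_const, smul_eq_mul]
    ring
  have hi' : Integrable (fun z => Real.log D - Real.log ‖w - z‖) μ := (integrable_const _).sub hi
  rw [← e]
  refine ⟨?_, integral_nonneg_of_ae h0⟩
  rw [ofReal_integral_eq_lintegral_ofReal hi' h0]
  refine lintegral_congr_ae (hae.mono fun z hz => ?_)
  have hne : w - z ≠ 0 := sub_ne_zero.mpr fun he => hw (he ▸ hz)
  simp only [logKernel_of_ne hne, logBump_eq_log_sub hD hne (h z hz)]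

/-! ### Extending inequalities between potentials to the boundary -/

/-- The uniform probability measure on `(r / 2, r]`. -/
noncomputable def uniformRadius (r : ℝ) : Measure ℝ :=
  ENNReal.ofReal (2 / r) • volume.restrict (Ioc (r / 2) r)

theorem isProbabilityMeasure_uniformRadius {r : ℝ} (hr : 0 < r) :
    IsProbabilityMeasure (uniformRadius r) := ⟨by
  rw [uniformRadius, Measure.smul_apply, Measure.restrict_apply_univ, Real.volume_Ioc, smul_eq_mul,
    ← ENNReal.ofReal_mul (by positivity)]
  rw [show 2 / r * (r - r / 2) = 1 by field_simp; ring, ENNReal.ofReal_one]⟩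

theorem ae_uniformRadius_mem (r : ℝ) : ∀ᵐ s ∂uniformRadius r, s ∈ Ioc (r / 2) r :=
  Measure.ae_smul_measure (ae_restrict_mem measurableSet_Ioc) _

theorem lintegral_uniformRadius_le {r : ℝ} (hr : 0 < r) {f : ℝ → ENNReal} {c : ENNReal}
    (h : ∀ᵐ s ∂uniformRadius r, f s ≤ c) : ∫⁻ s, f s ∂uniformRadius r ≤ c := by
  have := isProbabilityMeasure_uniformRadius hr
  refine (lintegral_mono_ae h).trans ?_
  simp

theorem le_lintegral_uniformRadius {r : ℝ} (hr : 0 < r) {f : ℝ → ENNReal} {c : ENNReal}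
    (h : ∀ᵐ s ∂uniformRadius r, c ≤ f s) : c ≤ ∫⁻ s, f s ∂uniformRadius r := by
  have := isProbabilityMeasure_uniformRadius hr
  refine le_trans ?_ (lintegral_mono_ae h)
  simp

/-- A majorant independent of `r`, for dominated convergence. If `‖y - t‖ ≤ 2 * r`, then `‖k s - t‖
≥ |‖y - t‖ - s|` reduces the average to a logarithmic integral over an interval of length `r / 2`;
the 8 arises from `2 / (r / 2) = 8 / (2 * r)`. Otherwise `‖k s - t‖ ≥ ‖y - t‖ / 2`. -/
theorem lintegral_logKernel_uniformRadius_le {D r : ℝ} (hr : 0 < r) (hD : 2 * r + r ≤ D) {y : ℂ}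
    {k : ℝ → ℂ} (hk : ∀ s ∈ Icc (r / 2) r, ‖k s - y‖ = s) (t : ℂ) :
    ∫⁻ s, logKernel D (k s - t) ∂uniformRadius r ≤
      logKernel D (y - t) + ENNReal.ofReal (Real.log 8 + 1) := by
  have hD0 : 0 < D := by linarith
  by_cases hty : y - t = 0
  · rw [hty, logKernel_zero, top_add]
    exact le_top
  set u := ‖y - t‖ with hu
  have hu0 : 0 < u := norm_pos_iff.mpr hty
  have hrev : ∀ s ∈ Ioc (r / 2) r, |u - s| ≤ ‖k s - t‖ := fun s hs => by
    have h1 := abs_norm_sub_norm_le (t - y) (k s - y)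
    rwa [show t - y - (k s - y) = -(k s - t) by ring, norm_neg, norm_sub_rev t y,
      hk s (Ioc_subset_Icc_self hs)] at h1
  rw [logKernel_of_ne hty, ← ENNReal.ofReal_add (logBump_nonneg _ _)
    (by have := Real.log_nonneg (show (1 : ℝ) ≤ 8 by norm_num); linarith)]
  rcases le_or_gt u (2 * r) with h | h
  · -- near the measure: average the logarithm
    have hle : ∀ᵐ s ∂uniformRadius r, logKernel D (k s - t) ≤
        ENNReal.ofReal (Real.log D - Real.log (u - s)) := by
      have hne : ∀ᵐ s ∂uniformRadius r, s ≠ u :=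
        Measure.ae_smul_measure (ae_restrict_of_ae (Measure.ae_ne volume u)) _
      filter_upwards [ae_uniformRadius_mem r, hne] with s hs hsu
      have h1 : 0 < |u - s| := abs_pos.mpr (sub_ne_zero.mpr hsu.symm)
      have h2 := hrev s hs
      have h3 : k s - t ≠ 0 := norm_pos_iff.mp (h1.trans_le h2)
      have h4 : ‖k s - t‖ ≤ D := by
        have : k s - t = (k s - y) + (y - t) := by ring
        rw [this]
        refine (norm_add_le _ _).trans ?_
        rw [hk s (Ioc_subset_Icc_self hs)]
        linarith [hs.2]
      rw [logKernel_of_ne h3, logBump_eq_log_sub hD0 h3 h4, ← Real.log_abs (u - s)]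
      exact ENNReal.ofReal_le_ofReal (by linarith [Real.log_le_log h1 h2])
    refine (lintegral_mono_ae hle).trans ?_
    have hrr : r / 2 ≤ r := by linarith
    have hii := intervalIntegrable_log_sub u (r / 2) r
    have hio : Integrable (fun s => Real.log D - Real.log (u - s))
        (volume.restrict (Ioc (r / 2) r)) := by
      rw [intervalIntegrable_iff_integrableOn_Ioc_of_le hrr] at hii
      exact (integrable_const _).sub hii
    have h0 : ∀ᵐ s ∂volume.restrict (Ioc (r / 2) r), 0 ≤ Real.log D - Real.log (u - s) := by
      filter_upwards [ae_restrict_mem measurableSet_Ioc,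
        ae_restrict_of_ae (Measure.ae_ne volume u)] with s hs hsu
      rw [← Real.log_abs (u - s)]
      refine sub_nonneg.mpr (Real.log_le_log (abs_pos.mpr (sub_ne_zero.mpr hsu.symm)) ?_)
      rw [abs_le]
      exact ⟨by linarith [hs.2], by linarith [hs.1]⟩
    rw [uniformRadius, lintegral_smul_measure, ← ofReal_integral_eq_lintegral_ofReal hio h0,
      smul_eq_mul, ← ENNReal.ofReal_mul (by positivity)]
    refine ENNReal.ofReal_le_ofReal ?_
    rw [← intervalIntegral.integral_of_le hrr, intervalIntegral.integral_sub (by simp) hii,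
      intervalIntegral.integral_const, smul_eq_mul]
    have h1 := neg_integral_log_sub_le u (show r / 2 < r by linarith)
    rw [show r - r / 2 = r / 2 by ring] at h1 ⊢
    have h2 : logBump D (y - t) = Real.log D - Real.log u :=
      logBump_eq_log_sub hD0 hty (by linarith)
    have h3 : Real.log u ≤ Real.log (2 * r) := Real.log_le_log hu0 h
    have h4 : Real.log (2 / (r / 2)) = Real.log 8 - Real.log (2 * r) := by
      rw [← Real.log_div (by norm_num) (by positivity)]
      congr 1
      field_simp
      norm_num
    rw [h2]
    calc 2 / r * (r / 2 * Real.log D - ∫ s in r / 2..r, Real.log (u - s))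
        ≤ 2 / r * (r / 2 * Real.log D + r / 2 * (Real.log (2 / (r / 2)) + 1)) := by
          gcongr
          linarith
      _ = Real.log D + (Real.log 8 - Real.log (2 * r) + 1) := by
          rw [h4]
          field_simp
      _ ≤ Real.log D - Real.log u + (Real.log 8 + 1) := by linarith
  · refine lintegral_uniformRadius_le hr ?_
    filter_upwards [ae_uniformRadius_mem r] with s hs
    have h1 : u / 2 ≤ ‖k s - t‖ := by
      refine le_trans ?_ (hrev s hs)
      rw [abs_of_pos (by linarith [hs.2])]
      linarith [hs.2]
    have h2 : k s - t ≠ 0 := norm_pos_iff.mp ((half_pos hu0).trans_le h1)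
    rw [logKernel_of_ne h2]
    refine ENNReal.ofReal_le_ofReal ?_
    have h3 : logBump D (k s - t) ≤ Real.posLog (2 * (D / u)) := by
      refine Real.posLog_le_posLog (by positivity) ?_
      rw [show 2 * (D / u) = D / (u / 2) by field_simp]
      exact div_le_div_of_nonneg_left hD0.le (half_pos hu0) h1
    have h4 := Real.posLog_mul (x := 2) (y := D / u)
    have h5 : Real.posLog 2 ≤ Real.log 8 := by
      rw [Real.posLog_eq_log (by norm_num)]
      exact Real.log_le_log (by norm_num) (by norm_num)
    have h6 : logBump D (y - t) = Real.posLog (D / u) := rfl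
    rw [h6]
    linarith

/-- A path in `Ω` from a point very close to `y` out to `q` crosses all the circles, and its image
is compact, so a measurable choice exists. -/
theorem exists_selection_of_isConnected {Ω : Set ℂ} (hΩ : IsOpen Ω) (hc : IsConnected Ω) {y q : ℂ}
    (hy : y ∈ closure Ω) (hq : q ∈ Ω) {r : ℝ} (hr : 0 < r) (hrq : r ≤ ‖q - y‖) :
    ∃ k : ℝ → ℂ, Measurable k ∧ ∀ s ∈ Icc (r / 2) r, k s ∈ Ω ∧ ‖k s - y‖ = s := by
  obtain ⟨p, hp, hpy⟩ := Metric.mem_closure_iff.mp hy (r / 2) (half_pos hr)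
  have hpath := ((hΩ.isConnected_iff_isPathConnected).mp hc).joinedIn p hp q hq
  have hT : IsCompact (range hpath.somePath) := isCompact_range hpath.somePath.continuous
  have hTc : IsPreconnected (range hpath.somePath) := isPreconnected_range hpath.somePath.continuous
  have hTΩ : range hpath.somePath ⊆ Ω := range_subset_iff.mpr hpath.somePath_mem
  obtain ⟨k, hk, h⟩ := exists_measurable_selection_spheres hT.isClosed (z₀ := y) (half_pos hr).le
    (b := r) fun s hs => by
      have := hTc.intermediate_value (⟨0, hpath.somePath.source⟩ : p ∈ range hpath.somePath)
        (⟨1, hpath.somePath.target⟩ : q ∈ range hpath.somePath) (f := fun z => ‖z - y‖)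
        (by fun_prop)
      obtain ⟨z, hz, he⟩ := this (show s ∈ Icc ‖p - y‖ ‖q - y‖ from
        ⟨by rw [dist_comm, dist_eq_norm] at hpy; linarith [hs.1], hs.2.trans hrq⟩)
      exact ⟨z, hz, he⟩
  exact ⟨k, hk, fun s hs => ⟨hTΩ (h s hs).1, (h s hs).2⟩⟩

/-- An inequality between potentials on a domain extends to its boundary points. -/
theorem truncatedPotential_add_le_of_mem_closure {Ω : Set ℂ} (hΩ : IsOpen Ω) (hc : IsConnected Ω)
    {y : ℂ} (hy : y ∈ closure Ω) (hyΩ : y ∉ Ω) {D : ℝ} (hD : 0 < D) {A B : Measure ℂ}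
    [IsFiniteMeasure A] [IsFiniteMeasure B] {a b : ENNReal} (ha : a ≠ ⊤)
    (h : ∀ w ∈ Ω, truncatedPotential D A w + a ≤ truncatedPotential D B w + b) :
    truncatedPotential D A y + a ≤ truncatedPotential D B y + b := by
  by_cases hB : truncatedPotential D B y = ⊤
  · rw [hB, top_add]
    exact le_top
  obtain ⟨q, hq⟩ := hc.nonempty
  have hqy : 0 < ‖q - y‖ := norm_pos_iff.mpr (sub_ne_zero.mpr fun he => hyΩ (he ▸ hq))
  -- The circles must separate `y` from `q`, and the majorant needs `3 * r ≤ D`.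
  set r₀ : ℝ := min ‖q - y‖ (D / 3) with hr₀
  have hr₀0 : 0 < r₀ := lt_min hqy (by positivity)
  set r : ℕ → ℝ := fun n => r₀ / (n + 1) with hr
  have hr0 : ∀ n, 0 < r n := fun n => by positivity
  have hrr₀ : ∀ n, r n ≤ r₀ := fun n => div_le_self hr₀0.le (by simp)
  have hrD : ∀ n, 2 * r n + r n ≤ D := fun n => by
    have := (hrr₀ n).trans (min_le_right _ _)
    linarith
  have hrlim : Tendsto r atTop (𝓝 0) := by
    have := (tendsto_one_div_add_atTop_nhds_zero_nat (𝕜 := ℝ)).const_mul r₀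
    simpa [hr, div_eq_mul_inv] using this
  have hsel := fun n => exists_selection_of_isConnected hΩ hc hy hq (hr0 n)
    ((hrr₀ n).trans (min_le_left _ _))
  choose k hkm hk using hsel
  have hprob : ∀ n, IsProbabilityMeasure (uniformRadius (r n)) := fun n =>
    isProbabilityMeasure_uniformRadius (hr0 n)
  set H : ℕ → ℂ → ENNReal := fun n t => ∫⁻ s, logKernel D (k n s - t) ∂uniformRadius (r n) with hH
  have hjm : ∀ n, Measurable fun p : ℂ × ℝ => logKernel D (k n p.2 - p.1) := fun n =>
    (measurable_logKernel D).comp (((hkm n).comp measurable_snd).sub measurable_fst)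
  have hHm : ∀ n, Measurable (H n) := fun n => (hjm n).lintegral_prod_right'
  have hHlim : ∀ t, Tendsto (fun n => H n t) atTop (𝓝 (logKernel D (y - t))) := by
    intro t
    have hcont : ContinuousAt (logKernel D) (y - t) := (continuous_logKernel hD).continuousAt
    have hnear : ∀ p : ENNReal → Prop, (∀ᶠ x in 𝓝 (y - t), p (logKernel D x)) → ∀ᶠ n in atTop,
        ∀ᵐ s ∂uniformRadius (r n), p (logKernel D (k n s - t)) := by
      intro p hp
      obtain ⟨δ, hδ, hb⟩ := Metric.eventually_nhds_iff.mp hp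
      filter_upwards [hrlim.eventually_lt_const hδ] with n hn
      filter_upwards [ae_uniformRadius_mem (r n)] with s hs
      refine hb ?_
      rw [dist_eq_norm, sub_sub_sub_cancel_right, (hk n s (Ioc_subset_Icc_self hs)).2]
      exact hs.2.trans_lt hn
    refine tendsto_order.mpr ⟨fun c hc' => ?_, fun c hc' => ?_⟩
    · obtain ⟨c', h1, h2⟩ := exists_between hc'
      filter_upwards [hnear (fun x => c' ≤ x) ((hcont.eventually_const_lt h2).mono fun _ => le_of_lt)]
        with n hn
      exact h1.trans_le (le_lintegral_uniformRadius (hr0 n) hn)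
    · obtain ⟨c', h1, h2⟩ := exists_between hc'
      filter_upwards [hnear (fun x => x ≤ c') ((hcont.eventually_lt_const h1).mono fun _ => le_of_lt)]
        with n hn
      exact (lintegral_uniformRadius_le (hr0 n) hn).trans_lt h2
  have hswap : ∀ n (μ : Measure ℂ) [IsFiniteMeasure μ],
      ∫⁻ s, truncatedPotential D μ (k n s) ∂uniformRadius (r n) = ∫⁻ t, H n t ∂μ := by
    intro n μ _
    exact (lintegral_lintegral_swap (hjm n).aemeasurable).symm
  have hineq : ∀ n, ∫⁻ t, H n t ∂A + a ≤ ∫⁻ t, H n t ∂B + b := by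
    intro n
    have e : ∀ c : ENNReal, c = ∫⁻ _s, c ∂uniformRadius (r n) := fun c => by simp
    rw [← hswap n A, ← hswap n B]
    conv_lhs => rw [e a]
    conv_rhs => rw [e b]
    rw [← lintegral_add_right _ measurable_const, ← lintegral_add_right _ measurable_const]
    refine lintegral_mono_ae ?_
    filter_upwards [ae_uniformRadius_mem (r n)] with s hs
    exact h _ (hk n s (Ioc_subset_Icc_self hs)).1
  -- Dominated convergence on the larger side, where the potential at `y` is finite. On the smaller
  -- side Fatou's lemma is enough.
  have hBlim : Tendsto (fun n => ∫⁻ t, H n t ∂B + b) atTop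
      (𝓝 (truncatedPotential D B y + b)) := by
    refine Tendsto.add_const _ (tendsto_lintegral_of_dominated_convergence
      (fun t => logKernel D (y - t) + ENNReal.ofReal (Real.log 8 + 1)) hHm (fun n => ?_) ?_ ?_)
    · exact Eventually.of_forall fun t => lintegral_logKernel_uniformRadius_le (hr0 n) (hrD n)
        (fun s hs => (hk n s hs).2) t
    · rw [lintegral_add_right _ measurable_const, lintegral_const]
      exact ENNReal.add_ne_top.mpr ⟨hB, ENNReal.mul_ne_top ENNReal.ofReal_ne_top
        (measure_ne_top _ _)⟩
    · exact Eventually.of_forall hHlim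
  have hAlim : truncatedPotential D A y ≤ liminf (fun n => ∫⁻ t, H n t ∂A) atTop := by
    refine le_trans (le_of_eq ?_) (lintegral_liminf_le hHm)
    exact lintegral_congr fun t => (hHlim t).liminf_eq.symm
  have haX : a ≤ truncatedPotential D B y + b :=
    ge_of_tendsto' hBlim fun n => le_add_self.trans (hineq n)
  have hsub : truncatedPotential D A y ≤ truncatedPotential D B y + b - a := by
    refine le_of_forall_lt_imp_le_of_dense fun c hc' => ENNReal.le_sub_of_add_le_right ha ?_
    refine ge_of_tendsto hBlim ?_
    filter_upwards [eventually_lt_of_lt_liminf (hc'.trans_le hAlim)] with n hn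
    exact (add_le_add_left hn.le a).trans (hineq n)
  calc truncatedPotential D A y + a ≤ truncatedPotential D B y + b - a + a := by gcongr
    _ = truncatedPotential D B y + b := tsub_add_cancel_of_le haX

/-! ### Balayage and the domination principle -/

theorem meetsSmallCircles_of_mem_interior {S : Set ℂ} {ζ : ℂ} (h : ζ ∈ interior S) :
    MeetsSmallCircles S ζ := by
  obtain ⟨r, hr, hb⟩ := Metric.isOpen_iff.mp isOpen_interior ζ h
  refine ⟨r / 2, half_pos hr, fun s hs => ⟨ζ + s, interior_subset (hb ?_), ?_⟩⟩
  · rw [mem_ball_iff_norm, add_sub_cancel_left, Complex.norm_real, Real.norm_of_nonneg hs.1]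
    linarith [hs.2]
  · rw [add_sub_cancel_left, Complex.norm_real, Real.norm_of_nonneg hs.1]

/-- Balayage: a mass inside a bounded regular open set can be swept to the boundary without changing
its potential outside. -/
theorem exists_balayage {W : Set ℂ} (hW : IsOpen W) (hb : Bornology.IsBounded W)
    (hreg : ∀ ζ ∈ frontier W, MeetsSmallCircles Wᶜ ζ) {x : ℂ} {ρ : ℝ} (hρ : 0 < ρ)
    (hx : Metric.closedBall x ρ ⊆ W) :
    ∃ α β : Measure ℂ, IsFiniteMeasure α ∧ IsFiniteMeasure β ∧ α (Metric.closedBall x ρ)ᶜ = 0 ∧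
      β (frontier W)ᶜ = 0 ∧ α univ = β univ ∧ α univ ≠ 0 ∧
      ∀ z ∉ closure W, logPotential α z = logPotential β z := by
  -- A condenser with the closed disc and the complement of `W` as plates. Its two equilibrium
  -- measures have equal mass, and the vanishing of `U` off `W` says that their potentials agree
  -- there.
  set F : Fin (1 + 1) → Set ℂ := ![Metric.closedBall x ρ, Wᶜ] with hF
  have hF0 : F 0 = Metric.closedBall x ρ := rfl
  have hF1 : F 1 = Wᶜ := rfl
  have hQ : ⋃ k ∈ {k : Fin (1 + 1) | k ≠ 0}, F k = Wᶜ := by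
    ext z
    simp only [mem_iUnion, mem_ofPred_eq, exists_prop]
    constructor
    · rintro ⟨k, hk, hz⟩
      obtain rfl : k = 1 := Fin.eq_one_of_ne_zero k hk
      exact hz
    · exact fun hz => ⟨1, by decide, hz⟩
  have hFc : ∀ k, IsClosed (F k) := fun k => by
    fin_cases k
    exacts [Metric.isClosed_closedBall, hW.isClosed_compl]
  have hFd : Pairwise fun k l => Disjoint (F k) (F l) := by
    have h01 : Disjoint (F 0) (F 1) := disjoint_left.mpr fun z hz hz' => hz' (hx hz)
    intro k l hkl
    fin_cases k <;> fin_cases l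
    exacts [absurd rfl hkl, h01, h01.symm, absurd rfl hkl]
  have hxW : x ∈ W := hx (Metric.mem_closedBall_self hρ.le)
  have hfr1 : frontier (F 1) = frontier W := by rw [hF1, frontier_compl]
  have hfr0 : frontier (F 0) = Metric.sphere x ρ := by rw [hF0, frontier_closedBall x hρ.ne']
  obtain ⟨U, hU⟩ : ∃ U, IsDirichletSolution (F 0) (⋃ k ∈ {k : Fin (1 + 1) | k ≠ 0}, F k) U := by
    rw [hQ]
    refine exists_isDirichletSolution (hFc 0) hW.isClosed_compl (hFd (i := 0) (j := 1) (by decide))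
      (fun ζ hζ => ?_) fun ζ hζ => ?_
    · refine meetsSmallCircles_of_isPreconnected Metric.isPreconnected_closedBall ?_ hζ
      refine ⟨x, Metric.mem_closedBall_self hρ.le, x + ρ, ?_, ?_⟩
      · rw [Metric.mem_closedBall, dist_eq_norm, add_sub_cancel_left, Complex.norm_real,
          Real.norm_of_nonneg hρ.le]
      · simpa using hρ.ne'
    · by_cases hζc : ζ ∈ closure W
      · exact hreg ζ (by rw [hW.frontier_eq]; exact ⟨hζc, hζ⟩)
      · exact meetsSmallCircles_of_mem_interior (by rwa [interior_compl])
  obtain ⟨R, hR⟩ := hb.subset_ball 0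
  obtain ⟨μ, hfin, hμ, hrep, htot⟩ := hU.exists_measures hFc hFd (fun k => by
      fin_cases k
      · exact hfr0 ▸ isCompact_sphere x ρ
      · exact hfr1 ▸ Metric.isCompact_of_isClosed_isBounded isClosed_frontier
          (hb.closure.subset frontier_subset_closure)) (fun k => by
      fin_cases k
      · exact hfr0 ▸ NormedSpace.sphere_nonempty.mpr hρ.le
      · refine hfr1 ▸ nonempty_frontier_iff.mpr ⟨⟨x, hxW⟩, fun hu => ?_⟩
        rw [hu] at hb
        exact NoncompactSpace.noncompact_univ (X := ℂ)
          (Metric.isCompact_of_isClosed_isBounded isClosed_univ hb)) (R := R) fun z hz => by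
      refine hU.eq_zero z (hQ ▸ fun hzW => ?_)
      have := mem_ball_zero_iff.mp (hR hzW)
      linarith
  have hf0 := hfin 0
  have hf1 := hfin 1
  have h10 : componentSign (0 : Fin (1 + 1)) 1 = -1 := componentSign_of_ne (by decide)
  have hsum : ∀ f : Fin (1 + 1) → ℝ, ∑ k, f k = f 0 + f 1 := fun f => Fin.sum_univ_two f
  simp only [hsum, componentSign_self, h10, one_mul, neg_one_mul] at hrep htot
  have hmass : μ 0 univ = μ 1 univ := by
    refine (ENNReal.toReal_eq_toReal_iff' (measure_ne_top _ _) (measure_ne_top _ _)).mp ?_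
    simp only [Measure.real] at htot
    linarith
  refine ⟨μ 0, μ 1, hf0, hf1, ?_, hfr1 ▸ hμ 1, hmass, fun h0 => ?_, fun z hz => ?_⟩
  · refine measure_mono_null (compl_subset_compl.mpr ?_) (hμ 0)
    rw [hfr0]
    exact Metric.sphere_subset_closedBall
  · have h1 := hrep x fun k => by
      fin_cases k
      · change x ∉ frontier (F 0)
        rw [hfr0]
        simpa using hρ.ne
      · change x ∉ frontier (F 1)
        rw [hfr1, hW.frontier_eq]
        exact fun h => h.2 hxW
    have hμ0 : μ 0 = 0 := Measure.measure_univ_eq_zero.mp h0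
    have hμ1 : μ 1 = 0 := Measure.measure_univ_eq_zero.mp (hmass ▸ h0)
    rw [hU.eq_one x (Metric.mem_closedBall_self hρ.le), hμ0, hμ1] at h1
    simp [logPotential] at h1
  · have h1 := hrep z fun k => by
      fin_cases k
      · change z ∉ frontier (F 0)
        exact fun h => hz (subset_closure (hx ((hFc 0).frontier_subset h)))
      · change z ∉ frontier (F 1)
        rw [hfr1]
        exact fun h => hz (frontier_subset_closure h)
    have h2 : U z = 0 := hU.eq_zero z (by rw [hQ]; exact fun h => hz (subset_closure h))
    linarith

theorem continuousAt_truncatedPotential {μ : Measure ℂ} [IsFiniteMeasure μ] {T : Set ℂ}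
    (hT : IsCompact T) (hμ : μ Tᶜ = 0) {w : ℂ} (hw : w ∉ T) {D : ℝ} (hD : 0 < D)
    (h : ∀ᶠ w in 𝓝 w, ∀ z ∈ T, ‖w - z‖ ≤ D) : ContinuousAt (truncatedPotential D μ) w := by
  have h1 : ContinuousAt (logPotential μ) w :=
    (meanValueOn_logPotential hT hμ).continuousOn.continuousAt (hT.isClosed.isOpen_compl.mem_nhds hw)
  refine (ENNReal.continuous_ofReal.continuousAt.comp
    (h1.add (continuousAt_const (y := Real.log D * μ.real univ)))).congr ?_
  filter_upwards [h, hT.isClosed.isOpen_compl.mem_nhds hw] with w' hw' hwT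
  exact (truncatedPotential_eq_ofReal hT hμ hwT hD hw').1.symm

/-- Domination principle: an inequality between potentials of measures on `∂Ω` extends from the
boundary of an open set `W` outside `Ω` to its interior. -/
theorem truncatedPotential_add_le_of_frontier {Ω W : Set ℂ} (hΩ : IsOpen Ω) (hc : IsConnected Ω)
    (hΩb : Bornology.IsBounded Ω) (hW : IsOpen W) (hWb : Bornology.IsBounded W)
    (hreg : ∀ ζ ∈ frontier W, MeetsSmallCircles Wᶜ ζ) (hd : Disjoint Ω (closure W))
    {A B : Measure ℂ} [IsFiniteMeasure A] [IsFiniteMeasure B] (hA : A (frontier Ω)ᶜ = 0)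
    (hB : B (frontier Ω)ᶜ = 0) {D : ℝ} (hD : 0 < D)
    (hdist : ∀ z ∈ closure Ω ∪ closure W, ∀ w ∈ closure Ω ∪ closure W, ‖z - w‖ ≤ D)
    {a b : ENNReal}
    (h : ∀ y ∈ frontier W, truncatedPotential D A y + a ≤ truncatedPotential D B y + b) {x : ℂ}
    (hx : x ∈ W) : truncatedPotential D A x + a ≤ truncatedPotential D B x + b := by
  by_contra! hlt
  obtain ⟨c₁, hc₁, hlt'⟩ := exists_between hlt
  obtain ⟨c₂, hc₁₂, hc₂⟩ := exists_between hlt'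
  have hE : IsCompact (frontier Ω) := Metric.isCompact_of_isClosed_isBounded isClosed_frontier
    (hΩb.closure.subset frontier_subset_closure)
  have hWΩ : Disjoint (closure Ω) W := (hd.mono_right subset_closure).closure_left hW
  have hxE : x ∉ frontier Ω := fun h => disjoint_left.mp hWΩ (frontier_subset_closure h) hx
  have hnear : ∀ᶠ w in 𝓝 x, ∀ z ∈ frontier Ω, ‖w - z‖ ≤ D := by
    filter_upwards [hW.mem_nhds hx] with w hw z hz
    exact hdist w (Or.inr (subset_closure hw)) z (Or.inl (frontier_subset_closure hz))
  have hcA := (continuousAt_truncatedPotential hE hA hxE hD hnear).add (continuousAt_const (y := a))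
  have hcB := (continuousAt_truncatedPotential hE hB hxE hD hnear).add (continuousAt_const (y := b))
  obtain ⟨ρ, hρ, hball⟩ := Metric.nhds_basis_closedBall.eventually_iff.mp
    ((hcA.eventually_const_lt hc₂).and ((hcB.eventually_lt_const hc₁).and (hW.mem_nhds hx)))
  -- A mass `α` on a small disc about `x`, where the inequality fails with the gap between `c₁` and
  -- `c₂`, is swept to `β` on `∂W`.
  obtain ⟨α, β, hα, hβ, hαs, hβs, hmass, hne, hpot⟩ :=
    exists_balayage hW hWb hreg hρ fun z hz => (hball hz).2.2
  have hfW : IsCompact (frontier W) := Metric.isCompact_of_isClosed_isBounded isClosed_frontier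
    (hWb.closure.subset frontier_subset_closure)
  have hreal : α.real univ = β.real univ := by rw [Measure.real, Measure.real, hmass]
  have hΩeq : ∀ w ∈ Ω, truncatedPotential D α w = truncatedPotential D β w := by
    intro w hw
    have hwW : w ∉ closure W := disjoint_left.mp hd hw
    rw [(truncatedPotential_eq_ofReal (isCompact_closedBall x ρ) hαs
        (fun hz => hwW (subset_closure (hball hz).2.2)) hD fun z hz =>
          hdist w (Or.inl (subset_closure hw)) z (Or.inr (subset_closure (hball hz).2.2))).1,
      (truncatedPotential_eq_ofReal hfW hβs (fun hz => hwW (frontier_subset_closure hz)) hD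
        fun z hz => hdist w (Or.inl (subset_closure hw)) z
          (Or.inr (frontier_subset_closure hz))).1, hpot w hwW, hreal]
  -- The potentials of `α` and `β` agree on `Ω`, and this equality persists on `∂Ω`, which carries
  -- `A` and `B`.
  have hEeq : ∀ y ∈ frontier Ω, truncatedPotential D α y = truncatedPotential D β y := by
    intro y hy
    have hyΩ : y ∉ Ω := by
      rw [hΩ.frontier_eq] at hy
      exact hy.2
    have h1 := truncatedPotential_add_le_of_mem_closure hΩ hc (frontier_subset_closure hy) hyΩ hD
      (A := α) (B := β) (a := 0) (b := 0) ENNReal.zero_ne_top fun w hw => by rw [hΩeq w hw]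
    have h2 := truncatedPotential_add_le_of_mem_closure hΩ hc (frontier_subset_closure hy) hyΩ hD
      (A := β) (B := α) (a := 0) (b := 0) ENNReal.zero_ne_top fun w hw => by rw [hΩeq w hw]
    simp only [add_zero] at h1 h2
    exact le_antisymm h1 h2
  -- By symmetry of the kernel, sweeping does not change the integral of the potential of a measure
  -- on `∂Ω`. The inequality on `∂W` therefore holds in the mean over `α`, against the gap.
  have hint : ∀ (M : Measure ℂ) [IsFiniteMeasure M], M (frontier Ω)ᶜ = 0 → ∀ c : ENNReal,
      ∫⁻ w, (truncatedPotential D M w + c) ∂α = ∫⁻ w, (truncatedPotential D M w + c) ∂β := by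
    intro M _ hM c
    rw [lintegral_add_right _ measurable_const, lintegral_add_right _ measurable_const,
      lintegral_truncatedPotential_comm, lintegral_truncatedPotential_comm D M β, lintegral_const,
      lintegral_const, hmass]
    congr 1
    refine lintegral_congr_ae ?_
    filter_upwards [compl_mem_ae_iff.mpr hM] with y hy
    rw [compl_compl] at hy
    exact hEeq y hy
  have hαae : ∀ᵐ w ∂α, w ∈ Metric.closedBall x ρ := by
    filter_upwards [compl_mem_ae_iff.mpr hαs] with w hw
    rwa [compl_compl] at hw
  have hβae : ∀ᵐ w ∂β, w ∈ frontier W := by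
    filter_upwards [compl_mem_ae_iff.mpr hβs] with w hw
    rwa [compl_compl] at hw
  have hchain : c₂ * α univ ≤ c₁ * α univ := by
    calc c₂ * α univ = ∫⁻ _w, c₂ ∂α := (lintegral_const _).symm
      _ ≤ ∫⁻ w, (truncatedPotential D A w + a) ∂α :=
        lintegral_mono_ae (hαae.mono fun w hw => (hball hw).1.le)
      _ = ∫⁻ w, (truncatedPotential D A w + a) ∂β := hint A hA a
      _ ≤ ∫⁻ w, (truncatedPotential D B w + b) ∂β := lintegral_mono_ae (hβae.mono fun w hw => h w hw)
      _ = ∫⁻ w, (truncatedPotential D B w + b) ∂α := (hint B hB b).symm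
      _ ≤ ∫⁻ _w, c₁ ∂α := lintegral_mono_ae (hαae.mono fun w hw => (hball hw).2.1.le)
      _ = c₁ * α univ := lintegral_const _
  exact absurd hchain (not_le.mpr ((ENNReal.mul_lt_mul_iff_left hne (measure_ne_top _ _)).mpr hc₁₂))

/-! ### A potential determines its measure -/

theorem ae_truncatedPotential_lt_top {D : ℝ} (hD : 0 < D) (μ : Measure ℂ) [IsFiniteMeasure μ] :
    ∀ᵐ w, truncatedPotential D μ w < ⊤ := by
  refine ae_lt_top (measurable_truncatedPotential D μ) ?_
  have h1 : ∫⁻ w, truncatedPotential D μ w = ∫⁻ _z, (∫⁻ w, logKernel D w) ∂μ := by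
    unfold truncatedPotential
    rw [lintegral_lintegral_swap (measurable_logKernel_sub D).aemeasurable]
    exact lintegral_congr fun z => lintegral_sub_right_eq_self (logKernel D) z
  have h2 : ∫⁻ w, logKernel D w = ∫⁻ w, ENNReal.ofReal (logBump D w) :=
    lintegral_congr_ae ((Measure.ae_ne volume 0).mono fun w hw => logKernel_of_ne hw)
  rw [h1, lintegral_const, h2]
  refine ENNReal.mul_ne_top ?_ (measure_ne_top _ _)
  rw [← ofReal_integral_eq_lintegral_ofReal (integrable_logBump hD)
    (Eventually.of_forall (logBump_nonneg D))]
  exact ENNReal.ofReal_ne_top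

theorem integral_logBump_sub_eq_toReal {D : ℝ} {μ : Measure ℂ} {w : ℂ}
    (hw : truncatedPotential D μ w < ⊤) :
    ∫ z, logBump D (w - z) ∂μ = (truncatedPotential D μ w).toReal := by
  have hm : Measurable fun z => logKernel D (w - z) :=
    (measurable_logKernel D).comp (measurable_const.sub measurable_id)
  have hm' : Measurable fun z => logBump D (w - z) :=
    (measurable_logBump D).comp (measurable_const.sub measurable_id)
  rw [integral_eq_lintegral_of_nonneg_ae (Eventually.of_forall fun z => logBump_nonneg _ _)
    hm'.aestronglyMeasurable]
  congr 1
  refine lintegral_congr_ae ?_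
  filter_upwards [ae_lt_top hm hw.ne] with z hz
  rw [logKernel_of_ne]
  rintro h0
  rw [h0, logKernel_zero] at hz
  exact lt_irrefl _ hz

theorem meanDefect_eq_zero_of_notMem {φ : ℂ → ℝ} {r : ℝ} (hr : 0 ≤ r) {w : ℂ}
    (hw : w ∉ Metric.cthickening r (tsupport φ)) : meanDefect φ r w = 0 := by
  have h0 : ∀ z ∈ Metric.closedBall w r, φ z = 0 := fun z hz => by
    by_contra hne
    exact hw (Metric.mem_cthickening_of_dist_le w z r _ (subset_tsupport _ hne)
      (by rw [dist_comm]; exact hz))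
  have h1 : Real.circleAverage φ w r = 0 :=
    Real.circleAverage_const_on_circle fun z hz => h0 z (sphere_abs_subset hr subset_rfl hz)
  rw [meanDefect, h1, h0 w (Metric.mem_closedBall_self hr), sub_zero, mul_zero]

/-- On the support of the defect the two kernels differ by the constant `log D`, which the defect
annihilates. -/
theorem integral_meanDefect_mul_logBump {φ : ℂ → ℝ} (hφ : Continuous φ) {R₀ : ℝ}
    (hR₀ : ∀ z, R₀ ≤ ‖z‖ → φ z = 0) {r : ℝ} (hr : 0 < r) {D : ℝ} (hD : 0 < D) {z : ℂ}
    (h : ∀ w ∈ Metric.cthickening r (tsupport φ), ‖w - z‖ ≤ D) :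
    ∫ w, meanDefect φ r w * logBump D (w - z) = ∫ w, meanDefect φ r w * -Real.log ‖w - z‖ := by
  have hdc := continuous_meanDefect hφ r
  have hd0 : ∀ w, R₀ + r ≤ ‖w‖ → meanDefect φ r w = 0 := fun w hw =>
    meanDefect_eq_zero_of_le_norm hR₀ hr.le hw
  have h1 : Integrable fun w => meanDefect φ r w * -Real.log ‖w - z‖ :=
    integrable_continuous_mul hdc hd0 (locallyIntegrable_log_norm_sub z).neg
  have h2 : Integrable fun w => meanDefect φ r w * Real.log D :=
    integrable_continuous_mul hdc hd0 continuous_const.locallyIntegrable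
  have h3 : ∫ w, meanDefect φ r w * Real.log D = 0 := by
    rw [integral_mul_const, integral_meanDefect hφ hR₀ hr, zero_mul]
  have h4 := integral_add h1 h2
  rw [h3, add_zero] at h4
  rw [← h4]
  refine integral_congr_ae ((Measure.ae_ne volume z).mono fun w hw => ?_)
  by_cases hwt : w ∈ Metric.cthickening r (tsupport φ)
  · simp only [logBump_eq_log_sub hD (sub_ne_zero.mpr hw) (h w hwt)]
    ring
  · simp only [meanDefect_eq_zero_of_notMem hr.le hwt, zero_mul, add_zero]

theorem integrable_meanDefect_mul_logBump {φ : ℂ → ℝ} (hφ : Continuous φ) {R₀ : ℝ}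
    (hR₀ : ∀ z, R₀ ≤ ‖z‖ → φ z = 0) {r : ℝ} (hr : 0 < r) {D : ℝ} (hD : 0 < D) (μ : Measure ℂ)
    [IsFiniteMeasure μ] :
    Integrable (fun p : ℂ × ℂ => meanDefect φ r p.1 * logBump D (p.1 - p.2)) (volume.prod μ) := by
  have h1 : Integrable (fun p : ℂ × ℂ => (1 : ℝ) * logBump D (p.1 - p.2)) (volume.prod μ) :=
    (integrable_const (1 : ℝ)).convolution_integrand (ContinuousLinearMap.mul ℝ ℝ)
      (integrable_logBump hD)
  have hdc := continuous_meanDefect hφ r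
  have hcs : HasCompactSupport (meanDefect φ r) :=
    HasCompactSupport.intro (isCompact_closedBall (0 : ℂ) (R₀ + r)) fun w hw =>
      meanDefect_eq_zero_of_le_norm hR₀ hr.le (by
        rw [mem_closedBall_zero_iff, not_le] at hw
        exact hw.le)
  obtain ⟨M, hM⟩ := hcs.exists_bound_of_continuous hdc
  simp only [one_mul] at h1
  exact h1.bdd_mul (c := M) (hdc.comp continuous_fst).aestronglyMeasurable
    (Eventually.of_forall fun p => hM p.1)

/-- Measures whose potentials differ by a constant on an open set agree there. -/
theorem integral_eq_of_truncatedPotential_add_eq {A B : Measure ℂ} [IsFiniteMeasure A]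
    [IsFiniteMeasure B] {T N : Set ℂ} (hA : A Tᶜ = 0) (hB : B Tᶜ = 0) (hN : IsOpen N) {D : ℝ}
    (hD : 0 < D) (hdist : ∀ w ∈ N, ∀ z ∈ T, ‖w - z‖ ≤ D) {a b : ENNReal} (ha : a ≠ ⊤) (hb : b ≠ ⊤)
    (h : ∀ w ∈ N, truncatedPotential D A w + a = truncatedPotential D B w + b) {φ : ℂ → ℝ}
    (hφ : Continuous φ) (hc : HasCompactSupport φ) (hφN : tsupport φ ⊆ N) :
    ∫ z, φ z ∂A = ∫ z, φ z ∂B := by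
  obtain ⟨δ, hδ, hδN⟩ := IsCompact.exists_cthickening_subset_open hc hN hφN
  obtain ⟨M, hM⟩ := hc.exists_bound_of_continuous hφ
  obtain ⟨R₀, hR⟩ := IsCompact.isBounded hc |>.subset_ball 0
  have hR₀ : ∀ z, R₀ ≤ ‖z‖ → φ z = 0 := fun z hz => by
    by_contra hne
    have := mem_ball_zero_iff.mp (hR (subset_tsupport _ hne))
    linarith
  -- `G r` is the average of `φ` against a normalized bump: it is bounded by `3 * M` and tends to
  -- `φ`.
  set G : ℝ → ℂ → ℝ := fun r z => ∫ w, meanDefect φ r w * -Real.log ‖w - z‖ with hG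
  have hrange : ∀ᶠ r : ℝ in 𝓝[>] 0, 0 < r ∧ r ≤ δ := by
    filter_upwards [Ioc_mem_nhdsGT hδ] with r hr using hr
  have hGbump : ∀ r, 0 < r → r ≤ δ → ∀ z ∈ T,
      ∫ w, meanDefect φ r w * logBump D (w - z) = G r z := fun r hr hrδ z hz =>
    integral_meanDefect_mul_logBump hφ hR₀ hr hD fun w hw =>
      hdist w (hδN (Metric.cthickening_mono hrδ _ hw)) z hz
  have hGle : ∀ r, 0 < r → ∀ z, ‖G r z‖ ≤ 3 * M := by
    intro r hr z
    have h1 := abs_average_logBump_sub_le (z := z) hr (integrable_mul_logBump hφ hR₀ hr z)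
      (ε := 2 * M) fun w _ => by
        have := abs_sub (φ w) (φ z)
        have := hM w
        have := hM z
        rw [Real.norm_eq_abs] at *
        linarith
    have e : G r z = ((∫ x, logBump 1 x) * r ^ 2)⁻¹ * ∫ w, φ w * logBump r (w - z) := by
      rw [← integral_sub_circleAverage_mul_neg_log hφ hR₀ hr, ← integral_const_mul]
      simp only [hG, meanDefect, mul_assoc]
    rw [← e] at h1
    have h2 := hM z
    rw [Real.norm_eq_abs] at h2 ⊢
    have := abs_sub_abs_le_abs_sub (G r z) (φ z)
    linarith
  have hlim : ∀ (μ : Measure ℂ) [IsFiniteMeasure μ], μ Tᶜ = 0 →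
      Tendsto (fun r => ∫ z, G r z ∂μ) (𝓝[>] 0) (𝓝 (∫ z, φ z ∂μ)) := by
    intro μ _ hμ
    refine tendsto_integral_filter_of_dominated_convergence (fun _ => 3 * M) ?_ ?_
      (integrable_const _) (Eventually.of_forall fun z =>
        tendsto_integral_meanDefect_mul_neg_log hφ hR₀ z)
    · filter_upwards [hrange] with r hr
      refine ((integrable_meanDefect_mul_logBump hφ hR₀ hr.1 hD μ).integral_prod_right
        ).aestronglyMeasurable.congr ?_
      filter_upwards [compl_mem_ae_iff.mpr hμ] with z hz
      rw [compl_compl] at hz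
      exact hGbump r hr.1 hr.2 z hz
    · filter_upwards [hrange] with r hr
      exact Eventually.of_forall (hGle r hr.1)
  -- Fubini pairs the defect of `φ` with the potential of the measure. The defect has integral 0, so
  -- any constant may be added; this absorbs `a` and `b`.
  have hfub : ∀ (μ : Measure ℂ) [IsFiniteMeasure μ], μ Tᶜ = 0 → ∀ r, 0 < r → r ≤ δ →
      ∀ c : ℝ, ∫ z, G r z ∂μ = ∫ w, meanDefect φ r w * (∫ z, logBump D (w - z) ∂μ + c) := by
    intro μ _ hμ r hr hrδ c
    have hi := integrable_meanDefect_mul_logBump hφ hR₀ hr hD μ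
    have h1 : ∫ z, G r z ∂μ = ∫ z, (∫ w, meanDefect φ r w * logBump D (w - z)) ∂μ := by
      refine integral_congr_ae ?_
      filter_upwards [compl_mem_ae_iff.mpr hμ] with z hz
      rw [compl_compl] at hz
      exact (hGbump r hr hrδ z hz).symm
    have h2 : Integrable fun w => meanDefect φ r w * ∫ z, logBump D (w - z) ∂μ := by
      simpa only [integral_const_mul] using hi.integral_prod_left
    have h3 : Integrable fun w => meanDefect φ r w * c :=
      integrable_continuous_mul (continuous_meanDefect hφ r)
        (fun w hw => meanDefect_eq_zero_of_le_norm hR₀ hr.le hw) continuous_const.locallyIntegrable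
    simp only [mul_add]
    have h4 := integral_integral_swap (f := fun w z => meanDefect φ r w * logBump D (w - z)) hi
    rw [h1, ← h4, integral_add h2 h3, integral_mul_const,
      integral_meanDefect hφ hR₀ hr, zero_mul, add_zero]
    simp only [integral_const_mul]
  refine tendsto_nhds_unique ((hlim A hA).congr' ?_) (hlim B hB)
  filter_upwards [hrange] with r hr
  rw [hfub A hA r hr.1 hr.2 a.toReal, hfub B hB r hr.1 hr.2 b.toReal]
  refine integral_congr_ae ?_
  filter_upwards [ae_truncatedPotential_lt_top hD A, ae_truncatedPotential_lt_top hD B] with w hwA hwB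
  by_cases hw : w ∈ Metric.cthickening r (tsupport φ)
  · have h1 := h w (hδN (Metric.cthickening_mono hr.2 _ hw))
    rw [integral_logBump_sub_eq_toReal hwA, integral_logBump_sub_eq_toReal hwB,
      ← ENNReal.toReal_add hwA.ne ha, ← ENNReal.toReal_add hwB.ne hb, h1]
  · simp only [meanDefect_eq_zero_of_notMem hr.1.le hw, zero_mul]

/-- A cut-off equal to 1 on `E` and supported in `N` localizes an arbitrary test function, since
neither measure charges `N` outside `E`. -/
theorem restrict_eq_of_truncatedPotential_add_eq {A B : Measure ℂ} [IsFiniteMeasure A]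
    [IsFiniteMeasure B] {T N E : Set ℂ} (hA : A Tᶜ = 0) (hB : B Tᶜ = 0) (hN : IsOpen N) {D : ℝ}
    (hD : 0 < D) (hdist : ∀ w ∈ N, ∀ z ∈ T, ‖w - z‖ ≤ D) {a b : ENNReal} (ha : a ≠ ⊤) (hb : b ≠ ⊤)
    (h : ∀ w ∈ N, truncatedPotential D A w + a = truncatedPotential D B w + b) (hE : IsCompact E)
    (hEN : E ⊆ N) (hT : T ∩ N ⊆ E) : A.restrict E = B.restrict E := by
  obtain ⟨δ, hδ, hδN⟩ := hE.exists_cthickening_subset_open hN hEN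
  obtain ⟨χ, hχ, hχc, hχ1, hχ0⟩ := exists_contDiff_bump hE
    (T := (Metric.thickening δ E)ᶜ) Metric.isOpen_thickening.isClosed_compl
    (disjoint_left.mpr fun z hz hz' => hz' (Metric.self_subset_thickening hδ E hz))
  have hsup : tsupport χ ⊆ N := by
    refine (closure_minimal (fun z hz => ?_) Metric.isClosed_cthickening).trans hδN
    by_contra hz'
    exact hz (hχ0 z fun hzt => hz' (Metric.thickening_subset_cthickening _ _ hzt))
  have hres : ∀ (μ : Measure ℂ), μ Tᶜ = 0 → ∀ f : ℂ → ℝ,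
      ∫ z, f z ∂(μ.restrict E) = ∫ z, f z * χ z ∂μ := by
    intro μ hμ f
    rw [← integral_indicator hE.measurableSet]
    refine integral_congr_ae ?_
    filter_upwards [compl_mem_ae_iff.mpr hμ] with z hz
    rw [compl_compl] at hz
    by_cases hzE : z ∈ E
    · rw [indicator_of_mem hzE, hχ1 z hzE, mul_one]
    · rw [indicator_of_notMem hzE, hχ0 z, mul_zero]
      exact fun hzt => hzE (hT ⟨hz, hδN (Metric.thickening_subset_cthickening _ _ hzt)⟩)
  refine ext_of_forall_integral_eq_of_IsFiniteMeasure fun f => ?_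
  rw [hres A hA, hres B hB]
  refine integral_eq_of_truncatedPotential_add_eq hA hB hN hD hdist ha hb h
    (f.continuous.mul hχ.continuous) hχc.mul_left ?_
  exact (closure_mono (Function.support_mul_subset_right _ _)).trans hsup

/-! ### Behaviour at infinity and comparison of logarithmic potentials -/

theorem abs_log_sub_log_le {a b c : ℝ} (ha : 0 < a) (hb : 0 < b) (hc : 0 < c) (hca : c ≤ a)
    (hcb : c ≤ b) : |Real.log a - Real.log b| ≤ |a - b| / c := by
  have key : ∀ x y : ℝ, 0 < x → 0 < y → c ≤ y → Real.log x - Real.log y ≤ |x - y| / c := by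
    intro x y hx hy hcy
    rw [← Real.log_div hx.ne' hy.ne']
    refine (Real.log_le_sub_one_of_pos (div_pos hx hy)).trans ?_
    rw [div_sub_one hy.ne']
    exact (div_le_div_of_nonneg_right (le_abs_self _) hy.le).trans
      (div_le_div_of_nonneg_left (abs_nonneg _) hc hcy)
  refine abs_le.mpr ⟨?_, key a b ha hb hcb⟩
  have := key b a hb ha hca
  rw [abs_sub_comm] at this
  linarith

/-- At infinity a potential behaves like that of a point mass. -/
theorem tendsto_logPotential_add_log {μ : Measure ℂ} [IsFiniteMeasure μ] {T : Set ℂ}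
    (hT : IsCompact T) (hμ : μ Tᶜ = 0) :
    Tendsto (fun w => logPotential μ w + μ.real univ * Real.log ‖w‖) (Bornology.cobounded ℂ)
      (𝓝 0) := by
  obtain ⟨M, hM0, hM⟩ := hT.isBounded.exists_pos_norm_le
  have hlim : Tendsto (fun w : ℂ => M / (‖w‖ - M) * μ.real univ) (Bornology.cobounded ℂ) (𝓝 0) := by
    have h1 : Tendsto (fun z : ℂ => ‖z‖ - M) (Bornology.cobounded ℂ) atTop :=
      tendsto_atTop_add_const_right _ _ tendsto_norm_cobounded_atTop
    simpa using (h1.const_div_atTop M).mul_const (μ.real univ)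
  refine squeeze_zero_norm' ?_ hlim
  filter_upwards [tendsto_norm_cobounded_atTop.eventually_gt_atTop M] with w hw
  have hwT : w ∉ T := fun h => absurd (hM w h) (not_le.mpr hw)
  have hi := integrable_log_norm_sub hT hμ hwT
  have e : logPotential μ w + μ.real univ * Real.log ‖w‖ =
      ∫ z, (Real.log ‖w‖ - Real.log ‖w - z‖) ∂μ := by
    rw [integral_sub (integrable_const _) hi, logPotential_eq_neg, integral_const, smul_eq_mul]
    ring
  rw [e]
  refine norm_integral_le_of_norm_le_const ?_
  filter_upwards [compl_mem_ae_iff.mpr hμ] with z hz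
  rw [compl_compl] at hz
  have hz := hM z hz
  have h1 : ‖w‖ - M ≤ ‖w - z‖ := by linarith [norm_sub_norm_le w z]
  have h2 : 0 < ‖w‖ - M := sub_pos.mpr hw
  rw [Real.norm_eq_abs]
  refine (abs_log_sub_log_le (by linarith) (h2.trans_le h1) h2 (by linarith) h1).trans ?_
  refine div_le_div_of_nonneg_right ?_ h2.le
  have := abs_norm_sub_norm_le w (w - z)
  rw [sub_sub_cancel] at this
  exact this.trans hz

/-- Truncation shifts the two potentials by `log D` times their own masses; adding the other
measure's shift on each side balances this even for unequal masses. -/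
theorem truncatedPotential_add_le_iff {A B : Measure ℂ} [IsFiniteMeasure A] [IsFiniteMeasure B]
    {T : Set ℂ} (hT : IsCompact T) (hA : A Tᶜ = 0) (hB : B Tᶜ = 0) {w : ℂ} (hw : w ∉ T) {D : ℝ}
    (hD : 1 ≤ D) (h : ∀ z ∈ T, ‖w - z‖ ≤ D) {ε : ℝ} (hε : 0 ≤ ε) :
    truncatedPotential D A w + ENNReal.ofReal (Real.log D * B.real univ) ≤
      truncatedPotential D B w + ENNReal.ofReal (Real.log D * A.real univ + ε) ↔
    logPotential A w ≤ logPotential B w + ε := by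
  have hD0 : 0 < D := one_pos.trans_le hD
  have hl := Real.log_nonneg hD
  have hmA : 0 ≤ Real.log D * A.real univ := mul_nonneg hl measureReal_nonneg
  have hmB : 0 ≤ Real.log D * B.real univ := mul_nonneg hl measureReal_nonneg
  obtain ⟨h1, h2⟩ := truncatedPotential_eq_ofReal hT hA hw hD0 h
  obtain ⟨h3, h4⟩ := truncatedPotential_eq_ofReal hT hB hw hD0 h
  rw [h1, h3, ← ENNReal.ofReal_add h2 hmB, ← ENNReal.ofReal_add h4 (by linarith),
    ENNReal.ofReal_le_ofReal_iff (by linarith)]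
  constructor <;> intro h <;> linarith

section Comparison

variable {Ω : Set ℂ} {A B : Measure ℂ} [IsFiniteMeasure A] [IsFiniteMeasure B]

theorem truncatedPotential_add_le_of_logPotential_eq (hΩ : IsOpen Ω) (hc : IsConnected Ω)
    (hΩb : Bornology.IsBounded Ω) (hA : A (frontier Ω)ᶜ = 0) (hB : B (frontier Ω)ᶜ = 0) {D : ℝ}
    (hD : 1 ≤ D) (hdist : ∀ w ∈ closure Ω, ∀ z ∈ closure Ω, ‖w - z‖ ≤ D)
    (hAB : ∀ z ∈ Ω, logPotential A z = logPotential B z) {w : ℂ} (hw : w ∈ closure Ω) :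
    truncatedPotential D A w + ENNReal.ofReal (Real.log D * B.real univ) ≤
      truncatedPotential D B w + ENNReal.ofReal (Real.log D * A.real univ) := by
  have hE : IsCompact (frontier Ω) := Metric.isCompact_of_isClosed_isBounded isClosed_frontier
    (hΩb.closure.subset frontier_subset_closure)
  have hin : ∀ w ∈ Ω, truncatedPotential D A w + ENNReal.ofReal (Real.log D * B.real univ) ≤
      truncatedPotential D B w + ENNReal.ofReal (Real.log D * A.real univ) := fun w hw => by
    have := truncatedPotential_add_le_iff hE hA hB (w := w)
      (fun h => (hΩ.frontier_eq ▸ h).2 hw) hD (fun z hz => hdist w (subset_closure hw) z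
        (frontier_subset_closure hz)) le_rfl
    rw [add_zero, add_zero] at this
    exact this.mpr (hAB w hw).le
  by_cases hwΩ : w ∈ Ω
  · exact hin w hwΩ
  · exact truncatedPotential_add_le_of_mem_closure hΩ hc hw hwΩ (one_pos.trans_le hD)
      ENNReal.ofReal_ne_top hin

/-- Points of `∂W` that lie on `∂Ω` need no hypothesis: the equality on `Ω` extends to them in
truncated form. -/
theorem logPotential_le_add_of_frontier (hΩ : IsOpen Ω) (hc : IsConnected Ω)
    (hΩb : Bornology.IsBounded Ω) {W : Set ℂ} (hW : IsOpen W) (hWb : Bornology.IsBounded W)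
    (hreg : ∀ ζ ∈ frontier W, MeetsSmallCircles Wᶜ ζ) (hd : Disjoint Ω (closure W))
    (hA : A (frontier Ω)ᶜ = 0) (hB : B (frontier Ω)ᶜ = 0)
    (hAB : ∀ z ∈ Ω, logPotential A z = logPotential B z) {ε : ℝ} (hε : 0 ≤ ε)
    (h : ∀ y ∈ frontier W, y ∉ frontier Ω → logPotential A y ≤ logPotential B y + ε) {x : ℂ}
    (hx : x ∈ W) : logPotential A x ≤ logPotential B x + ε := by
  have hE : IsCompact (frontier Ω) := Metric.isCompact_of_isClosed_isBounded isClosed_frontier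
    (hΩb.closure.subset frontier_subset_closure)
  obtain ⟨R, hR⟩ := (hΩb.closure.union hWb.closure).exists_norm_le
  set D := max 1 (2 * R) with hDdef
  have hD : 1 ≤ D := le_max_left _ _
  have hdist : ∀ z ∈ closure Ω ∪ closure W, ∀ w ∈ closure Ω ∪ closure W, ‖z - w‖ ≤ D := by
    intro z hz w hw
    have := norm_sub_le z w
    have := hR z hz
    have := hR w hw
    have := le_max_right 1 (2 * R)
    linarith
  have hxΩ : x ∉ frontier Ω := fun hx' => disjoint_left.mp
    ((hd.mono_right subset_closure).closure_left hW) (frontier_subset_closure hx') hx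
  refine (truncatedPotential_add_le_iff hE hA hB hxΩ hD (fun z hz => hdist x
    (Or.inr (subset_closure hx)) z (Or.inl (frontier_subset_closure hz))) hε).mp ?_
  refine truncatedPotential_add_le_of_frontier hΩ hc hΩb hW hWb hreg hd hA hB
    (one_pos.trans_le hD) hdist (fun y hy => ?_) hx
  by_cases hyΩ : y ∈ frontier Ω
  · refine (truncatedPotential_add_le_of_logPotential_eq hΩ hc hΩb hA hB hD
      (fun z hz w hw => hdist z (Or.inl hz) w (Or.inl hw)) hAB (frontier_subset_closure hyΩ)).trans ?_
    gcongr
    linarith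
  · exact (truncatedPotential_add_le_iff hE hA hB hyΩ hD (fun z hz => hdist y
      (Or.inr (frontier_subset_closure hy)) z (Or.inl (frontier_subset_closure hz))) hε).mpr
      (h y hy hyΩ)

end Comparison

/-! ### Uniqueness of the measures -/

namespace IsBoundaryLabelling

variable {Ω : Set ℂ} {n : ℕ} {Γ K : Fin (n + 1) → Set ℂ}

theorem meetsSmallCircles_boundary (h : IsBoundaryLabelling Ω Γ K) {k : Fin (n + 1)} {ζ : ℂ}
    (hζ : ζ ∈ Γ k) {W : Set ℂ} (hW : W ⊆ interior (K k)) : MeetsSmallCircles Wᶜ ζ := by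
  refine (meetsSmallCircles_of_isPreconnected (isPreconnected_of_mem_componentsOf
    (h.boundary_mem k).1) (h.boundary_mem k).2 hζ).mono fun z hz hzW => ?_
  rw [← h.frontier_eq k] at hz
  exact hz.2 (hW hzW)

theorem frontier_interior_fill_subset (h : IsBoundaryLabelling Ω Γ K) (k : Fin (n + 1)) :
    frontier (interior (K k)) ⊆ Γ k :=
  h.frontier_eq k ▸ frontier_interior_subset

theorem disjoint_closure_interior_fill (h : IsBoundaryLabelling Ω Γ K) (hΩ : IsOpen Ω)
    (k : Fin (n + 1)) : Disjoint Ω (closure (interior (K k))) :=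
  disjoint_left.mpr fun _ hz hz' => h.fill_subset_compl k
    ((h.isClosed_fill hΩ k).closure_interior_subset hz') hz

variable {A B : Measure ℂ} [IsFiniteMeasure A] [IsFiniteMeasure B]

/-- For `k ≠ 0` the domination principle applies to the bounded open set `interior (K k)`, whose
frontier lies in `∂Ω`. For `k = 0` that set is cut off by a large circle. -/
theorem logPotential_le_of_mem_interior_fill (h : IsBoundaryLabelling Ω Γ K)
    (hΩ : IsBoundedFinitelyConnectedDomain Ω) (hA : A (frontier Ω)ᶜ = 0)
    (hB : B (frontier Ω)ᶜ = 0) (hAB : ∀ z ∈ Ω, logPotential A z = logPotential B z)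
    {k : Fin (n + 1)} (hk : k ≠ 0 ∨ A univ = B univ) {x : ℂ} (hx : x ∈ interior (K k)) :
    logPotential A x ≤ logPotential B x := by
  have hd := h.disjoint_closure_interior_fill hΩ.isOpen k
  by_cases hk0 : k = 0
  · subst hk0
    have hmass := hk.resolve_left fun h => h rfl
    refine le_of_forall_pos_le_add fun ε hε => ?_
    have hE : IsCompact (frontier Ω) := Metric.isCompact_of_isClosed_isBounded isClosed_frontier
      (hΩ.isBounded.closure.subset frontier_subset_closure)
    -- Equal masses cancel the logarithmic terms at infinity, so the potentials differ by less than
    -- `ε` on all large circles.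
    have hfar : ∀ᶠ w in Bornology.cobounded ℂ, logPotential A w < logPotential B w + ε := by
      have h1 := (tendsto_logPotential_add_log hE hA).sub (tendsto_logPotential_add_log hE hB)
      rw [sub_zero] at h1
      filter_upwards [h1.eventually_lt_const hε] with w hw
      rw [Measure.real, Measure.real, hmass] at hw
      linarith
    obtain ⟨R, hR⟩ := ((Filter.hasBasis_cobounded_norm (E := ℂ)).eventually_iff).mp hfar
    obtain ⟨-, hR⟩ := hR
    set R' : ℝ := max R (‖x‖ + 1) with hR'
    have hR'0 : 0 < R' := by
      have := norm_nonneg x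
      have := le_max_right R (‖x‖ + 1)
      linarith
    refine logPotential_le_add_of_frontier hΩ.isOpen hΩ.isConnected hΩ.isBounded
      (W := interior (K 0) ∩ Metric.ball 0 R') (isOpen_interior.inter Metric.isOpen_ball)
      (Metric.isBounded_ball.subset inter_subset_right) (fun ζ hζ => ?_)
      (hd.mono_right (closure_mono inter_subset_left)) hA hB hAB hε.le (fun y hy hyΩ => ?_)
      ⟨hx, mem_ball_zero_iff.mpr (by
        have := le_max_right R (‖x‖ + 1)
        linarith)⟩
    · rcases frontier_inter_subset _ _ hζ with hζ | hζ
      · exact h.meetsSmallCircles_boundary (h.frontier_interior_fill_subset 0 hζ.1)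
          inter_subset_left
      · have hζs := Metric.frontier_ball_subset_sphere hζ.2
        refine (meetsSmallCircles_of_isPreconnected (isPreconnected_sphere
          (by rw [Complex.rank_real_complex]; exact Nat.one_lt_ofNat) 0 R') ?_ hζs).mono
          fun z hz hz' => ?_
        · refine ⟨(R' : ℂ), by simp [hR'0.le], -(R' : ℂ), by simp [hR'0.le], fun he => ?_⟩
          have h2 : (R' : ℂ) = 0 := by linear_combination he / 2
          exact hR'0.ne' (by exact_mod_cast h2)
        · exact absurd hz'.2 (by rw [Metric.mem_ball, Metric.mem_sphere.mp hz]; exact lt_irrefl _)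
    · rcases frontier_inter_subset _ _ hy with hy | hy
      · exact absurd (h.boundary_subset_frontier 0 (h.frontier_interior_fill_subset 0 hy.1)) hyΩ
      · have hys := Metric.frontier_ball_subset_sphere hy.2
        refine (hR ?_).le
        rw [mem_sphere_zero_iff_norm] at hys
        show R ≤ ‖y‖
        rw [hys]
        exact le_max_left _ _
  · obtain ⟨R, -, -, hR⟩ := h.exists_compl_ball_subset hΩ.isBounded
    have := logPotential_le_add_of_frontier hΩ.isOpen hΩ.isConnected hΩ.isBounded
      (W := interior (K k)) isOpen_interior
      (Metric.isBounded_ball.subset (interior_subset.trans (h.fill_subset_ball hR hk0)))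
      (fun ζ hζ => h.meetsSmallCircles_boundary (h.frontier_interior_fill_subset k hζ) subset_rfl)
      hd hA hB hAB le_rfl (fun y hy hyΩ => absurd
        (h.boundary_subset_frontier k (h.frontier_interior_fill_subset k hy)) hyΩ) hx
    rwa [add_zero] at this

/-- Measures on `∂Ω` whose potentials agree on `Ω` agree on `Γ k`, if `k ≠ 0` or the masses agree. -/
theorem restrict_boundary_eq (h : IsBoundaryLabelling Ω Γ K)
    (hΩ : IsBoundedFinitelyConnectedDomain Ω) (hA : A (⋃ k, Γ k)ᶜ = 0)
    (hB : B (⋃ k, Γ k)ᶜ = 0) (hAB : ∀ z ∈ Ω, logPotential A z = logPotential B z)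
    {k : Fin (n + 1)} (hk : k ≠ 0 ∨ A univ = B univ) : A.restrict (Γ k) = B.restrict (Γ k) := by
  have hsub : ⋃ k, Γ k ⊆ frontier Ω := iUnion_subset h.boundary_subset_frontier
  have hA' : A (frontier Ω)ᶜ = 0 := measure_mono_null (compl_subset_compl.mpr hsub) hA
  have hB' : B (frontier Ω)ᶜ = 0 := measure_mono_null (compl_subset_compl.mpr hsub) hB
  have hE : IsCompact (frontier Ω) := Metric.isCompact_of_isClosed_isBounded isClosed_frontier
    (hΩ.isBounded.closure.subset frontier_subset_closure)
  obtain ⟨R, hR0, hRΩ, hR⟩ := h.exists_compl_ball_subset hΩ.isBounded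
  set D := max 1 (2 * (R + 1)) with hDdef
  have hD : 1 ≤ D := le_max_left _ _
  have hcl : ∀ z ∈ closure Ω, ‖z‖ ≤ R := fun z hz => mem_closedBall_zero_iff.mp
    (Metric.closure_ball_subset_closedBall (closure_mono hRΩ hz))
  have hdist : ∀ z w : ℂ, ‖z‖ < R + 1 → ‖w‖ ≤ R → ‖z - w‖ ≤ D := fun z w hz hw => by
    have := norm_sub_le z w
    have := le_max_right 1 (2 * (R + 1))
    linarith
  -- A bounded neighbourhood of `Γ k` made up of points of the closure of `Ω` and interior points of
  -- `K k`, where both inequalities are known. The radius `R + 1` leaves room around the closure of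
  -- `Ω`.
  set N : Set ℂ := ((⋃ l ∈ {l | l ≠ k}, K l) ∪ degeneratePoints Ω K)ᶜ ∩ Metric.ball 0 (R + 1)
    with hN
  have hNo : IsOpen N := ((isClosed_iUnion_ne (fun l => h.isClosed_fill hΩ.isOpen l) k).union
    (h.finite_degeneratePoints hΩ).isClosed).isOpen_compl.inter Metric.isOpen_ball
  have hNsub : ∀ w ∈ N, w ∈ closure Ω ∨ w ∈ interior (K k) := by
    intro w hw
    by_cases hwk : w ∈ K k
    · by_cases hwi : w ∈ interior (K k)
      · exact Or.inr hwi
      · refine Or.inl (frontier_subset_closure (h.boundary_subset_frontier k ?_))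
        rw [← h.frontier_eq k]
        exact ⟨subset_closure hwk, hwi⟩
    · refine Or.inl (subset_closure ?_)
      by_contra hwΩ
      refine hw.1 (Or.inr ⟨hwΩ, fun hwK => ?_⟩)
      obtain ⟨l, hl⟩ := mem_iUnion.mp hwK
      refine hw.1 (Or.inl (mem_biUnion (show l ∈ {l | l ≠ k} from fun he => hwk (he ▸ hl)) hl))
  have hle : ∀ (A B : Measure ℂ) [IsFiniteMeasure A] [IsFiniteMeasure B], A (frontier Ω)ᶜ = 0 →
      B (frontier Ω)ᶜ = 0 → (∀ z ∈ Ω, logPotential A z = logPotential B z) →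
      (k ≠ 0 ∨ A univ = B univ) → ∀ w ∈ N,
      truncatedPotential D A w + ENNReal.ofReal (Real.log D * B.real univ) ≤
        truncatedPotential D B w + ENNReal.ofReal (Real.log D * A.real univ) := by
    intro A B _ _ hA hB hAB hk w hw
    rcases hNsub w hw with hwc | hwi
    · exact truncatedPotential_add_le_of_logPotential_eq hΩ.isOpen hΩ.isConnected hΩ.isBounded hA hB
        hD (fun z hz w hw => hdist z w (by linarith [hcl z hz]) (hcl w hw)) hAB hwc
    · have hwf : w ∉ frontier Ω := fun hwf => disjoint_left.mp
        (((h.disjoint_closure_interior_fill hΩ.isOpen k).mono_right subset_closure).closure_left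
          isOpen_interior) (frontier_subset_closure hwf) hwi
      have := truncatedPotential_add_le_iff hE hA hB hwf hD (fun z hz => hdist w z
        (mem_ball_zero_iff.mp hw.2) (hcl z (frontier_subset_closure hz))) le_rfl
      rw [add_zero, add_zero] at this
      exact this.mpr (h.logPotential_le_of_mem_interior_fill hΩ hA hB hAB hk hwi)
  refine restrict_eq_of_truncatedPotential_add_eq hA hB hNo (one_pos.trans_le hD)
    (fun w hw z hz => hdist w z (mem_ball_zero_iff.mp hw.2)
      (hcl z (frontier_subset_closure (hsub hz)))) ENNReal.ofReal_ne_top ENNReal.ofReal_ne_top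
    (fun w hw => le_antisymm (hle A B hA' hB' hAB hk w hw)
      (hle B A hB' hA' (fun z hz => (hAB z hz).symm) (hk.imp id Eq.symm) w hw))
    (h.isCompact_boundary hΩ.isBounded k) (fun z hz => ⟨?_, ?_⟩) fun z hz => ?_
  · have hzk := h.boundary_subset_fill hΩ.isOpen k hz
    rintro (hz' | hz')
    · obtain ⟨l, hl, hzl⟩ := mem_iUnion₂.mp hz'
      exact disjoint_left.mp (h.disjoint_fill hl) hzl hzk
    · exact hz'.2 (mem_iUnion.mpr ⟨k, hzk⟩)
  · have := hcl z (frontier_subset_closure (h.boundary_subset_frontier k hz))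
    exact mem_ball_zero_iff.mpr (by linarith)
  · obtain ⟨l, hl⟩ := mem_iUnion.mp hz.1
    by_cases hlk : l = k
    · exact hlk ▸ hl
    · exact absurd (Or.inl (mem_biUnion (show l ∈ {l | l ≠ k} from hlk)
        (h.boundary_subset_fill hΩ.isOpen l hl))) hz.2.1

/-- The sets `Γ k` are disjoint, so each measure is recovered from the sum by restriction to its own
`Γ k`. -/
theorem eq_of_sum_logPotential_eq (h : IsBoundaryLabelling Ω Γ K)
    (hΩ : IsBoundedFinitelyConnectedDomain Ω) {α β : Fin (n + 1) → Measure ℂ}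
    (hαf : ∀ k, IsFiniteMeasure (α k)) (hβf : ∀ k, IsFiniteMeasure (β k))
    (hα : ∀ k, α k (Γ k)ᶜ = 0) (hβ : ∀ k, β k (Γ k)ᶜ = 0)
    (hsum : ∀ z ∈ Ω, ∑ k, logPotential (α k) z = ∑ k, logPotential (β k) z) {k : Fin (n + 1)}
    (hk : k ≠ 0 ∨ ∑ l, α l univ = ∑ l, β l univ) : α k = β k := by
  have hfin : ∀ {α : Fin (n + 1) → Measure ℂ}, (∀ k, IsFiniteMeasure (α k)) →
      IsFiniteMeasure (∑ k, α k) := fun {α} hα => ⟨by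
    rw [Measure.finsetSum_apply]
    exact ENNReal.sum_lt_top.mpr fun k _ => measure_lt_top _ _⟩
  have hnull : ∀ {α : Fin (n + 1) → Measure ℂ}, (∀ k, α k (Γ k)ᶜ = 0) →
      (∑ k, α k) (⋃ k, Γ k)ᶜ = 0 := fun {α} hα => by
    rw [Measure.finsetSum_apply]
    exact Finset.sum_eq_zero fun k _ =>
      measure_mono_null (compl_subset_compl.mpr (subset_iUnion Γ k)) (hα k)
  have hpot : ∀ {α : Fin (n + 1) → Measure ℂ}, (∀ k, IsFiniteMeasure (α k)) →
      (∀ k, α k (Γ k)ᶜ = 0) → ∀ z ∈ Ω, logPotential (∑ k, α k) z = ∑ k, logPotential (α k) z := by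
    intro α hαf hα z hz
    have hz' : ∀ k, z ∉ Γ k := fun k hk =>
      h.fill_subset_compl k (h.boundary_subset_fill hΩ.isOpen k hk) hz
    simp only [logPotential_eq_neg]
    rw [integral_finsetSum_measure fun k _ => ?_, Finset.sum_neg_distrib]
    have := hαf k
    exact integrable_log_norm_sub (h.isCompact_boundary hΩ.isBounded k) (hα k) (hz' k)
  have hres : ∀ {α : Fin (n + 1) → Measure ℂ}, (∀ k, α k (Γ k)ᶜ = 0) →
      (∑ k, α k).restrict (Γ k) = α k := by
    intro α hα
    refine Measure.ext fun s hs => ?_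
    rw [Measure.restrict_apply hs, Measure.finsetSum_apply, Finset.sum_eq_single k]
    · rw [← Measure.restrict_apply hs, Measure.restrict_eq_self_of_ae_mem (mem_ae_iff.mpr (hα k))]
    · intro l _ hl
      refine measure_mono_null (fun z hz => ?_) (hα l)
      exact fun hzl => disjoint_left.mp (h.disjoint_boundary hΩ.isOpen hl) hzl hz.2
    · simp
  have := hfin hαf
  have := hfin hβf
  rw [← hres hα, ← hres hβ]
  refine h.restrict_boundary_eq hΩ (hnull hα) (hnull hβ) (fun z hz => ?_) (hk.imp id fun hm => ?_)
  · rw [hpot hαf hα z hz, hpot hβf hβ z hz, hsum z hz]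
  · rw [Measure.finsetSum_apply, Measure.finsetSum_apply, hm]

end IsBoundaryLabelling

namespace IsPotentialRepresentation

variable {Ω : Set ℂ} {n : ℕ} {Γ K : Fin (n + 1) → Set ℂ} {j : Fin (n + 1)}
  {μ ν : Fin (n + 1) → Measure ℂ}

theorem measure_compl (hμ : IsPotentialRepresentation Ω Γ j μ) (k : Fin (n + 1)) :
    μ k (Γ k)ᶜ = 0 :=
  measure_mono_null (compl_subset_compl.mpr (hμ.support_subset k)) Measure.measure_compl_support

theorem eq_of_ne_zero (hμ : IsPotentialRepresentation Ω Γ j μ)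
    (hν : IsPotentialRepresentation Ω Γ j ν) (h : IsBoundaryLabelling Ω Γ K)
    (hΩ : IsBoundedFinitelyConnectedDomain Ω) {k : Fin (n + 1)} (hk : k ≠ 0) : ν k = μ k := by
  -- Moving the negative terms across the equality exchanges the `j`-th measures and leaves sums
  -- with plus signs only, that is, potentials of positive measures.
  set α : Fin (n + 1) → Measure ℂ := fun l => if l = j then ν l else μ l with hα
  set β : Fin (n + 1) → Measure ℂ := fun l => if l = j then μ l else ν l with hβ
  have key : α k = β k := by
    refine h.eq_of_sum_logPotential_eq hΩ (fun l => ?_) (fun l => ?_) (fun l => ?_) (fun l => ?_)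
      (fun z hz => ?_) (Or.inl hk)
    · simp only [hα]
      split_ifs
      exacts [hν.finite l, hμ.finite l]
    · simp only [hβ]
      split_ifs
      exacts [hμ.finite l, hν.finite l]
    · simp only [hα]
      split_ifs
      exacts [hν.measure_compl l, hμ.measure_compl l]
    · simp only [hβ]
      split_ifs
      exacts [hμ.measure_compl l, hν.measure_compl l]
    · have h1 := hμ.eq_potential z hz
      rw [hν.eq_potential z hz] at h1
      rw [← Finset.add_sum_erase _ _ (Finset.mem_univ j),
        ← Finset.add_sum_erase (f := fun l => logPotential (β l) z) _ (Finset.mem_univ j)]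
      have e1 : ∑ l ∈ Finset.univ.erase j, logPotential (α l) z =
          ∑ l ∈ Finset.univ.erase j, logPotential (μ l) z := Finset.sum_congr rfl fun l hl => by
        simp only [hα, if_neg (Finset.ne_of_mem_erase hl)]
      have e2 : ∑ l ∈ Finset.univ.erase j, logPotential (β l) z =
          ∑ l ∈ Finset.univ.erase j, logPotential (ν l) z := Finset.sum_congr rfl fun l hl => by
        simp only [hβ, if_neg (Finset.ne_of_mem_erase hl)]
      rw [e1, e2]
      simp only [hα, hβ, if_pos]
      linarith
  simp only [hα, hβ] at key
  split_ifs at key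
  exacts [key, key.symm]

/-- All measures with index different from 0 already coincide, so equality of the masses on `Γ 0` is
equality of the total masses, which settles `Γ 0`. -/
theorem eq_zero_of_mass_eq (hμ : IsPotentialRepresentation Ω Γ j μ)
    (hν : IsPotentialRepresentation Ω Γ j ν) (h : IsBoundaryLabelling Ω Γ K)
    (hΩ : IsBoundedFinitelyConnectedDomain Ω) (hj : j ≠ 0) (hmass : ν 0 univ = μ 0 univ) :
    ν 0 = μ 0 := by
  have hne : ∀ l, l ≠ 0 → ν l = μ l := fun l hl => hμ.eq_of_ne_zero hν h hΩ hl
  refine h.eq_of_sum_logPotential_eq hΩ hν.finite hμ.finite hν.measure_compl hμ.measure_compl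
    (fun z hz => ?_) (Or.inr (Finset.sum_congr rfl fun l _ => ?_))
  · have h1 := hμ.eq_potential z hz
    rw [hν.eq_potential z hz, hne j hj, sub_right_inj] at h1
    rw [← Finset.add_sum_erase _ _ (Finset.mem_univ j), h1, hne j hj,
      Finset.add_sum_erase _ (fun l => logPotential (μ l) z) (Finset.mem_univ j)]
  · by_cases hl : l = 0
    · rw [hl, hmass]
    · rw [hne l hl]

end IsPotentialRepresentation

/-! ### The main theorem -/

theorem theorem3 {n : ℕ} (Ω : Set ℂ) (hΩ : IsBoundedFinitelyConnectedDomain Ω)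
    (Γ K : Fin (n + 1) → Set ℂ) (hΓ : IsBoundaryLabelling Ω Γ K)
    (j : Fin (n + 1)) (hj : j ≠ 0) :
    ∃ μ : Fin (n + 1) → Measure ℂ,
      IsPotentialRepresentation Ω Γ j μ ∧
      (∀ ν : Fin (n + 1) → Measure ℂ, IsPotentialRepresentation Ω Γ j ν →
        (∀ k, k ≠ 0 → ν k = μ k) ∧ (ν 0 univ = μ 0 univ → ν 0 = μ 0)) ∧
      (∀ k, (μ k).support = Γ k) ∧
      (∀ k D γ, IsPeriodContour Ω (K k) D γ →
        (μ k).real univ = |period (fun z => harmonicMeasure Ω z (Γ j)) γ|) ∧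
      (∀ D γ, IsPeriodContour Ω (K j) D γ →
        0 < period (fun z => harmonicMeasure Ω z (Γ j)) γ) ∧
      (∀ k D γ, k ≠ j → IsPeriodContour Ω (K k) D γ →
        period (fun z => harmonicMeasure Ω z (Γ j)) γ < 0) := by
  obtain ⟨U, hU⟩ := hΓ.exists_dirichletSolution hΩ.isOpen j
  obtain ⟨μ, hfin, hμ, hrep, htot⟩ := hΓ.exists_measures hΩ hj hU
  have hsub : ∀ k, (μ k).support ⊆ Γ k := fun k =>
    Measure.support_subset_of_isClosed (hΓ.isClosed_boundary k) (mem_ae_iff.mpr (hμ k))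
  have hsupp : ∀ k, (μ k).support = Γ k := fun k => (hsub k).antisymm
    (hΓ.boundary_subset_support hΩ hj hU hfin hμ hrep k)
  have heq : ∀ z ∈ Ω, harmonicMeasure Ω z (Γ j) =
      ∑ k, componentSign j k * logPotential (μ k) z := fun z hz => by
    rw [hΓ.harmonicMeasure_eq hΩ hU hz]
    exact hrep z fun k hk => hΓ.fill_subset_compl k (hΓ.boundary_subset_fill hΩ.isOpen k hk) hz
  have hμrep : IsPotentialRepresentation Ω Γ j μ :=
    ⟨hfin, hsub, fun z hz => by rw [heq z hz, sum_componentSign_mul]⟩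
  have hper : ∀ k D γ, IsPeriodContour Ω (K k) D γ →
      period (fun z => harmonicMeasure Ω z (Γ j)) γ = componentSign j k * (μ k).real univ :=
    fun k D γ hD => hΓ.period_eq hΩ hfin hμ heq htot hD
  have hpos : ∀ k, 0 < (μ k).real univ := fun k => by
    have := hfin k
    refine measureReal_nonneg.lt_of_ne' fun h0 => ?_
    rw [measureReal_eq_zero_iff, Measure.measure_univ_eq_zero] at h0
    have h1 := hsupp k
    rw [h0, Measure.support_zero] at h1
    exact (hΓ.boundary_mem k).2.nonempty.ne_empty h1.symm
  refine ⟨μ, hμrep, fun ν hν => ⟨fun k hk => hμrep.eq_of_ne_zero hν hΓ hΩ hk,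
    hμrep.eq_zero_of_mass_eq hν hΓ hΩ hj⟩, hsupp, fun k D γ hD => ?_, fun D γ hD => ?_,
    fun k D γ hk hD => ?_⟩
  · rw [hper k D γ hD, abs_mul, abs_of_pos (hpos k)]
    unfold componentSign
    split_ifs <;> simp
  · rw [hper j D γ hD, componentSign_self, one_mul]
    exact hpos j
  · rw [hper k D γ hD, componentSign_of_ne hk, neg_one_mul, neg_lt_zero]
    exact hpos k
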